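/- Let $m\ge 3$ and let $M$ be a second countable Hausdorff smooth $m$-manifold with a conformal class $\mathcal C=\{f g : f\in C^\infty(M),\ f>0\}$ of smooth Lorentzian metrics of signature $(-,+,\dots,+)$, time-oriented by a smooth timelike vector field $T$, and strongly causal. A light ray $\Gamma\subset M$ is the image of an inextensible null geodesic of some $g\in\mathcal C$. A parametrisation of an arc of $\Gamma$ is a smooth curve $\gamma\colon I\to M$ on an open interval with $\gamma(I)\subset\Gamma$, $\dot\gamma\ne 0$ and $g(\dot\gamma,T)<0$. For such $\gamma$ and $t\in I$ put $$R_\gamma(t)\colon \dot\gamma(t)^\perp/\langle\dot\gamma(t)\rangle\to\dot\gamma(t)^\perp/\langle\dot\gamma(t)\rangle,\qquad R_\gamma(t)\langle w\rangle=\langle R(\dot\gamma(t),w)\dot\gamma(t)\rangle,$$ where $R(X,Y)=[\nabla_X,\nabla_Y]-\nabla_{[X,Y]}$ is the curvature of a metric $g\in\mathcal C$ for which $\gamma$ is an (affinely parametrised) geodesic near $t$. Put $\mathrm{Ric}_\gamma=\operatorname{tr}R_\gamma$ and $\zeta_\gamma=|\det R_\gamma|^{1/(2(m-2))}$, and call $\gamma$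 projective if $\mathrm{Ric}_\gamma=0$ on $I$. Let $\Gamma$ be a light ray of $M$. Then: 1. For every parametrisation $\gamma$ of an arc of $\Gamma$ and every $t\in I$, a metric $g\in\mathcal C$ for which $\gamma$ is a geodesic near $t$ exists, and $R_\gamma(t)$ does not depend on its choice. Every point of $\Gamma$ lies on an arc of $\Gamma$ with a projective parametrisation. 2. If a segment $\Gamma_0\subset\Gamma$ can be written as $\Gamma_0=\gamma_P([a,b])$, $a\le b$, $[a,b]\subset I$, with $\gamma_P\colon I\to M$ a projective parametrisation of an arc of $\Gamma$, then $\zeta_{\gamma_P}$ is integrable on $[a,b]$ and $$L(\Gamma_0)=\int_a^b\zeta_{\gamma_P}(t)\,dt=\int_a^b|\det R_{\gamma_P}(t)|^{1/(2(m-2))}\,dt$$ does not depend on the choice of $\gamma_P$, $a$, $b$. 3. If $\phi\colon M\to M'$ is a conformal diffeomorphism (a diffeomorphism with $\phi^*g'\in\mathcal C$ for all $g'\in\mathcal C'$, not assumed to preserve the time orientation) onto another such spacetime $(M',\mathcal C',T')$, then $\phi(\Gamma)$ is a light ray of $M'$, and for every segment $\Gamma_0\subset\Gamma$ as in 2, $\phi(\Gamma_0)\subset\phi(\Gamma)$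 is again such a segment and $L(\phi(\Gamma_0))=L(\Gamma_0)$. 4. There is a 1-form $ds_\Gamma$ along $\Gamma$ with $ds_\Gamma(\dot\gamma_P(t))=\zeta_{\gamma_P}(t)$ for every projective parametrisation $\gamma_P$ of an arc of $\Gamma$. It is unique on vectors tangent to $\Gamma$, and in an arbitrary parametrisation $\gamma$ of an arc of $\Gamma$ it is $$ds_\Gamma=\Bigl|\det\Bigl(R_\gamma(t)-\tfrac{1}{m-2}\mathrm{Ric}_\gamma(t)\,\mathrm{Id}\Bigr)\Bigr|^{1/(2(m-2))}dt .$$ For every such $\gamma\colon I\to M$ and $[a,b]\subset I$ its pull-back is integrable on $[a,b]$, and if $\Gamma_0=\gamma([a,b])$ is a segment as in 2, then $L(\Gamma_0)=\int_a^b ds_\Gamma(\dot\gamma(t))\,dt$. 5. If $\gamma\colon I\to M$ parametrises an arc of $\Gamma$ on which $ds_\Gamma\neq 0$ and $t_0\in I$, then $s(t)=\int_{t_0}^t ds_\Gamma(\dot\gamma(\tau))\,d\tau$ is a conformal arc parameter: there is a parametrisation $\gamma_C\colon J\to M$ of the same arc with $ds_\Gamma(\dot\gamma_C)=1$ and $\gamma_C(s(t))=\gamma(t)$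 for $t\in I$. Two parametrisations $\gamma_1\colon J_1\to M$, $\gamma_2\colon J_2\to M$ of the same arc with $ds_\Gamma(\dot\gamma_i)=1$ differ by a translation: there is $c\in\mathbb R$ with $J_2=J_1+c$ and $\gamma_2(s+c)=\gamma_1(s)$ for $s\in J_1$. -/

import Mathlib

open Set Filter Topology MeasureTheory
open scoped Manifold ContDiff

set_option maxSynthPendingDepth 3

noncomputable section

namespace LightRay

/-! ### Levi-Civita calculus of a metric on a coordinate domain -/

section Coordinates

variable {E : Type*} [NormedAddCommGroup E] [NormedSpace ℝ E]

/-- `koszul G y u v w = ∂_u G(v, w) + ∂_v G(u, w) - ∂_w G(u, v)` at the point `y`,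
for constant vectors `u v w`. -/
def koszul (G : E → E →L[ℝ] E →L[ℝ] ℝ) (y : E) : E →L[ℝ] E →L[ℝ] E →L[ℝ] ℝ :=
  fderiv ℝ G y + (fderiv ℝ G y).flip
    - (ContinuousLinearMap.flipₗᵢ ℝ E E ℝ).toContinuousLinearEquiv.toContinuousLinearMap.comp
        (fderiv ℝ G y).flip

/-- Christoffel symbols of the Levi-Civita connection of `G`:
`2 G (christoffel G y u v, w) = koszul G y u v w` where `G y` is non-degenerate. -/
def christoffel (G : E → E →L[ℝ] E →L[ℝ] ℝ) (y : E) : E →L[ℝ] E →L[ℝ] E :=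
  (2⁻¹ : ℝ) •
    (ContinuousLinearMap.compL ℝ E (E →L[ℝ] ℝ) E (G y).inverse).comp (koszul G y)

/-- The Riemann curvature `R(u, v) w = ∇_u ∇_v w - ∇_v ∇_u w - ∇_[u,v] w`
of the metric `G` at the point `y`. -/
def riemann (G : E → E →L[ℝ] E →L[ℝ] ℝ) (y u v w : E) : E :=
  fderiv ℝ (christoffel G) y u v w - fderiv ℝ (christoffel G) y v u w
    + christoffel G y u (christoffel G y v w) - christoffel G y v (christoffel G y u w)

/-- The linear map `w ↦ R(u, w) u`. -/
def jacobiMap (G : E → E →L[ℝ] E →L[ℝ] ℝ) (y u : E) : E →ₗ[ℝ] E where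
  toFun w := riemann G y u w u
  map_add' a b := by
    simp only [riemann, map_add, add_apply]
    abel
  map_smul' c a := by
    simp only [riemann, map_smul, smul_apply, RingHom.id_apply, smul_sub, smul_add]

lemma koszul_apply (G : E → E →L[ℝ] E →L[ℝ] ℝ) (y u v w : E) :
    koszul G y u v w = fderiv ℝ G y u v w + fderiv ℝ G y v u w - fderiv ℝ G y w u v := by
  simp [koszul]

lemma riemann_self (G : E → E →L[ℝ] E →L[ℝ] ℝ) (y u w : E) : riemann G y u u w = 0 := by
  simp [riemann]

lemma two_mul_christoffel {G : E → E →L[ℝ] E →L[ℝ] ℝ} {y : E} (h : (G y).IsInvertible)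
    (u v w : E) : 2 * G y (christoffel G y u v) w = koszul G y u v w := by
  obtain ⟨e, he⟩ := h
  simp [christoffel, ← he]

lemma fderiv_eq_christoffel {G : E → E →L[ℝ] E →L[ℝ] ℝ} {y : E} (h : (G y).IsInvertible)
    (hs : ∀ᶠ z in 𝓝 y, ∀ u v, G z u v = G z v u) (hd : DifferentiableAt ℝ G y) (u v w : E) :
    fderiv ℝ G y u v w = G y (christoffel G y u v) w + G y (christoffel G y u w) v := by
  have hsym : ∀ a b c, fderiv ℝ G y a b c = fderiv ℝ G y a c b := by
    intro a b c
    have h1 : HasFDerivAt (fun z => G z b c) _ y :=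
      (hd.hasFDerivAt.clm_apply (hasFDerivAt_const b y)).clm_apply (hasFDerivAt_const c y)
    have h2 : HasFDerivAt (fun z => G z c b) _ y :=
      (hd.hasFDerivAt.clm_apply (hasFDerivAt_const c y)).clm_apply (hasFDerivAt_const b y)
    have h3 := h1.congr_of_eventuallyEq (f₁ := fun z => G z c b)
      (by filter_upwards [hs] with z hz using hz c b)
    have := congrArg (fun L => L a) (h3.unique h2)
    simpa using this
  have h1 := two_mul_christoffel h u v w
  have h2 := two_mul_christoffel h u w v
  rw [koszul_apply] at h1 h2
  have e1 := hsym u v w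
  have e2 := hsym v u w
  have e3 := hsym w u v
  linarith

/-- Skew-symmetry of the curvature endomorphism: `G(R(u, v) w, w) = 0`. -/
lemma riemann_skew {G : E → E →L[ℝ] E →L[ℝ] ℝ} {y : E}
    (h : ∀ᶠ z in 𝓝 y, (G z).IsInvertible)
    (hs : ∀ᶠ z in 𝓝 y, ∀ u v, G z u v = G z v u) (hG : ContDiffAt ℝ ∞ G y)
    [CompleteSpace E] (u v w : E) : G y (riemann G y u v w) w = 0 := by
  have hG' : ContDiffAt ℝ ∞ (fderiv ℝ G) y := hG.fderiv_right (by simp)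
  have hdG : DifferentiableAt ℝ G y := hG.differentiableAt (by simp)
  have hddG : DifferentiableAt ℝ (fderiv ℝ G) y := hG'.differentiableAt (by simp)
  have hK : DifferentiableAt ℝ (koszul G) y := by
    have hfl : DifferentiableAt ℝ (fun z => (fderiv ℝ G z).flip) y :=
      ((ContinuousLinearMap.flipₗᵢ ℝ E E (E →L[ℝ] ℝ)).differentiableAt).comp y hddG
    unfold koszul
    exact (hddG.add hfl).sub ((differentiableAt_const _).clm_comp hfl)
  have hinv : DifferentiableAt ℝ (fun z => (G z).inverse) y :=
    DifferentiableAt.comp y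
      ((ContinuousLinearMap.IsInvertible.contDiffAt_map_inverse (n := 1)
        h.self_of_nhds).differentiableAt (by simp)) hdG
  have hΓ : DifferentiableAt ℝ (christoffel G) y := by
    unfold christoffel
    have hc : DifferentiableAt ℝ
        (fun z => ContinuousLinearMap.compL ℝ E (E →L[ℝ] ℝ) E (G z).inverse) y :=
      (ContinuousLinearMap.compL ℝ E (E →L[ℝ] ℝ) E).differentiableAt.comp y hinv
    exact (hc.clm_comp hK).const_smul (2⁻¹ : ℝ)
  have key : ∀ a b : E, fderiv ℝ (fderiv ℝ G) y a b w w
      = 2 * (fderiv ℝ G y a (christoffel G y b w) w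
        + G y (fderiv ℝ (christoffel G) y a b w) w) := by
    intro a b
    have hev : ∀ᶠ z in 𝓝 y, fderiv ℝ G z b w w = 2 * G z (christoffel G z b w) w := by
      filter_upwards [h.eventually_nhds, hs.eventually_nhds, h, hs,
        (hG.of_le (m := 1) (mod_cast le_top)).eventually (by simp)] with z _ hz2 hz3 _ hz5
      rw [fderiv_eq_christoffel hz3 hz2 (hz5.differentiableAt (by simp))]
      ring
    have h1 : HasFDerivAt (fun z => fderiv ℝ G z b w w) _ y :=
      ((hddG.hasFDerivAt.clm_apply (hasFDerivAt_const b y)).clm_apply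
        (hasFDerivAt_const w y)).clm_apply (hasFDerivAt_const w y)
    have h2 : HasFDerivAt (fun z => 2 * G z (christoffel G z b w) w) _ y :=
      ((hdG.hasFDerivAt.clm_apply ((hΓ.hasFDerivAt.clm_apply
        (hasFDerivAt_const b y)).clm_apply (hasFDerivAt_const w y))).clm_apply
        (hasFDerivAt_const w y)).const_mul 2
    have h3 := (h2.congr_of_eventuallyEq hev).unique h1
    have := congrArg (fun L => L a) h3
    simp at this
    linarith
  have hsym : fderiv ℝ (fderiv ℝ G) y u v = fderiv ℝ (fderiv ℝ G) y v u :=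
    ((hG.of_le (m := 2) (WithTop.coe_le_coe.2 le_top)).isSymmSndFDerivAt (by simp)).eq u v
  have k1 := key u v
  have k2 := key v u
  rw [hsym] at k1
  have c1 := fderiv_eq_christoffel h.self_of_nhds hs hdG u (christoffel G y v w) w
  have c2 := fderiv_eq_christoffel h.self_of_nhds hs hdG v (christoffel G y u w) w
  have s := hs.self_of_nhds (christoffel G y u w) (christoffel G y v w)
  simp only [riemann, map_add, map_sub, add_apply, sub_apply]
  linarith

end Coordinates

/-! ### Lorentzian metrics -/

/-- The model space `ℝ^m`. -/
abbrev Model (m : ℕ) := EuclideanSpace ℝ (Fin m)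

section Manifold

variable {m : ℕ} {M : Type*} [TopologicalSpace M] [ChartedSpace (Model m) M]

/-- The coordinate expression, in the chart `e`, of a field `b` of bilinear forms on the
tangent spaces of `M`: `(y, u, v) ↦ b (e.symm y) (d(e.symm) u, d(e.symm) v)`. -/
def chartForm (b : ∀ x : M, TangentSpace 𝓘(ℝ, Model m) x →L[ℝ]
      TangentSpace 𝓘(ℝ, Model m) x →L[ℝ] ℝ)
    (e : OpenPartialHomeomorph M (Model m)) (y : Model m) : Model m →L[ℝ] Model m →L[ℝ] ℝ :=
  let B : Model m →L[ℝ] Model m →L[ℝ] ℝ := b (e.symm y)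
  let D : Model m →L[ℝ] Model m := mfderiv 𝓘(ℝ, Model m) 𝓘(ℝ, Model m) e.symm y
  B.bilinearComp D D

variable (m M) in
/-- A smooth Lorentzian metric of signature `(-, +, …, +)` on the `m`-manifold `M`. -/
structure LorentzMetric where
  /-- the scalar product on each tangent space -/
  val : ∀ x : M, TangentSpace 𝓘(ℝ, Model m) x →L[ℝ] TangentSpace 𝓘(ℝ, Model m) x →L[ℝ] ℝ
  symm : ∀ x u v, val x u v = val x v u
  /-- signature: there is a negative vector whose orthogonal complement is positive definite -/
  lorentzian : ∀ x, ∃ v, val x v v < 0 ∧ ∀ w, val x v w = 0 → w ≠ 0 → 0 < val x w w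
  /-- the components of the metric are smooth in all charts of the atlas -/
  smooth : ∀ e ∈ atlas (Model m) M, ContDiffOn ℝ ∞ (chartForm val e) e.target

/-- The metric `g` in the coordinates given by the preferred chart at `x`. -/
def LorentzMetric.local (g : LorentzMetric m M) (x : M) :
    Model m → Model m →L[ℝ] Model m →L[ℝ] ℝ :=
  chartForm g.val (chartAt (Model m) x)

/-- The endomorphism `w ↦ R(v, w) v` of `T_x M`, with `R` the curvature of `g`
(computed in the chart at `x`). -/
def LorentzMetric.jacobi (g : LorentzMetric m M) (x : M) (v : TangentSpace 𝓘(ℝ, Model m) x) :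
    TangentSpace 𝓘(ℝ, Model m) x →ₗ[ℝ] TangentSpace 𝓘(ℝ, Model m) x :=
  let e := chartAt (Model m) x
  let D : Model m →L[ℝ] Model m := mfderiv 𝓘(ℝ, Model m) 𝓘(ℝ, Model m) e x
  let D' : Model m →L[ℝ] Model m := mfderiv 𝓘(ℝ, Model m) 𝓘(ℝ, Model m) e.symm (e x)
  D'.toLinearMap ∘ₗ jacobiMap (g.local x) (e x) (D v) ∘ₗ D.toLinearMap

lemma LorentzMetric.nondegenerate (g : LorentzMetric m M) (x : M)
    (a : TangentSpace 𝓘(ℝ, Model m) x) (h : ∀ b, g.val x a b = 0) : a = 0 := by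
  obtain ⟨v, _, hv⟩ := g.lorentzian x
  by_contra ha
  have := hv a (by rw [g.symm]; exact h v) ha
  rw [h a] at this
  exact lt_irrefl _ this

lemma LorentzMetric.jacobi_self (g : LorentzMetric m M) (x : M)
    (v : TangentSpace 𝓘(ℝ, Model m) x) : g.jacobi x v v = 0 := by
  let e := chartAt (Model m) x
  let D : Model m →L[ℝ] Model m := mfderiv 𝓘(ℝ, Model m) 𝓘(ℝ, Model m) e x
  let D' : Model m →L[ℝ] Model m := mfderiv 𝓘(ℝ, Model m) 𝓘(ℝ, Model m) e.symm (e x)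
  exact (congrArg D' (riemann_self (g.local x) (e x) (D v) (D v))).trans (map_zero D')

lemma LorentzMetric.local_isInvertible [IsManifold 𝓘(ℝ, Model m) ∞ M] (g : LorentzMetric m M)
    (x : M) {y : Model m} (hy : y ∈ (chartAt (Model m) x).target) :
    (g.local x y).IsInvertible := by
  set e := chartAt (Model m) x with he
  have hmem : e ∈ atlas (Model m) M := chart_mem_atlas _ _
  have hmd : e.MDifferentiable 𝓘(ℝ, Model m) 𝓘(ℝ, Model m) :=
    have : IsManifold 𝓘(ℝ, Model m) 1 M := IsManifold.of_le (n := ∞) (by simp)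
    mdifferentiable_of_mem_atlas hmem
  have hsurj : Function.Surjective
      (mfderiv 𝓘(ℝ, Model m) 𝓘(ℝ, Model m) e.symm y) := hmd.symm.mfderiv_surjective hy
  have hinj : Function.Injective
      (mfderiv 𝓘(ℝ, Model m) 𝓘(ℝ, Model m) e.symm y) := hmd.symm.mfderiv_injective hy
  have hG : Function.Injective (g.local x y).toLinearMap := by
    rw [← LinearMap.ker_eq_bot, LinearMap.ker_eq_bot']
    intro p hp
    have h0 : mfderiv 𝓘(ℝ, Model m) 𝓘(ℝ, Model m) e.symm y p = 0 := by
      apply g.nondegenerate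
      intro b
      obtain ⟨q, rfl⟩ := hsurj b
      exact congrArg (fun L : Model m →L[ℝ] ℝ => L q) hp
    exact hinj (h0.trans (map_zero _).symm)
  have hdim : Module.finrank ℝ (Model m) = Module.finrank ℝ (Model m →L[ℝ] ℝ) := by
    rw [← LinearEquiv.finrank_eq
      (LinearMap.toContinuousLinearMap : (Model m →ₗ[ℝ] ℝ) ≃ₗ[ℝ] (Model m →L[ℝ] ℝ))]
    exact (Subspace.dual_finrank_eq (K := ℝ) (V := Model m)).symm
  refine ⟨(LinearEquiv.ofBijective (g.local x y).toLinearMap ⟨hG,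
    (LinearMap.injective_iff_surjective_of_finrank_eq_finrank hdim).1 hG⟩
      ).toContinuousLinearEquiv, ?_⟩
  ext p q
  rfl

lemma LorentzMetric.jacobi_orthogonal [IsManifold 𝓘(ℝ, Model m) ∞ M] (g : LorentzMetric m M)
    (x : M) (v w : TangentSpace 𝓘(ℝ, Model m) x) : g.val x v (g.jacobi x v w) = 0 := by
  set e := chartAt (Model m) x with he
  have hmem : e ∈ atlas (Model m) M := chart_mem_atlas _ _
  have hx : x ∈ e.source := mem_chart_source _ _
  have hmd : e.MDifferentiable 𝓘(ℝ, Model m) 𝓘(ℝ, Model m) :=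
    have : IsManifold 𝓘(ℝ, Model m) 1 M := IsManifold.of_le (n := ∞) (by simp)
    mdifferentiable_of_mem_atlas hmem
  have hy : e x ∈ e.target := e.map_source hx
  have hnhds : e.target ∈ 𝓝 (e x) := e.open_target.mem_nhds hy
  let D : Model m →L[ℝ] Model m := mfderiv 𝓘(ℝ, Model m) 𝓘(ℝ, Model m) e x
  let D' : Model m →L[ℝ] Model m := mfderiv 𝓘(ℝ, Model m) 𝓘(ℝ, Model m) e.symm (e x)
  have hD : ∀ a : Model m, D' (D a) = a := fun a =>
    congrArg (fun L : Model m →L[ℝ] Model m => L a) (hmd.symm_comp_deriv hx)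
  have : ∀ p : M, p = x → (g.val p : Model m →L[ℝ] Model m →L[ℝ] ℝ) = g.val x := by
    rintro _ rfl
    rfl
  have hval : (g.val (e.symm (e x)) : Model m →L[ℝ] Model m →L[ℝ] ℝ) = g.val x :=
    this _ (e.left_inv hx)
  have hloc : ∀ p q : Model m,
      g.local x (e x) p q = (g.val x : Model m →L[ℝ] Model m →L[ℝ] ℝ) (D' p) (D' q) := by
    intro p q
    rw [← hval]
    rfl
  have hskew := riemann_skew (G := g.local x) (y := e x)
    (by filter_upwards [hnhds] with z hz using g.local_isInvertible x hz)
    (Eventually.of_forall fun z a b => g.symm _ _ _)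
    ((g.smooth e hmem).contDiffAt hnhds) (D v) (D w) (D v)
  rw [g.symm]
  exact (congrArg (fun z : Model m => (g.val x : Model m →L[ℝ] Model m →L[ℝ] ℝ)
    (D' (riemann (g.local x) (e x) (D v) (D w) (D v))) z) (hD v)).symm.trans
    ((hloc _ _).symm.trans hskew)

/-! ### Conformal structures -/

variable (m M) in
/-- A conformal class of Lorentzian metrics: all metrics `f • g`, with `f` a smooth positive
function, for some metric `g`. -/
structure ConformalClass where
  metrics : Set (LorentzMetric m M)
  isClass : ∃ g ∈ metrics, ∀ h : LorentzMetric m M, h ∈ metrics ↔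
    ∃ f : M → ℝ, ContMDiff 𝓘(ℝ, Model m) 𝓘(ℝ, ℝ) ∞ f ∧ (∀ x, 0 < f x) ∧
      ∀ x u v, h.val x u v = f x * g.val x u v

lemma ConformalClass.proportional (C : ConformalClass m M) {g h : LorentzMetric m M}
    (hg : g ∈ C.metrics) (hh : h ∈ C.metrics) (x : M) :
    ∃ c : ℝ, 0 < c ∧ ∀ u v, h.val x u v = c * g.val x u v := by
  obtain ⟨k, -, hk⟩ := C.isClass
  obtain ⟨a, -, ha, hga⟩ := (hk g).1 hg
  obtain ⟨b, -, hb, hhb⟩ := (hk h).1 hh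
  refine ⟨b x / a x, div_pos (hb x) (ha x), fun u v => ?_⟩
  rw [hhb, hga]
  field_simp [(ha x).ne']

/-- The orthogonal complement `v^⊥` of a tangent vector (the same for all metrics of the
class). -/
def ConformalClass.perp (C : ConformalClass m M) (x : M) (v : TangentSpace 𝓘(ℝ, Model m) x) :
    Submodule ℝ (TangentSpace 𝓘(ℝ, Model m) x) where
  carrier := {w | ∀ g ∈ C.metrics, g.val x v w = 0}
  add_mem' ha hb g hg := by
    rw [map_add, ha g hg, hb g hg, add_zero]
  zero_mem' g _ := map_zero _
  smul_mem' c w hw g hg := by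
    rw [map_smul, hw g hg, smul_zero]

/-- The quotient `v^⊥ / ⟨v⟩`. -/
abbrev ConformalClass.Screen (C : ConformalClass m M) (x : M)
    (v : TangentSpace 𝓘(ℝ, Model m) x) : Type :=
  C.perp x v ⧸ (Submodule.span ℝ {v}).comap (C.perp x v).subtype

lemma ConformalClass.jacobi_mem_perp [IsManifold 𝓘(ℝ, Model m) ∞ M] (C : ConformalClass m M)
    {g : LorentzMetric m M} (hg : g ∈ C.metrics) (x : M)
    (v w : TangentSpace 𝓘(ℝ, Model m) x) : g.jacobi x v w ∈ C.perp x v := by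
  intro h hh
  obtain ⟨c, -, hc⟩ := C.proportional hg hh x
  rw [hc, g.jacobi_orthogonal, mul_zero]

/-- The endomorphism `⟨w⟩ ↦ ⟨R(v, w) v⟩` of `v^⊥ / ⟨v⟩`, with `R` the curvature of the metric `g`
of the conformal class. -/
def ConformalClass.screenCurvature [IsManifold 𝓘(ℝ, Model m) ∞ M] (C : ConformalClass m M)
    {g : LorentzMetric m M} (hg : g ∈ C.metrics) (x : M) (v : TangentSpace 𝓘(ℝ, Model m) x) :
    Module.End ℝ (C.Screen x v) :=
  Submodule.mapQ _ _
    ((g.jacobi x v).restrict (p := C.perp x v) (q := C.perp x v)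
      fun w _ => C.jacobi_mem_perp hg x v w)
    (by
      intro w hw
      obtain ⟨c, hc⟩ := Submodule.mem_span_singleton.1 (Submodule.mem_comap.1 hw)
      have h0 : g.jacobi x v (w : TangentSpace 𝓘(ℝ, Model m) x) = 0 := by
        rw [show (w : TangentSpace 𝓘(ℝ, Model m) x) = c • v from hc.symm, map_smul,
          g.jacobi_self, smul_zero]
      refine Submodule.mem_comap.2 (Submodule.mem_comap.2 ?_)
      have : (C.perp x v).subtype ((g.jacobi x v).restrict (p := C.perp x v) (q := C.perp x v)
          (fun w _ => C.jacobi_mem_perp hg x v w) w) = 0 := h0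
      rw [this]
      exact Submodule.zero_mem _)

/-! ### Curves and geodesics -/

/-- The velocity `γ'(t)`. -/
def velocity (γ : ℝ → M) (t : ℝ) : TangentSpace 𝓘(ℝ, Model m) (γ t) :=
  mfderiv 𝓘(ℝ, ℝ) 𝓘(ℝ, Model m) γ t (1 : ℝ)

/-- The geodesic equation `c'' + Γ(c', c') = 0` of the metric `g` holds at the parameter `t`,
where `c` is the curve `γ` in the chart at `γ t`. -/
def LorentzMetric.GeodesicAt (g : LorentzMetric m M) (γ : ℝ → M) (t : ℝ) : Prop :=
  let c : ℝ → Model m := fun s => chartAt (Model m) (γ t) (γ s)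
  deriv (deriv c) t + christoffel (g.local (γ t)) (c t) (deriv c t) (deriv c t) = 0

/-- `γ` restricted to the non-empty open interval `I` is a regular null geodesic of `g`. -/
structure LorentzMetric.IsNullGeodesicOn (g : LorentzMetric m M) (γ : ℝ → M) (I : Set ℝ) :
    Prop where
  isOpen : IsOpen I
  ordConnected : I.OrdConnected
  nonempty : I.Nonempty
  smooth : ContMDiffOn 𝓘(ℝ, ℝ) 𝓘(ℝ, Model m) ∞ γ I
  regular : ∀ t ∈ I, velocity (m := m) γ t ≠ 0
  null : ∀ t ∈ I, g.val (γ t) (velocity γ t) (velocity γ t) = 0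
  geodesic : ∀ t ∈ I, g.GeodesicAt γ t

/-- A light ray: the image of an inextensible null geodesic of some metric of the class. -/
def ConformalClass.IsLightRay (C : ConformalClass m M) (Γ : Set M) : Prop :=
  ∃ g ∈ C.metrics, ∃ (γ : ℝ → M) (I : Set ℝ), g.IsNullGeodesicOn γ I ∧
    (∀ (γ' : ℝ → M) (I' : Set ℝ), g.IsNullGeodesicOn γ' I' → I ⊆ I' → EqOn γ' γ I → I' ⊆ I) ∧
    γ '' I = Γ

/-- `g` is adapted to the parametrised curve `γ` near `t`: `γ` is a `g`-geodesic there. -/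
def LorentzMetric.IsAdapted (g : LorentzMetric m M) (γ : ℝ → M) (t : ℝ) : Prop :=
  ∀ᶠ s in 𝓝 t, g.GeodesicAt γ s

open Classical in
/-- The curvature `R_γ(t)`, an endomorphism of `γ'(t)^⊥ / ⟨γ'(t)⟩`: the map
`⟨w⟩ ↦ ⟨R(γ'(t), w) γ'(t)⟩` with `R` the curvature of any metric of the conformal class for which
the parametrised curve `γ` is a geodesic near `t`. -/
def ConformalClass.curvature [IsManifold 𝓘(ℝ, Model m) ∞ M] (C : ConformalClass m M)
    (γ : ℝ → M) (t : ℝ) : Module.End ℝ (C.Screen (γ t) (velocity γ t)) :=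
  if h : ∃ g, g ∈ C.metrics ∧ g.IsAdapted γ t then
    C.screenCurvature h.choose_spec.1 (γ t) (velocity γ t)
  else 0

/-- `Ric_γ(t)`, the trace of `R_γ(t)`. -/
def ConformalClass.ric [IsManifold 𝓘(ℝ, Model m) ∞ M] (C : ConformalClass m M)
    (γ : ℝ → M) (t : ℝ) : ℝ :=
  LinearMap.trace ℝ _ (C.curvature γ t)

/-- `ζ_γ(t) = |det R_γ(t)|^{1/(2(m-2))}`. -/
def ConformalClass.zeta [IsManifold 𝓘(ℝ, Model m) ∞ M] (C : ConformalClass m M)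
    (γ : ℝ → M) (t : ℝ) : ℝ :=
  |LinearMap.det (C.curvature γ t)| ^ (1 / (2 * ((m : ℝ) - 2)))

/-! ### Spacetimes -/

variable [IsManifold 𝓘(ℝ, Model m) ∞ M]

variable (m M) in
/-- A spacetime: a conformal class of Lorentzian metrics with a time orientation `T`, strongly
causal. -/
structure Spacetime extends ConformalClass m M where
  T : ∀ x : M, TangentSpace 𝓘(ℝ, Model m) x
  T_smooth : ContMDiff 𝓘(ℝ, Model m) 𝓘(ℝ, Model m).tangent ∞
    (fun x => (⟨x, T x⟩ : TangentBundle 𝓘(ℝ, Model m) M))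
  T_timelike : ∀ g ∈ metrics, ∀ x, g.val x (T x) (T x) < 0
  /-- Strong causality: every neighbourhood `U` of a point contains a neighbourhood `V` such that
  future-directed causal curve segments with end points in `V` stay in `U`. -/
  stronglyCausal : ∀ x : M, ∀ U ∈ 𝓝 x, ∃ V ∈ 𝓝 x, V ⊆ U ∧
    ∀ (γ : ℝ → M) (a b : ℝ), a ≤ b →
      (∀ t ∈ Icc a b, ContMDiffAt 𝓘(ℝ, ℝ) 𝓘(ℝ, Model m) ∞ γ t) →
      (∀ t ∈ Icc a b, ∀ g ∈ metrics, g.val (γ t) (velocity γ t) (velocity γ t) ≤ 0 ∧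
        g.val (γ t) (velocity γ t) (T (γ t)) < 0) →
      γ a ∈ V → γ b ∈ V → ∀ t ∈ Icc a b, γ t ∈ U

/-- `γ`, on the open interval `I`, is a smooth regular future-directed parametrisation of an
(open) arc of the light ray `Γ`. -/
structure Spacetime.IsParametrisation (S : Spacetime m M) (Γ : Set M) (γ : ℝ → M)
    (I : Set ℝ) : Prop where
  isOpen : IsOpen I
  ordConnected : I.OrdConnected
  smooth : ContMDiffOn 𝓘(ℝ, ℝ) 𝓘(ℝ, Model m) ∞ γ I
  regular : ∀ t ∈ I, velocity (m := m) γ t ≠ 0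
  future : ∀ t ∈ I, ∀ g ∈ S.metrics, g.val (γ t) (velocity γ t) (S.T (γ t)) < 0
  image_subset : γ '' I ⊆ Γ

/-- A projective parametrisation of an arc of `Γ`: one with `Ric_γ = 0`. -/
structure Spacetime.IsProjective (S : Spacetime m M) (Γ : Set M) (γ : ℝ → M) (I : Set ℝ) : Prop
    extends S.IsParametrisation Γ γ I where
  ric_eq_zero : ∀ t ∈ I, S.ric γ t = 0

/-- `γ` is a projective parametrisation, on the open interval `I`, of an arc of `Γ` containing the
segment `Γ₀ = γ([a, b])`. -/
structure Spacetime.IsProjectiveSegment (S : Spacetime m M) (Γ Γ₀ : Set M) (γ : ℝ → M) (I : Set ℝ)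
    (a b : ℝ) : Prop where
  projective : S.IsProjective Γ γ I
  le : a ≤ b
  subset : Icc a b ⊆ I
  image_eq : γ '' Icc a b = Γ₀

open Classical in
/-- The conformal length `L(Γ₀) = ∫_a^b ζ_γ(t) dt` of a segment `Γ₀` of the light ray `Γ`, computed
along some projective parametrisation `γ` of `Γ` with `Γ₀ = γ([a, b])`. -/
def Spacetime.conformalLength (S : Spacetime m M) (Γ Γ₀ : Set M) : ℝ :=
  if h : ∃ p : (ℝ → M) × Set ℝ × ℝ × ℝ, S.IsProjectiveSegment Γ Γ₀ p.1 p.2.1 p.2.2.1 p.2.2.2 then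
    ∫ t in h.choose.2.2.1..h.choose.2.2.2, S.zeta h.choose.1 t
  else 0

/-- The 1-form `θ` represents `ds_Γ`: along every projective parametrisation `γ` of an arc of the
light ray `Γ` its pull-back is `ζ_γ(t) dt`. (Only the values of `θ` on vectors tangent to `Γ`
matter.) -/
def Spacetime.IsArcForm (S : Spacetime m M) (Γ : Set M)
    (θ : ∀ x : M, TangentSpace 𝓘(ℝ, Model m) x →L[ℝ] ℝ) : Prop :=
  ∀ (γ : ℝ → M) (I : Set ℝ), S.IsProjective Γ γ I →
    ∀ t ∈ I, θ (γ t) (velocity γ t) = S.zeta γ t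

/-- A parametrisation `γ` of an arc of `Γ` by a conformal arc parameter `s`: the pull-back of the
1-form `θ` is `ds`. -/
structure Spacetime.IsArcParametrisation (S : Spacetime m M) (Γ : Set M)
    (θ : ∀ x : M, TangentSpace 𝓘(ℝ, Model m) x →L[ℝ] ℝ) (γ : ℝ → M) (I : Set ℝ) : Prop
    extends S.IsParametrisation Γ γ I where
  unit_speed : ∀ s ∈ I, θ (γ s) (velocity γ s) = 1

/-- A conformal diffeomorphism: the pull-back of every metric of the class of `M'` is a metric
of the class of `M`. -/
def IsConformal {M' : Type*} [TopologicalSpace M'] [ChartedSpace (Model m) M']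
    (C : ConformalClass m M) (C' : ConformalClass m M')
    (φ : Diffeomorph 𝓘(ℝ, Model m) 𝓘(ℝ, Model m) M M' ∞) : Prop :=
  ∀ g' ∈ C'.metrics, ∃ g ∈ C.metrics, ∀ x u v, g.val x u v =
    g'.val (φ x) (mfderiv 𝓘(ℝ, Model m) 𝓘(ℝ, Model m) φ x u)
      (mfderiv 𝓘(ℝ, Model m) 𝓘(ℝ, Model m) φ x v)

end Manifold

end LightRay

end

open LightRay

/-!
A light ray is the image of one future-directed null geodesic `γ₀ : I₀ → M` of one metric `g` of
the class. Strong causality makes `γ₀` a homeomorphism onto its image: applied to the complement of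
the two points `γ₀ (t₀ ± δ)`, it shows that `γ₀` comes back near `γ₀ t₀` only at parameters near
`t₀` (`Spacetime.IsFutureGeodesic.exists_nhds`). Hence every parametrisation of an arc is `γ₀ ∘ h`
for a smooth increasing function `h` (`IsReparam`,
`Spacetime.IsFutureGeodesic.exists_isReparam`), and all statements become statements about functions
of one real variable.

The remaining geometric input is the behaviour of geodesics and curvature under a conformal change
`f g`, computed in coordinates. The curve `γ₀ ∘ h` is a geodesic of `f g` if and only if `f` is a
constant multiple of `1 / h'` along it (`IsReparam.geodesicAt_iff`); near each parameter the
function `1 / h'` is the restriction of a positive function on `M` (`IsReparam.exists_isAdapted`).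
Along a null geodesic the map `w ↦ R(v, w) v` on `v^⊥ / ⟨v⟩` changes
by a multiple of the identity, which depends on the logarithmic derivative of `f` along the curve
and vanishes if that derivative does (`IsConformalFactor.jac_eq`). Three consequences carry
the theorem.

* Two adapted metrics have proportional values along the curve, with a constant ratio, so they
  define the same curvature (`ConformalClass.curvature_eq`).
* The determinant of the trace-free part of the curvature does not see multiples of the identity and
  is homogeneous of degree `2 (m - 2)` in the velocity. Its power `1 / (2 (m - 2))` is therefore the
  density of a 1-form: along `γ₀ ∘ h` it is `h'` times a fixed function of the geodesic parameter
  (`IsReparam.arcDensity_eq`). Lengths are integrals of this function, by the substitution rule, and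
  the arc parameter is its primitive.
* The Ricci term changes by the Schwarzian derivative of `h` (`IsReparam.ric_eq`), so the projective
  parameters are found by solving an ordinary differential equation
  (`Spacetime.IsFutureGeodesic.exists_projective`).

Determinants on the quotient `v^⊥ / ⟨v⟩` are compared with determinants on the whole tangent space
(`det_screen`); this yields both their smoothness along curves and their invariance under
isometries. A conformal diffeomorphism is an isometry of suitable metrics of the two classes
(`exists_isIsometry`), possibly followed by a reversal of the parameter, under which the density of
the arc form is even.
-/

set_option linter.unusedSectionVars false

noncomputable section

namespace LightRay

/-! ### Calculus of the Levi-Civita connection in coordinates -/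

section Coordinates

variable {E : Type*} [NormedAddCommGroup E] [NormedSpace ℝ E]

/-- A smooth pseudo-Riemannian metric on the open subset `U` of a vector space. -/
structure IsMetricOn (G : E → E →L[ℝ] E →L[ℝ] ℝ) (U : Set E) : Prop where
  isOpen : IsOpen U
  contDiffOn : ContDiffOn ℝ ∞ G U
  symm : ∀ z ∈ U, ∀ u v, G z u v = G z v u
  isInvertible : ∀ z ∈ U, (G z).IsInvertible

namespace IsMetricOn

variable {G : E → E →L[ℝ] E →L[ℝ] ℝ} {U : Set E} {y : E}

lemma eventually_mem (h : IsMetricOn G U) (hy : y ∈ U) : ∀ᶠ z in 𝓝 y, z ∈ U :=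
  h.isOpen.mem_nhds hy

lemma contDiffAt (h : IsMetricOn G U) (hy : y ∈ U) : ContDiffAt ℝ ∞ G y :=
  h.contDiffOn.contDiffAt (h.eventually_mem hy)

lemma differentiableAt (h : IsMetricOn G U) (hy : y ∈ U) : DifferentiableAt ℝ G y :=
  (h.contDiffAt hy).differentiableAt (by simp)

lemma fderiv_symm (h : IsMetricOn G U) (hy : y ∈ U) (a b c : E) :
    fderiv ℝ G y a b c = fderiv ℝ G y a c b := by
  have hs : ∀ᶠ z in 𝓝 y, ∀ u v, G z u v = G z v u := by
    filter_upwards [h.eventually_mem hy] with z hz using h.symm z hz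
  have hi := h.isInvertible y hy
  rw [fderiv_eq_christoffel hi hs (h.differentiableAt hy),
    fderiv_eq_christoffel hi hs (h.differentiableAt hy), add_comm]

lemma fderiv_eq (h : IsMetricOn G U) (hy : y ∈ U) (u v w : E) :
    fderiv ℝ G y u v w = G y (christoffel G y u v) w + G y (christoffel G y u w) v :=
  fderiv_eq_christoffel (h.isInvertible y hy)
    (by filter_upwards [h.eventually_mem hy] with z hz using h.symm z hz)
    (h.differentiableAt hy) u v w

lemma ext_left (h : IsMetricOn G U) (hy : y ∈ U) {a b : E} (hab : ∀ w, G y a w = G y b w) :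
    a = b := by
  obtain ⟨e, he⟩ := h.isInvertible y hy
  apply e.injective
  ext w
  simpa [← he] using hab w

lemma eq_christoffel (h : IsMetricOn G U) (hy : y ∈ U) {X u v : E}
    (hX : ∀ w, 2 * G y X w = koszul G y u v w) : X = christoffel G y u v := by
  refine h.ext_left hy fun w => ?_
  have h1 := hX w
  rw [← two_mul_christoffel (h.isInvertible y hy)] at h1
  linarith

lemma christoffel_comm (h : IsMetricOn G U) (hy : y ∈ U) (u v : E) :
    christoffel G y u v = christoffel G y v u := by
  refine h.eq_christoffel hy fun w => ?_
  rw [two_mul_christoffel (h.isInvertible y hy), koszul_apply, koszul_apply,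
    h.fderiv_symm hy w u v]
  ring

lemma contDiffOn_fderiv (h : IsMetricOn G U) : ContDiffOn ℝ ∞ (fderiv ℝ G) U :=
  h.contDiffOn.fderiv_of_isOpen h.isOpen (by simp)

variable [CompleteSpace E]

lemma contDiffOn_inverse (h : IsMetricOn G U) : ContDiffOn ℝ ∞ (fun z => (G z).inverse) U :=
  fun z hz => ((ContinuousLinearMap.IsInvertible.contDiffAt_map_inverse
    (h.isInvertible z hz)).comp z (h.contDiffAt hz)).contDiffWithinAt

lemma contDiffOn_christoffel (h : IsMetricOn G U) : ContDiffOn ℝ ∞ (christoffel G) U := by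
  have hfl : ContDiffOn ℝ ∞ (fun z => (fderiv ℝ G z).flip) U :=
    ((ContinuousLinearMap.flipₗᵢ ℝ E E (E →L[ℝ] ℝ)).contDiff).comp_contDiffOn h.contDiffOn_fderiv
  have hK : ContDiffOn ℝ ∞ (koszul G) U := by
    unfold koszul
    exact (h.contDiffOn_fderiv.add hfl).sub (contDiffOn_const.clm_comp hfl)
  unfold christoffel
  have hc : ContDiffOn ℝ ∞
      (fun z => ContinuousLinearMap.compL ℝ E (E →L[ℝ] ℝ) E (G z).inverse) U :=
    (ContinuousLinearMap.compL ℝ E (E →L[ℝ] ℝ) E).contDiff.comp_contDiffOn h.contDiffOn_inverse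
  exact (hc.clm_comp hK).const_smul (2⁻¹ : ℝ)

lemma differentiableAt_christoffel (h : IsMetricOn G U) (hy : y ∈ U) :
    DifferentiableAt ℝ (christoffel G) y :=
  (h.contDiffOn_christoffel.contDiffAt (h.eventually_mem hy)).differentiableAt (by simp)

end IsMetricOn

/-- `G` is the pull-back of the metric `G'` by the smooth map `ψ : U → U'`. -/
structure IsPullback (G G' : E → E →L[ℝ] E →L[ℝ] ℝ) (ψ : E → E) (U U' : Set E) : Prop where
  source : IsMetricOn G U
  target : IsMetricOn G' U'
  contDiffOn : ContDiffOn ℝ ∞ ψ U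
  mapsTo : MapsTo ψ U U'
  surjective : ∀ z ∈ U, Function.Surjective (fderiv ℝ ψ z)
  eq : ∀ z ∈ U, ∀ u v, G z u v = G' (ψ z) (fderiv ℝ ψ z u) (fderiv ℝ ψ z v)

namespace IsPullback

variable {G G' : E → E →L[ℝ] E →L[ℝ] ℝ} {ψ : E → E} {U U' : Set E} {y : E}

lemma contDiffOn_fderiv (h : IsPullback G G' ψ U U') : ContDiffOn ℝ ∞ (fderiv ℝ ψ) U :=
  h.contDiffOn.fderiv_of_isOpen h.source.isOpen (by simp)

lemma hasFDerivAt (h : IsPullback G G' ψ U U') (hy : y ∈ U) :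
    HasFDerivAt ψ (fderiv ℝ ψ y) y :=
  ((h.contDiffOn.contDiffAt (h.source.eventually_mem hy)).differentiableAt (by simp)).hasFDerivAt

lemma hasFDerivAt_fderiv (h : IsPullback G G' ψ U U') (hy : y ∈ U) :
    HasFDerivAt (fderiv ℝ ψ) (fderiv ℝ (fderiv ℝ ψ) y) y :=
  ((h.contDiffOn_fderiv.contDiffAt (h.source.eventually_mem hy)).differentiableAt
    (by simp)).hasFDerivAt

lemma hasFDerivAt_fderiv_fderiv (h : IsPullback G G' ψ U U') (hy : y ∈ U) :
    HasFDerivAt (fderiv ℝ (fderiv ℝ ψ)) (fderiv ℝ (fderiv ℝ (fderiv ℝ ψ)) y) y :=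
  (((h.contDiffOn_fderiv.fderiv_of_isOpen (m := ∞) h.source.isOpen (by simp)).contDiffAt
    (h.source.eventually_mem hy)).differentiableAt (by simp)).hasFDerivAt

lemma second_symm (h : IsPullback G G' ψ U U') (hy : y ∈ U) (a b : E) :
    fderiv ℝ (fderiv ℝ ψ) y a b = fderiv ℝ (fderiv ℝ ψ) y b a :=
  (((h.contDiffOn.contDiffAt (h.source.eventually_mem hy)).of_le (m := 2)
    (WithTop.coe_le_coe.2 le_top)).isSymmSndFDerivAt (by simp)).eq a b

lemma third_symm (h : IsPullback G G' ψ U U') (hy : y ∈ U) (a b c : E) :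
    fderiv ℝ (fderiv ℝ (fderiv ℝ ψ)) y a b c = fderiv ℝ (fderiv ℝ (fderiv ℝ ψ)) y b a c := by
  rw [(((h.contDiffOn_fderiv.contDiffAt (h.source.eventually_mem hy)).of_le (m := 2)
    (WithTop.coe_le_coe.2 le_top)).isSymmSndFDerivAt (by simp)).eq a b]

lemma fderiv_metric (h : IsPullback G G' ψ U U') (hy : y ∈ U) (a b c : E) :
    fderiv ℝ G y a b c =
      fderiv ℝ G' (ψ y) (fderiv ℝ ψ y a) (fderiv ℝ ψ y b) (fderiv ℝ ψ y c)
      + G' (ψ y) (fderiv ℝ (fderiv ℝ ψ) y a b) (fderiv ℝ ψ y c)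
      + G' (ψ y) (fderiv ℝ ψ y b) (fderiv ℝ (fderiv ℝ ψ) y a c) := by
  have h1 := ((h.source.differentiableAt hy).hasFDerivAt.clm_apply
    (hasFDerivAt_const b y)).clm_apply (hasFDerivAt_const c y)
  have h2 := ((((h.target.differentiableAt (h.mapsTo hy)).hasFDerivAt.comp y
    (h.hasFDerivAt hy)).clm_apply ((h.hasFDerivAt_fderiv hy).clm_apply
      (hasFDerivAt_const b y))).clm_apply ((h.hasFDerivAt_fderiv hy).clm_apply
      (hasFDerivAt_const c y)))
  have h3 := (h2.congr_of_eventuallyEq (f₁ := fun z => G z b c) (by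
    filter_upwards [h.source.eventually_mem hy] with z hz using h.eq z hz b c)).unique h1
  have := congrArg (fun L => L a) h3
  simp at this
  linarith

/-- Transformation law of the Christoffel symbols. -/
lemma christoffel_eq (h : IsPullback G G' ψ U U') (hy : y ∈ U) (u v : E) :
    fderiv ℝ ψ y (christoffel G y u v) =
      christoffel G' (ψ y) (fderiv ℝ ψ y u) (fderiv ℝ ψ y v) + fderiv ℝ (fderiv ℝ ψ) y u v := by
  refine h.target.ext_left (h.mapsTo hy) fun w' => ?_
  obtain ⟨w, rfl⟩ := h.surjective y hy w'
  rw [← h.eq y hy]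
  have h1 := two_mul_christoffel (h.source.isInvertible y hy) u v w
  have h2 := two_mul_christoffel (h.target.isInvertible _ (h.mapsTo hy)) (fderiv ℝ ψ y u)
    (fderiv ℝ ψ y v) (fderiv ℝ ψ y w)
  rw [koszul_apply] at h1 h2
  rw [h.fderiv_metric hy, h.fderiv_metric hy, h.fderiv_metric hy] at h1
  have s1 := h.second_symm hy u v
  have s2 := h.second_symm hy u w
  have s3 := h.second_symm hy v w
  have t1 := h.target.symm _ (h.mapsTo hy) (fderiv ℝ ψ y u) (fderiv ℝ (fderiv ℝ ψ) y w v)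
  have t2 := h.target.symm _ (h.mapsTo hy) (fderiv ℝ ψ y v) (fderiv ℝ (fderiv ℝ ψ) y w u)
  rw [s1, s2, s3] at h1
  rw [map_add, add_apply, s1]
  linarith

variable [CompleteSpace E]

/-- The curvature tensor is natural. -/
lemma riemann_eq (h : IsPullback G G' ψ U U') (hy : y ∈ U) (u v w : E) :
    fderiv ℝ ψ y (riemann G y u v w) =
      riemann G' (ψ y) (fderiv ℝ ψ y u) (fderiv ℝ ψ y v) (fderiv ℝ ψ y w) := by
  -- the derivative of the transformation law of the Christoffel symbols
  have key : ∀ a b c : E,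
      fderiv ℝ (fderiv ℝ ψ) y a (christoffel G y b c)
        + fderiv ℝ ψ y (fderiv ℝ (christoffel G) y a b c) =
      fderiv ℝ (christoffel G') (ψ y) (fderiv ℝ ψ y a) (fderiv ℝ ψ y b) (fderiv ℝ ψ y c)
      + christoffel G' (ψ y) (fderiv ℝ (fderiv ℝ ψ) y a b) (fderiv ℝ ψ y c)
      + christoffel G' (ψ y) (fderiv ℝ ψ y b) (fderiv ℝ (fderiv ℝ ψ) y a c)
      + fderiv ℝ (fderiv ℝ (fderiv ℝ ψ)) y a b c := by
    intro a b c
    have h1 := (h.hasFDerivAt_fderiv hy).clm_apply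
      (((h.source.differentiableAt_christoffel hy).hasFDerivAt.clm_apply
        (hasFDerivAt_const b y)).clm_apply (hasFDerivAt_const c y))
    have h2 := (((((h.target.differentiableAt_christoffel (h.mapsTo hy)).hasFDerivAt.comp y
      (h.hasFDerivAt hy)).clm_apply ((h.hasFDerivAt_fderiv hy).clm_apply
        (hasFDerivAt_const b y))).clm_apply ((h.hasFDerivAt_fderiv hy).clm_apply
        (hasFDerivAt_const c y)))).add
        (((h.hasFDerivAt_fderiv_fderiv hy).clm_apply (hasFDerivAt_const b y)).clm_apply
          (hasFDerivAt_const c y))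
    have h3 := (h2.congr_of_eventuallyEq
      (f₁ := fun z => fderiv ℝ ψ z (christoffel G z b c)) (by
      filter_upwards [h.source.eventually_mem hy] with z hz using h.christoffel_eq hz b c)).unique
        h1
    have := congrArg (fun L => L a) h3
    simp at this
    rw [add_comm, ← this]
    abel
  have k1 := key u v w
  have k2 := key v u w
  have e1 := h.christoffel_eq hy u (christoffel G y v w)
  have e2 := h.christoffel_eq hy v (christoffel G y u w)
  rw [h.christoffel_eq hy v w, map_add] at e1
  rw [h.christoffel_eq hy u w, map_add] at e2
  rw [h.third_symm hy v u w, h.second_symm hy v u] at k2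
  rw [← eq_sub_iff_add_eq'] at k1 k2
  simp only [riemann, map_add, map_sub, k1, k2, e1, e2]
  abel

end IsPullback

/-! ### Conformal change in coordinates -/

/-- The vector dual to the covector `a` with respect to the metric `G`. -/
def sharp (G : E → E →L[ℝ] E →L[ℝ] ℝ) (a : E → E →L[ℝ] ℝ) (z : E) : E := (G z).inverse (a z)

/-- `Gh = f G` on `U`, with `f` smooth and positive. -/
structure IsConformalChange (G Gh : E → E →L[ℝ] E →L[ℝ] ℝ) (f : E → ℝ) (U : Set E) : Prop where
  left : IsMetricOn G U
  right : IsMetricOn Gh U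
  contDiffOn : ContDiffOn ℝ ∞ f U
  pos : ∀ z ∈ U, 0 < f z
  eq : ∀ z ∈ U, ∀ u v, Gh z u v = f z * G z u v

/-- The logarithmic derivative `df / (2 f)`, that is `du` for `f = exp (2 u)`. -/
def halfDLog (f : E → ℝ) (z : E) : E →L[ℝ] ℝ := (2 * f z)⁻¹ • fderiv ℝ f z

namespace IsConformalChange

variable {G Gh : E → E →L[ℝ] E →L[ℝ] ℝ} {f : E → ℝ} {U : Set E} {y : E}

lemma contDiffOn_halfDLog (h : IsConformalChange G Gh f U) : ContDiffOn ℝ ∞ (halfDLog f) U := by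
  unfold halfDLog
  refine ContDiffOn.smul (ContDiffOn.inv (contDiffOn_const.mul h.contDiffOn) fun z hz => ?_)
    (h.contDiffOn.fderiv_of_isOpen h.left.isOpen (by simp))
  have := h.pos z hz
  positivity

lemma apply_sharp (h : IsConformalChange G Gh f U) (hy : y ∈ U) (a : E → E →L[ℝ] ℝ) :
    G y (sharp G a y) = a y := by
  obtain ⟨e, he⟩ := h.left.isInvertible y hy
  simp [sharp, ← he]

/-- The Christoffel symbols of the metric `f G`. -/
lemma christoffel_eq (h : IsConformalChange G Gh f U) (hy : y ∈ U) (u v : E) :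
    christoffel Gh y u v = christoffel G y u v + halfDLog f y u • v + halfDLog f y v • u
      - G y u v • sharp G (halfDLog f) y := by
  symm
  refine h.right.eq_christoffel hy fun w => ?_
  have hf := h.pos y hy
  have hfd : HasFDerivAt f (fderiv ℝ f y) y := ((h.contDiffOn.contDiffAt
    (h.left.eventually_mem hy)).differentiableAt (by simp)).hasFDerivAt
  have hd : ∀ a b c, fderiv ℝ Gh y a b c = f y * fderiv ℝ G y a b c + fderiv ℝ f y a * G y b c := by
    intro a b c
    have h1 := ((h.right.differentiableAt hy).hasFDerivAt.clm_apply
      (hasFDerivAt_const b y)).clm_apply (hasFDerivAt_const c y)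
    have h2 := hfd.mul (((h.left.differentiableAt hy).hasFDerivAt.clm_apply
      (hasFDerivAt_const b y)).clm_apply (hasFDerivAt_const c y))
    have h3 := (h2.congr_of_eventuallyEq (f₁ := fun z => Gh z b c) (by
      filter_upwards [h.left.eventually_mem hy] with z hz using h.eq z hz b c)).unique h1
    have := congrArg (fun L => L a) h3
    simp at this
    rw [← this]
    ring
  have hk := two_mul_christoffel (h.left.isInvertible y hy) u v w
  rw [koszul_apply] at hk
  rw [koszul_apply, hd, hd, hd, h.eq y hy]
  simp only [map_add, map_sub, map_smul, add_apply, sub_apply, smul_apply, smul_eq_mul,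
    h.apply_sharp hy]
  have ha : ∀ x, halfDLog f y x = (2 * f y)⁻¹ * fderiv ℝ f y x := fun x => rfl
  rw [ha, ha, ha]
  have e : ∀ x, 2 * (f y * ((2 * f y)⁻¹ * x)) = x := fun x => by field_simp
  have e1 := e (fderiv ℝ f y u * G y v w)
  have e2 := e (fderiv ℝ f y v * G y u w)
  have e3 := e (fderiv ℝ f y w * G y u v)
  linear_combination f y * hk + e1 + e2 - e3

variable [CompleteSpace E]

/-- Conformal change of the curvature along a null vector `k`: on `k^⊥`, modulo `k`, the map
`w ↦ R(k, w) k` changes by a multiple of the identity. -/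
lemma riemann_eq (h : IsConformalChange G Gh f U) (hy : y ∈ U) {k w : E} (hk : G y k k = 0)
    (hw : G y k w = 0) : ∃ β : ℝ, riemann Gh y k w k = riemann G y k w k
      + (fderiv ℝ (halfDLog f) y k k - halfDLog f y (christoffel G y k k)
          - halfDLog f y k ^ 2) • w + β • k := by
  set a := halfDLog f with ha
  set s := sharp G a with hs
  have hda : HasFDerivAt a (fderiv ℝ a y) y := ((h.contDiffOn_halfDLog.contDiffAt
    (h.left.eventually_mem hy)).differentiableAt (by simp)).hasFDerivAt
  have hds : HasFDerivAt s (fderiv ℝ s y) y := by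
    have : ContDiffOn ℝ ∞ s U := h.left.contDiffOn_inverse.clm_apply h.contDiffOn_halfDLog
    exact ((this.contDiffAt (h.left.eventually_mem hy)).differentiableAt (by simp)).hasFDerivAt
  have hdG := (h.left.differentiableAt hy).hasFDerivAt
  -- the derivative of the formula for `christoffel Gh`
  have key : ∀ x u v : E, fderiv ℝ (christoffel Gh) y x u v = fderiv ℝ (christoffel G) y x u v
      + fderiv ℝ a y x u • v + fderiv ℝ a y x v • u - fderiv ℝ G y x u v • s y
      - G y u v • fderiv ℝ s y x := by
    intro x u v
    have h1 := ((h.right.differentiableAt_christoffel hy).hasFDerivAt.clm_apply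
      (hasFDerivAt_const u y)).clm_apply (hasFDerivAt_const v y)
    have h2 := ((((h.left.differentiableAt_christoffel hy).hasFDerivAt.clm_apply
      (hasFDerivAt_const u y)).clm_apply (hasFDerivAt_const v y)).add
      ((hda.clm_apply (hasFDerivAt_const u y)).smul (hasFDerivAt_const v y))).add
      ((hda.clm_apply (hasFDerivAt_const v y)).smul (hasFDerivAt_const u y)) |>.sub
      (((hdG.clm_apply (hasFDerivAt_const u y)).clm_apply (hasFDerivAt_const v y)).smul hds)
    have h3 := (h2.congr_of_eventuallyEq (f₁ := fun z => christoffel Gh z u v) (by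
      filter_upwards [h.left.eventually_mem hy] with z hz using h.christoffel_eq hz u v)).unique h1
    have := congrArg (fun L => L x) h3
    simp at this
    rw [← this]
    abel
  have hwk : G y w k = 0 := by rw [h.left.symm y hy, hw]
  have g1 := h.left.fderiv_eq hy k w k
  have g2 := h.left.fderiv_eq hy w k k
  have c1 := h.left.christoffel_comm hy k w
  have t1 := h.left.symm y hy k (christoffel G y w k)
  have t2 := h.left.symm y hy w (christoffel G y k k)
  -- the coefficient of `k` obtained by inserting the formula for `christoffel Gh`
  refine ⟨fderiv ℝ a y k w - 2 * fderiv ℝ a y w k + a y k * a y w + a y (christoffel G y w k), ?_⟩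
  simp only [riemann, key, h.christoffel_eq hy, map_add, map_smul, hk, hwk, hw,
    smul_eq_mul, zero_smul, sub_zero, mul_zero, add_zero, c1]
  rw [c1] at g1
  rw [t1, t2, g1, g2]
  module

end IsConformalChange

end Coordinates

/-! ### Linear algebra of the screen space -/

section ScreenAlgebra

open Module

open Module.Basis in
lemma trace_eq_trace_restrict_add_trace_mapQ {K V : Type*} [Field K] [AddCommGroup V] [Module K V]
    [FiniteDimensional K V] (W : Submodule K V) (A : V →ₗ[K] V) (hA : W ≤ W.comap A) :
    LinearMap.trace K V A =
      LinearMap.trace K W (A.restrict hA) + LinearMap.trace K (V ⧸ W) (W.mapQ W A hA) := by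
  let bW := Module.Free.chooseBasis K W
  let bQ := Module.Free.chooseBasis K (V ⧸ W)
  rw [LinearMap.trace_eq_matrix_trace K (sumQuot bW bQ), LinearMap.trace_eq_matrix_trace K bW,
    LinearMap.trace_eq_matrix_trace K bQ]
  simp only [Matrix.trace, Matrix.diag, Fintype.sum_sum_type]
  congr 1
  · refine Finset.sum_congr rfl fun i _ => ?_
    simp only [LinearMap.toMatrix_apply, sumQuot_inl]
    apply sumQuot_repr_inl_of_mem
  · refine Finset.sum_congr rfl fun j _ => ?_
    simp only [LinearMap.toMatrix_apply, sumQuot_repr_inr]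
    rw [← sumQuot_inr bW bQ j, W.mapQ_apply]
    simp

variable {V : Type*} [AddCommGroup V] [Module ℝ V]

/-- For covectors `α`, `β` and vectors `v`, `n` with `β v = 0` and `α v = β n ≠ 0`, a map which is
the identity on `⟨v⟩` and on `V / ker β`, and which maps `ker β` to `⟨v⟩`. Added to an endomorphism
of `V`, it leaves its action on `ker β / ⟨v⟩` alone. -/
def screenCorrection (α β : V →ₗ[ℝ] ℝ) (v n : V) : V →ₗ[ℝ] V :=
  (β n)⁻¹ • (β.smulRight n + α.smulRight v)

lemma screenCorrection_apply (α β : V →ₗ[ℝ] ℝ) (v n w : V) :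
    screenCorrection α β v n w = (β n)⁻¹ • (β w • n + α w • v) := by
  simp [screenCorrection]

variable [FiniteDimensional ℝ V] {α β : V →ₗ[ℝ] ℝ} {v n : V} {p : Submodule ℝ V}

/-- The determinant of the endomorphism which `A` induces on `ker β / ⟨v⟩`, as a determinant
on `V`. -/
lemma det_screen (hp : ∀ w, w ∈ p ↔ β w = 0) (hv : β v = 0) (hn : β n ≠ 0) (hα : α v = β n)
    {σ : ℝ} {A : V →ₗ[ℝ] V} (hAβ : ∀ w, β (A w) = σ * β w) (hAv : A v = σ • v)
    (hA : ∀ w ∈ p, A w ∈ p)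
    (hQ : (Submodule.span ℝ {v}).comap p.subtype ≤
      ((Submodule.span ℝ {v}).comap p.subtype).comap (A.restrict hA)) :
    LinearMap.det (Submodule.mapQ _ _ (A.restrict hA) hQ) =
      LinearMap.det (A + (1 - σ) • screenCorrection α β v n) := by
  set B := A + (1 - σ) • screenCorrection α β v n with hB
  have hBapp : ∀ w, B w = A w + (1 - σ) • (β n)⁻¹ • (β w • n + α w • v) := fun w => by
    simp [hB, screenCorrection_apply]
  have hBβ : ∀ w, β (B w) = β w := by
    intro w
    rw [hBapp]
    simp only [map_add, map_smul, hAβ, smul_eq_mul, hv]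
    field_simp
    ring
  have hBv : B v = v := by
    rw [hBapp, hAv, hv, hα, zero_smul, zero_add, smul_smul _ (β n), inv_mul_cancel₀ hn, one_smul,
      ← add_smul]
    simp
  have hBp : p ≤ p.comap B := by
    intro w hw
    rw [Submodule.mem_comap, hp, hBβ]
    exact (hp w).1 hw
  have hBA : ∀ w ∈ p, B w - A w ∈ Submodule.span ℝ {v} := by
    intro w hw
    rw [hBapp, (hp w).1 hw, zero_smul, zero_add, add_sub_cancel_left]
    exact Submodule.smul_mem _ _ (Submodule.smul_mem _ _ (Submodule.smul_mem _ _
      (Submodule.mem_span_singleton_self v)))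
  set s : Submodule ℝ p := (Submodule.span ℝ {v}).comap p.subtype with hs
  have hBs : s ≤ s.comap (B.restrict hBp) := by
    intro w hw
    have h1 : B (w : V) - A w ∈ Submodule.span ℝ {v} := hBA w w.2
    have h2 : A (w : V) ∈ Submodule.span ℝ {v} := hQ hw
    have : B (w : V) ∈ Submodule.span ℝ {v} := by simpa using add_mem h1 h2
    exact this
  -- `B` is the identity on `V / p` and on `⟨v⟩`, and induces the same map as `A` on `p / ⟨v⟩`
  rw [LinearMap.det_eq_det_mul_det p B hBp, LinearMap.det_eq_det_mul_det s _ hBs]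
  have e1 : p.mapQ p B hBp = LinearMap.id := by
    ext w
    simp only [LinearMap.comp_apply, Submodule.mkQ_apply, Submodule.mapQ_apply, LinearMap.id_apply]
    rw [Submodule.Quotient.eq, hp, map_sub, hBβ, sub_self]
  have e2 : (B.restrict hBp).restrict hBs = LinearMap.id := by
    ext w
    obtain ⟨c, hc⟩ := Submodule.mem_span_singleton.1 (Submodule.mem_comap.1 w.2)
    have : B ((w : p) : V) = ((w : p) : V) := by
      rw [show ((w : p) : V) = c • v from hc.symm, map_smul, hBv]
    simpa using this
  have e3 : s.mapQ s (B.restrict hBp) hBs = s.mapQ s (A.restrict hA) hQ := by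
    ext w
    simp only [LinearMap.comp_apply, Submodule.mkQ_apply, Submodule.mapQ_apply]
    rw [Submodule.Quotient.eq]
    exact hBA w w.2
  rw [e1, e2, e3, LinearMap.det_id, LinearMap.det_id, one_mul, mul_one]

/-- The trace of the endomorphism which `A` induces on `ker β / ⟨v⟩`. -/
lemma trace_screen (hp : ∀ w, w ∈ p ↔ β w = 0)
    {A : V →ₗ[ℝ] V} (hAβ : ∀ w, β (A w) = 0) (hAv : A v = 0)
    (hA : ∀ w ∈ p, A w ∈ p)
    (hQ : (Submodule.span ℝ {v}).comap p.subtype ≤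
      ((Submodule.span ℝ {v}).comap p.subtype).comap (A.restrict hA)) :
    LinearMap.trace ℝ _ (Submodule.mapQ _ _ (A.restrict hA) hQ) = LinearMap.trace ℝ V A := by
  set s : Submodule ℝ p := (Submodule.span ℝ {v}).comap p.subtype with hs
  rw [trace_eq_trace_restrict_add_trace_mapQ p A hA,
    trace_eq_trace_restrict_add_trace_mapQ s _ hQ]
  have e1 : p.mapQ p A hA = 0 := by
    ext w
    simp only [LinearMap.comp_apply, Submodule.mkQ_apply, Submodule.mapQ_apply,
      LinearMap.zero_apply]
    rw [Submodule.Quotient.mk_eq_zero, hp, hAβ]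
  have e2 : (A.restrict hA).restrict (p := s) (q := s) (fun w hw => hQ hw) = 0 := by
    ext w
    obtain ⟨c, hc⟩ := Submodule.mem_span_singleton.1 (Submodule.mem_comap.1 w.2)
    have : A ((w : p) : V) = 0 := by
      rw [show ((w : p) : V) = c • v from hc.symm, map_smul, hAv, smul_zero]
    simpa using this
  rw [e1, e2, map_zero, map_zero, zero_add, add_zero]

lemma finrank_screen (hp : ∀ w, w ∈ p ↔ β w = 0) (hv : β v = 0) (hv0 : v ≠ 0) (hβ : β ≠ 0) :
    finrank ℝ (p ⧸ (Submodule.span ℝ {v}).comap p.subtype) + 2 = finrank ℝ V := by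
  have hker : p = LinearMap.ker β := by
    ext w
    rw [hp, LinearMap.mem_ker]
  have h1 := Submodule.finrank_quotient_add_finrank ((Submodule.span ℝ {v}).comap p.subtype)
  have h2 : finrank ℝ ((Submodule.span ℝ {v}).comap p.subtype) = 1 := by
    rw [(Submodule.comapSubtypeEquivOfLe (p := Submodule.span ℝ {v}) (q := p) ?_).finrank_eq,
      finrank_span_singleton hv0]
    rw [Submodule.span_singleton_le_iff_mem, hp, hv]
  have h3 := LinearMap.finrank_range_add_finrank_ker β
  rw [LinearMap.range_eq_top.2 (LinearMap.surjective hβ), finrank_top, finrank_self, ← hker] at h3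
  omega

end ScreenAlgebra

/-! ### Tangent maps, metrics and isometries in charts -/

section Charts

variable {m : ℕ} {M : Type*} [TopologicalSpace M] [ChartedSpace (Model m) M]
  {M' : Type*} [TopologicalSpace M'] [ChartedSpace (Model m) M']

/-- The tangent map of `f` at `x`, with every tangent space identified with the model space. -/
def tmap (f : M → M') (x : M) : Model m →L[ℝ] Model m :=
  mfderiv 𝓘(ℝ, Model m) 𝓘(ℝ, Model m) f x

/-- The scalar product of `g` at `x`, with the tangent space identified with the model space. -/
def LorentzMetric.form (g : LorentzMetric m M) (x : M) : Model m →L[ℝ] Model m →L[ℝ] ℝ := g.val x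

/-- The velocity of a curve, with the tangent space identified with the model space. -/
def vel (γ : ℝ → M) (t : ℝ) : Model m := velocity γ t

/-- The endomorphism `w ↦ R(v, w) v`, with the tangent space identified with the model space. -/
def LorentzMetric.jac (g : LorentzMetric m M) (x : M) (v : Model m) : Model m →ₗ[ℝ] Model m :=
  g.jacobi x v

lemma tmap_model (f : Model m → Model m) (y : Model m) : tmap f y = fderiv ℝ f y :=
  mfderiv_eq_fderiv

lemma tmap_comp {M'' : Type*} [TopologicalSpace M''] [ChartedSpace (Model m) M''] (f : M' → M'')
    (h : M → M') (x : M) (hf : MDifferentiableAt 𝓘(ℝ, Model m) 𝓘(ℝ, Model m) f (h x))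
    (hh : MDifferentiableAt 𝓘(ℝ, Model m) 𝓘(ℝ, Model m) h x) :
    tmap (m := m) (f ∘ h) x = (tmap f (h x)).comp (tmap h x) :=
  mfderiv_comp x hf hh

section Manifold

variable [IsManifold 𝓘(ℝ, Model m) ∞ M] [IsManifold 𝓘(ℝ, Model m) ∞ M']


lemma mdifferentiable_chartAt (x₀ : M) :
    (chartAt (Model m) x₀).MDifferentiable 𝓘(ℝ, Model m) 𝓘(ℝ, Model m) :=
  have : IsManifold 𝓘(ℝ, Model m) 1 M := IsManifold.of_le (n := ∞) (by simp)
  mdifferentiable_of_mem_atlas (chart_mem_atlas _ _)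

lemma tmap_symm_tmap {x₀ x : M} (hx : x ∈ (chartAt (Model m) x₀).source) (v : Model m) :
    tmap (chartAt (Model m) x₀).symm (chartAt (Model m) x₀ x)
      (tmap (chartAt (Model m) x₀) x v) = v :=
  congrArg (fun L : Model m →L[ℝ] Model m => L v) ((mdifferentiable_chartAt x₀).symm_comp_deriv hx)

lemma tmap_tmap_symm {x₀ : M} {y : Model m} (hy : y ∈ (chartAt (Model m) x₀).target)
    (v : Model m) :
    tmap (chartAt (Model m) x₀) ((chartAt (Model m) x₀).symm y)
      (tmap (chartAt (Model m) x₀).symm y v) = v :=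
  congrArg (fun L : Model m →L[ℝ] Model m => L v) ((mdifferentiable_chartAt x₀).comp_symm_deriv hy)

/-- The tangent map of a chart. -/
def chartEquiv {x₀ x : M} (hx : x ∈ (chartAt (Model m) x₀).source) : Model m ≃ₗ[ℝ] Model m :=
  LinearEquiv.ofLinearMap (tmap (chartAt (Model m) x₀) x).toLinearMap
    (tmap (chartAt (Model m) x₀).symm (chartAt (Model m) x₀ x)).toLinearMap
    (by
      ext1 v
      have := tmap_tmap_symm ((chartAt (Model m) x₀).map_source hx) v
      rwa [(chartAt (Model m) x₀).left_inv hx] at this)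
    (by
      ext1 v
      exact tmap_symm_tmap hx v)

lemma chartEquiv_apply {x₀ x : M} (hx : x ∈ (chartAt (Model m) x₀).source) (v : Model m) :
    chartEquiv hx v = tmap (chartAt (Model m) x₀) x v := rfl

lemma LorentzMetric.local_apply (g : LorentzMetric m M) (x₀ : M) (y u v : Model m) :
    g.local x₀ y u v = g.form ((chartAt (Model m) x₀).symm y)
      (tmap (chartAt (Model m) x₀).symm y u) (tmap (chartAt (Model m) x₀).symm y v) := rfl

lemma LorentzMetric.local_chart (g : LorentzMetric m M) {x₀ x : M}
    (hx : x ∈ (chartAt (Model m) x₀).source) (u v : Model m) :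
    g.local x₀ (chartAt (Model m) x₀ x) (tmap (chartAt (Model m) x₀) x u)
      (tmap (chartAt (Model m) x₀) x v) = g.form x u v := by
  rw [g.local_apply, tmap_symm_tmap hx, tmap_symm_tmap hx, (chartAt (Model m) x₀).left_inv hx]

lemma LorentzMetric.isMetricOn (g : LorentzMetric m M) (x₀ : M) :
    IsMetricOn (g.local x₀) (chartAt (Model m) x₀).target where
  isOpen := (chartAt (Model m) x₀).open_target
  contDiffOn := g.smooth _ (chart_mem_atlas _ _)
  symm _ _ _ _ := g.symm _ _ _
  isInvertible _ hz := g.local_isInvertible x₀ hz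

/-- `φ` pulls the metric `g'` back to `g`. -/
def IsIsometry (g : LorentzMetric m M) (g' : LorentzMetric m M')
    (φ : Diffeomorph 𝓘(ℝ, Model m) 𝓘(ℝ, Model m) M M' ∞) : Prop :=
  ∀ x u v, g.form x u v = g'.form (φ x) (tmap φ x u) (tmap φ x v)

lemma tmap_id (x : M) : tmap (id : M → M) x = ContinuousLinearMap.id ℝ (Model m) :=
  mfderiv_id

lemma isIsometry_refl (g : LorentzMetric m M) :
    IsIsometry g g (Diffeomorph.refl 𝓘(ℝ, Model m) M ∞) := by
  intro x u v
  have : tmap (Diffeomorph.refl 𝓘(ℝ, Model m) M ∞) x = ContinuousLinearMap.id ℝ (Model m) :=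
    tmap_id x
  rw [this]
  rfl

section Diffeo

variable (φ : Diffeomorph 𝓘(ℝ, Model m) 𝓘(ℝ, Model m) M M' ∞)

lemma mdifferentiableAt_diffeo (x : M) :
    MDifferentiableAt 𝓘(ℝ, Model m) 𝓘(ℝ, Model m) φ x :=
  φ.contMDiff.contMDiffAt.mdifferentiableAt (by simp)

lemma tmap_symm_diffeo (x : M) (v : Model m) : tmap φ.symm (φ x) (tmap φ x v) = v := by
  have h := tmap_comp φ.symm φ x (mdifferentiableAt_diffeo φ.symm (φ x))
    (mdifferentiableAt_diffeo φ x)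
  have : (φ.symm ∘ φ : M → M) = id := by
    ext z
    simp
  rw [this, tmap_id] at h
  exact (congrArg (fun L => L v) h).symm

/-- The tangent map of a diffeomorphism. -/
def diffeoEquiv (x : M) : Model m ≃ₗ[ℝ] Model m :=
  LinearEquiv.ofLinearMap (tmap φ x).toLinearMap (tmap φ.symm (φ x)).toLinearMap
    (by
      ext1 v
      have := tmap_symm_diffeo φ.symm (φ x) v
      rw [φ.symm_apply_apply] at this
      exact this)
    (by
      ext1 v
      exact tmap_symm_diffeo φ x v)

lemma diffeoEquiv_apply (x : M) (v : Model m) : diffeoEquiv φ x v = tmap φ x v := rfl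

lemma IsIsometry.symm {g : LorentzMetric m M} {g' : LorentzMetric m M'} {φ}
    (h : IsIsometry g g' φ) : IsIsometry g' g φ.symm := by
  intro x u v
  have hx : φ (φ.symm x) = x := φ.apply_symm_apply x
  have e : ∀ w, tmap φ (φ.symm x) (tmap φ.symm x w) = w := fun w => by
    have := tmap_symm_diffeo φ.symm x w
    exact this
  rw [h, e, e, hx]

/-- The coordinate expression of a diffeomorphism. -/
def coordMap (x₀ : M) (x₀' : M') : Model m → Model m :=
  chartAt (Model m) x₀' ∘ φ ∘ (chartAt (Model m) x₀).symm

/-- The domain of the coordinate expression of a diffeomorphism. -/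
def coordDomain (x₀ : M) (x₀' : M') : Set (Model m) :=
  (chartAt (Model m) x₀).target ∩
    (φ ∘ (chartAt (Model m) x₀).symm) ⁻¹' (chartAt (Model m) x₀').source

lemma isOpen_coordDomain (x₀ : M) (x₀' : M') : IsOpen (coordDomain φ x₀ x₀') :=
  (φ.continuous.comp_continuousOn (chartAt (Model m) x₀).continuousOn_symm).isOpen_inter_preimage
    (chartAt (Model m) x₀).open_target (chartAt (Model m) x₀').open_source

lemma mem_coordDomain {x₀ : M} {x₀' : M'} {x : M} (hx : x ∈ (chartAt (Model m) x₀).source)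
    (hx' : φ x ∈ (chartAt (Model m) x₀').source) :
    chartAt (Model m) x₀ x ∈ coordDomain φ x₀ x₀' := by
  refine ⟨(chartAt (Model m) x₀).map_source hx, ?_⟩
  simpa [(chartAt (Model m) x₀).left_inv hx] using hx'

lemma contDiffOn_coordMap (x₀ : M) (x₀' : M') :
    ContDiffOn ℝ ∞ (coordMap φ x₀ x₀') (coordDomain φ x₀ x₀') := by
  rw [← contMDiffOn_iff_contDiffOn]
  have h1 : ContMDiffOn 𝓘(ℝ, Model m) 𝓘(ℝ, Model m) ∞ (chartAt (Model m) x₀').toFun _ :=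
    contMDiffOn_chart (I := 𝓘(ℝ, Model m)) (x := x₀')
  have h2 := (contMDiffOn_chart_symm (I := 𝓘(ℝ, Model m)) (n := ∞) (x := x₀))
  exact h1.comp (φ.contMDiff.comp_contMDiffOn (h2.mono inter_subset_left)) fun z hz => hz.2

lemma fderiv_coordMap {x₀ : M} {x₀' : M'} {y : Model m} (hy : y ∈ coordDomain φ x₀ x₀')
    (v : Model m) :
    fderiv ℝ (coordMap φ x₀ x₀') y v =
      tmap (chartAt (Model m) x₀') (φ ((chartAt (Model m) x₀).symm y))
        (tmap φ ((chartAt (Model m) x₀).symm y) (tmap (chartAt (Model m) x₀).symm y v)) := by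
  have h2 := (mdifferentiable_chartAt x₀).mdifferentiableAt_symm hy.1
  have h1 := (mdifferentiable_chartAt x₀').mdifferentiableAt hy.2
  have h3 := mdifferentiableAt_diffeo φ ((chartAt (Model m) x₀).symm y)
  have e1 : tmap (coordMap φ x₀ x₀') y = _ := tmap_comp _ _ y h1 (h3.comp y h2)
  rw [tmap_comp _ _ y h3 h2, tmap_model] at e1
  rw [e1]
  rfl

lemma fderiv_coordMap_chart {x₀ : M} {x₀' : M'} {x : M}
    (hx : x ∈ (chartAt (Model m) x₀).source) (hx' : φ x ∈ (chartAt (Model m) x₀').source)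
    (v : Model m) :
    fderiv ℝ (coordMap φ x₀ x₀') (chartAt (Model m) x₀ x) (tmap (chartAt (Model m) x₀) x v) =
      tmap (chartAt (Model m) x₀') (φ x) (tmap φ x v) := by
  rw [fderiv_coordMap φ (mem_coordDomain φ hx hx'), tmap_symm_tmap hx,
    (chartAt (Model m) x₀).left_inv hx]

lemma coordMap_chart {x₀ : M} (x₀' : M') {x : M} (hx : x ∈ (chartAt (Model m) x₀).source) :
    coordMap φ x₀ x₀' (chartAt (Model m) x₀ x) = chartAt (Model m) x₀' (φ x) := by
  simp [coordMap, (chartAt (Model m) x₀).left_inv hx]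

/-- In charts, an isometry is a pull-back of metrics. -/
lemma IsIsometry.isPullback {g : LorentzMetric m M} {g' : LorentzMetric m M'} {φ}
    (h : IsIsometry g g' φ) (x₀ : M) (x₀' : M') :
    IsPullback (g.local x₀) (g'.local x₀') (coordMap φ x₀ x₀') (coordDomain φ x₀ x₀')
      (chartAt (Model m) x₀').target where
  source :=
    { isOpen := isOpen_coordDomain φ x₀ x₀'
      contDiffOn := (g.isMetricOn x₀).contDiffOn.mono inter_subset_left
      symm := fun z hz => (g.isMetricOn x₀).symm z hz.1
      isInvertible := fun z hz => (g.isMetricOn x₀).isInvertible z hz.1 }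
  target := g'.isMetricOn x₀'
  contDiffOn := contDiffOn_coordMap φ x₀ x₀'
  mapsTo z hz := (chartAt (Model m) x₀').map_source hz.2
  surjective z hz w := by
    set x := (chartAt (Model m) x₀).symm z with hxdef
    have hx : x ∈ (chartAt (Model m) x₀).source := (chartAt (Model m) x₀).map_target hz.1
    have hzx : chartAt (Model m) x₀ x = z := (chartAt (Model m) x₀).right_inv hz.1
    have hx' : φ x ∈ (chartAt (Model m) x₀').source := hz.2
    obtain ⟨a, rfl⟩ := (chartEquiv hx').surjective w
    obtain ⟨b, rfl⟩ := (diffeoEquiv φ x).surjective a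
    refine ⟨tmap (chartAt (Model m) x₀) x b, ?_⟩
    rw [← hzx, fderiv_coordMap_chart φ hx hx', chartEquiv_apply, diffeoEquiv_apply]
  eq z hz u v := by
    rw [fderiv_coordMap φ hz, fderiv_coordMap φ hz, g.local_apply, h]
    exact (g'.local_chart hz.2 _ _).symm

end Diffeo

lemma LorentzMetric.jac_apply (g : LorentzMetric m M) (x : M) (v w : Model m) :
    g.jac x v w = tmap (chartAt (Model m) x).symm (chartAt (Model m) x x)
      (riemann (g.local x) (chartAt (Model m) x x) (tmap (chartAt (Model m) x) x v)
        (tmap (chartAt (Model m) x) x w) (tmap (chartAt (Model m) x) x v)) := rfl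

lemma IsIsometry.chart_jac {φ : Diffeomorph 𝓘(ℝ, Model m) 𝓘(ℝ, Model m) M M' ∞}
    {g : LorentzMetric m M} {g' : LorentzMetric m M'}
    (h : IsIsometry g g' φ) {x : M} {x₀' : M'} (hx' : φ x ∈ (chartAt (Model m) x₀').source)
    (v w : Model m) :
    tmap (chartAt (Model m) x₀') (φ x) (tmap φ x (g.jac x v w)) =
      riemann (g'.local x₀') (chartAt (Model m) x₀' (φ x))
        (tmap (chartAt (Model m) x₀') (φ x) (tmap φ x v))
        (tmap (chartAt (Model m) x₀') (φ x) (tmap φ x w))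
        (tmap (chartAt (Model m) x₀') (φ x) (tmap φ x v)) := by
  have hx : x ∈ (chartAt (Model m) x).source := mem_chart_source _ _
  have key := (h.isPullback x x₀').riemann_eq (mem_coordDomain φ hx hx')
    (tmap (chartAt (Model m) x) x v) (tmap (chartAt (Model m) x) x w)
    (tmap (chartAt (Model m) x) x v)
  rw [fderiv_coordMap_chart φ hx hx', fderiv_coordMap_chart φ hx hx', coordMap_chart φ x₀' hx]
    at key
  rw [← key, fderiv_coordMap φ (mem_coordDomain φ hx hx'), ← g.jac_apply,
    (chartAt (Model m) x).left_inv hx]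

/-- The curvature may be computed in any chart. -/
lemma LorentzMetric.chart_jac (g : LorentzMetric m M) {x x₀ : M}
    (hx : x ∈ (chartAt (Model m) x₀).source) (v w : Model m) :
    tmap (chartAt (Model m) x₀) x (g.jac x v w) =
      jacobiMap (g.local x₀) (chartAt (Model m) x₀ x)
        (tmap (chartAt (Model m) x₀) x v) (tmap (chartAt (Model m) x₀) x w) := by
  have h := (isIsometry_refl g).chart_jac (x := x) (x₀' := x₀) hx v w
  have : tmap (Diffeomorph.refl 𝓘(ℝ, Model m) M ∞) x = ContinuousLinearMap.id ℝ (Model m) :=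
    tmap_id x
  rw [this] at h
  exact h

/-- The curvature is invariant under isometries. -/
lemma IsIsometry.jac_eq {φ : Diffeomorph 𝓘(ℝ, Model m) 𝓘(ℝ, Model m) M M' ∞}
    {g : LorentzMetric m M} {g' : LorentzMetric m M'}
    (h : IsIsometry g g' φ) (x : M) (v w : Model m) :
    tmap φ x (g.jac x v w) = g'.jac (φ x) (tmap φ x v) (tmap φ x w) := by
  have hx' : φ x ∈ (chartAt (Model m) (φ x)).source := mem_chart_source _ _
  apply (chartEquiv hx').injective
  rw [chartEquiv_apply, chartEquiv_apply, h.chart_jac hx', g'.chart_jac hx']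
  rfl


end Manifold
end Charts

/-! ### The geodesic equation in charts -/

section Curves

variable {m : ℕ} {M : Type*} [TopologicalSpace M] [ChartedSpace (Model m) M]
  [IsManifold 𝓘(ℝ, Model m) ∞ M]
  {M' : Type*} [TopologicalSpace M'] [ChartedSpace (Model m) M'] [IsManifold 𝓘(ℝ, Model m) ∞ M']

/-- A curve in the chart at `x₀`. -/
def coord (x₀ : M) (γ : ℝ → M) : ℝ → Model m := fun t => chartAt (Model m) x₀ (γ t)

/-- The derivative of a curve, as a map to the model space. -/
def velMap (γ : ℝ → M) (t : ℝ) : ℝ →L[ℝ] Model m := mfderiv 𝓘(ℝ, ℝ) 𝓘(ℝ, Model m) γ t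

lemma vel_diffeo_comp (φ : Diffeomorph 𝓘(ℝ, Model m) 𝓘(ℝ, Model m) M M' ∞) {γ : ℝ → M} {t : ℝ}
    (hγ : ContMDiffAt 𝓘(ℝ, ℝ) 𝓘(ℝ, Model m) ∞ γ t) :
    vel (m := m) (φ ∘ γ) t = tmap φ (γ t) (vel γ t) :=
  congrArg (fun L : ℝ →L[ℝ] Model m => L 1)
    (mfderiv_comp t (mdifferentiableAt_diffeo φ (γ t)) (hγ.mdifferentiableAt (by simp)))

lemma vel_comp {γ : ℝ → M} {h : ℝ → ℝ} {t : ℝ}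
    (hγ : ContMDiffAt 𝓘(ℝ, ℝ) 𝓘(ℝ, Model m) ∞ γ (h t)) (hh : DifferentiableAt ℝ h t) :
    vel (m := m) (γ ∘ h) t = deriv h t • vel γ (h t) := by
  have e : (mfderiv 𝓘(ℝ, ℝ) 𝓘(ℝ, ℝ) h t : ℝ →L[ℝ] ℝ) = fderiv ℝ h t := mfderiv_eq_fderiv
  have h1 : velMap (m := m) (γ ∘ h) t = (velMap γ (h t)).comp (fderiv ℝ h t) := by
    rw [← e]
    exact mfderiv_comp t (hγ.mdifferentiableAt (by simp)) hh.mdifferentiableAt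
  have h3 : vel (m := m) (γ ∘ h) t = velMap γ (h t) (deriv h t • 1) := by
    rw [smul_eq_mul, mul_one, ← fderiv_apply_one_eq_deriv]
    exact congrArg (fun L : ℝ →L[ℝ] Model m => L 1) h1
  rw [h3, map_smul]
  rfl

lemma vel_congr {γ γ' : ℝ → M} {t : ℝ} (h : γ =ᶠ[𝓝 t] γ') :
    vel (m := m) γ t = vel γ' t := by
  have h1 : velMap (m := m) γ t = velMap γ' t := h.mfderiv_eq
  exact congrArg (fun L : ℝ →L[ℝ] Model m => L 1) h1

section Coord

variable {γ : ℝ → M} {t : ℝ} {x₀ : M}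

lemma contDiffAt_coord (hγ : ContMDiffAt 𝓘(ℝ, ℝ) 𝓘(ℝ, Model m) ∞ γ t)
    (hx : γ t ∈ (chartAt (Model m) x₀).source) : ContDiffAt ℝ ∞ (coord (m := m) x₀ γ) t := by
  rw [← contMDiffAt_iff_contDiffAt]
  have h1 : ContMDiffAt 𝓘(ℝ, Model m) 𝓘(ℝ, Model m) ∞ (chartAt (Model m) x₀) (γ t) :=
    (contMDiffOn_chart (I := 𝓘(ℝ, Model m)) (x := x₀)).contMDiffAt
      ((chartAt (Model m) x₀).open_source.mem_nhds hx)
  exact h1.comp t hγ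

lemma hasDerivAt_coord (hγ : ContMDiffAt 𝓘(ℝ, ℝ) 𝓘(ℝ, Model m) ∞ γ t)
    (hx : γ t ∈ (chartAt (Model m) x₀).source) :
    HasDerivAt (coord (m := m) x₀ γ) (tmap (chartAt (Model m) x₀) (γ t) (vel γ t)) t := by
  have h1 := ((contDiffAt_coord hγ hx).differentiableAt (by simp)).hasDerivAt
  have h2 : (mfderiv 𝓘(ℝ, ℝ) 𝓘(ℝ, Model m) (coord (m := m) x₀ γ) t : ℝ →L[ℝ] Model m) =
      (tmap (chartAt (Model m) x₀) (γ t)).comp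
        (mfderiv 𝓘(ℝ, ℝ) 𝓘(ℝ, Model m) γ t : ℝ →L[ℝ] Model m) :=
    mfderiv_comp t ((mdifferentiable_chartAt x₀).mdifferentiableAt hx)
      (hγ.mdifferentiableAt (by simp))
  rw [mfderiv_eq_fderiv] at h2
  have h3 : deriv (coord (m := m) x₀ γ) t = tmap (chartAt (Model m) x₀) (γ t) (vel γ t) := by
    rw [← fderiv_apply_one_eq_deriv, h2]
    rfl
  rwa [h3] at h1

lemma deriv_coord (hγ : ContMDiffAt 𝓘(ℝ, ℝ) 𝓘(ℝ, Model m) ∞ γ t)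
    (hx : γ t ∈ (chartAt (Model m) x₀).source) :
    deriv (coord (m := m) x₀ γ) t = tmap (chartAt (Model m) x₀) (γ t) (vel γ t) :=
  (hasDerivAt_coord hγ hx).deriv

lemma contDiffAt_deriv_coord (hγ : ContMDiffAt 𝓘(ℝ, ℝ) 𝓘(ℝ, Model m) ∞ γ t)
    (hx : γ t ∈ (chartAt (Model m) x₀).source) :
    ContDiffAt ℝ ∞ (deriv (coord (m := m) x₀ γ)) t :=
  (contDiffAt_coord hγ hx).derivWithin (by simp)

lemma eventually_mem_source (hγ : ContMDiffAt 𝓘(ℝ, ℝ) 𝓘(ℝ, Model m) ∞ γ t)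
    (hx : γ t ∈ (chartAt (Model m) x₀).source) :
    ∀ᶠ s in 𝓝 t, γ s ∈ (chartAt (Model m) x₀).source :=
  hγ.continuousAt.eventually ((chartAt (Model m) x₀).open_source.mem_nhds hx)

end Coord

/-- The left-hand side `c'' + Γ(c', c')` of the geodesic equation, in the chart at `x₀`. -/
def LorentzMetric.resid (g : LorentzMetric m M) (x₀ : M) (γ : ℝ → M) (t : ℝ) : Model m :=
  deriv (deriv (coord x₀ γ)) t + christoffel (g.local x₀) (coord x₀ γ t)
    (deriv (coord x₀ γ) t) (deriv (coord x₀ γ) t)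

variable {g gh : LorentzMetric m M} {g' : LorentzMetric m M'}
  {φ : Diffeomorph 𝓘(ℝ, Model m) 𝓘(ℝ, Model m) M M' ∞} {γ : ℝ → M} {t : ℝ} {x₀ : M}

lemma IsIsometry.resid_eq (h : IsIsometry g g' φ) {x₀' : M'}
    (hγ : ContMDiffAt 𝓘(ℝ, ℝ) 𝓘(ℝ, Model m) ∞ γ t)
    (hx : γ t ∈ (chartAt (Model m) x₀).source) (hx' : φ (γ t) ∈ (chartAt (Model m) x₀').source) :
    g'.resid x₀' (φ ∘ γ) t = fderiv ℝ (coordMap φ x₀ x₀') (coord x₀ γ t) (g.resid x₀ γ t) := by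
  have hp := h.isPullback x₀ x₀'
  have hmem : coord x₀ γ t ∈ coordDomain φ x₀ x₀' := mem_coordDomain φ hx hx'
  have hc := contDiffAt_coord hγ hx
  have hev : ∀ᶠ s in 𝓝 t, coord x₀ γ s ∈ coordDomain φ x₀ x₀' :=
    hc.continuousAt.eventually (hp.source.eventually_mem hmem)
  have hd : ∀ᶠ s in 𝓝 t, DifferentiableAt ℝ (coord (m := m) x₀ γ) s := by
    filter_upwards [(hc.of_le (m := 1) (mod_cast le_top)).eventually (by simp)] with s hs
    exact hs.differentiableAt (by simp)
  have e0 : ∀ᶠ s in 𝓝 t, coord x₀' (φ ∘ γ) s = coordMap φ x₀ x₀' (coord x₀ γ s) := by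
    filter_upwards [eventually_mem_source hγ hx] with s hs
    exact (coordMap_chart φ x₀' hs).symm
  have e1 : ∀ᶠ s in 𝓝 t, deriv (coord x₀' (φ ∘ γ)) s =
      fderiv ℝ (coordMap φ x₀ x₀') (coord x₀ γ s) (deriv (coord x₀ γ) s) := by
    filter_upwards [e0.eventually_nhds, hev, hd] with s h1 h2 h3
    rw [EventuallyEq.deriv_eq h1]
    exact ((hp.hasFDerivAt h2).comp_hasDerivAt s h3.hasDerivAt).deriv
  have e2 : deriv (deriv (coord x₀' (φ ∘ γ))) t =
      fderiv ℝ (fderiv ℝ (coordMap φ x₀ x₀')) (coord x₀ γ t) (deriv (coord x₀ γ) t)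
        (deriv (coord x₀ γ) t)
      + fderiv ℝ (coordMap φ x₀ x₀') (coord x₀ γ t) (deriv (deriv (coord x₀ γ)) t) := by
    rw [EventuallyEq.deriv_eq e1]
    exact (((hp.hasFDerivAt_fderiv hmem).comp_hasDerivAt t
      hd.self_of_nhds.hasDerivAt).clm_apply
        ((contDiffAt_deriv_coord hγ hx).differentiableAt (by simp)).hasDerivAt).deriv
  rw [LorentzMetric.resid, e2, e1.self_of_nhds, e0.self_of_nhds, LorentzMetric.resid, map_add,
    hp.christoffel_eq hmem]
  abel

/-- The geodesic equation may be checked in any chart. -/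
lemma LorentzMetric.geodesicAt_iff (g : LorentzMetric m M)
    (hγ : ContMDiffAt 𝓘(ℝ, ℝ) 𝓘(ℝ, Model m) ∞ γ t)
    (hx : γ t ∈ (chartAt (Model m) x₀).source) : g.GeodesicAt γ t ↔ g.resid x₀ γ t = 0 := by
  have hx0 : γ t ∈ (chartAt (Model m) (γ t)).source := mem_chart_source _ _
  have h1 : g.resid x₀ γ t = _ := (isIsometry_refl g).resid_eq (x₀ := γ t) (x₀' := x₀) hγ hx0 hx
  have h2 : g.resid (γ t) γ t = _ :=
    (isIsometry_refl g).resid_eq (x₀ := x₀) (x₀' := γ t) hγ hx hx0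
  change g.resid (γ t) γ t = 0 ↔ _
  constructor
  · intro h
    rw [h1, h, map_zero]
  · intro h
    rw [h2, h, map_zero]

lemma IsIsometry.geodesicAt (h : IsIsometry g g' φ)
    (hγ : ContMDiffAt 𝓘(ℝ, ℝ) 𝓘(ℝ, Model m) ∞ γ t) (hg : g.GeodesicAt γ t) :
    g'.GeodesicAt (φ ∘ γ) t := by
  have h1 : g'.resid (φ (γ t)) (φ ∘ γ) t = _ :=
    h.resid_eq (x₀ := γ t) hγ (mem_chart_source _ _) (mem_chart_source _ _)
  rw [show g.resid (γ t) γ t = 0 from hg, map_zero] at h1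
  exact h1

/-- Reparametrisation adds a tangential term to the geodesic equation. -/
lemma LorentzMetric.resid_comp (g : LorentzMetric m M) {h : ℝ → ℝ}
    (hγ : ContMDiffAt 𝓘(ℝ, ℝ) 𝓘(ℝ, Model m) ∞ γ (h t)) (hh : ContDiffAt ℝ ∞ h t)
    (hx : γ (h t) ∈ (chartAt (Model m) x₀).source) :
    g.resid x₀ (γ ∘ h) t = deriv h t ^ 2 • g.resid x₀ γ (h t)
      + deriv (deriv h) t • deriv (coord x₀ γ) (h t) := by
  have hc := contDiffAt_coord hγ hx
  have hd : ∀ᶠ s in 𝓝 t, DifferentiableAt ℝ (coord (m := m) x₀ γ) (h s) := by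
    apply hh.continuousAt.eventually
    filter_upwards [(hc.of_le (m := 1) (mod_cast le_top)).eventually (by simp)] with s hs
    exact hs.differentiableAt (by simp)
  have hdh : ∀ᶠ s in 𝓝 t, DifferentiableAt ℝ h s := by
    filter_upwards [(hh.of_le (m := 1) (mod_cast le_top)).eventually (by simp)] with s hs
    exact hs.differentiableAt (by simp)
  have e1 : ∀ᶠ s in 𝓝 t, deriv (coord (m := m) x₀ (γ ∘ h)) s =
      deriv h s • deriv (coord x₀ γ) (h s) := by
    filter_upwards [hd, hdh] with s h1 h2
    exact (h1.hasDerivAt.scomp s h2.hasDerivAt).deriv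
  have hdh' : HasDerivAt (deriv h) (deriv (deriv h) t) t :=
    ((hh.derivWithin (m := ∞) (by simp)).differentiableAt (by simp)).hasDerivAt
  have e2 : deriv (deriv (coord (m := m) x₀ (γ ∘ h))) t =
      deriv h t • deriv h t • deriv (deriv (coord x₀ γ)) (h t)
      + deriv (deriv h) t • deriv (coord x₀ γ) (h t) := by
    rw [EventuallyEq.deriv_eq e1]
    exact (hdh'.smul (((contDiffAt_deriv_coord hγ hx).differentiableAt
      (by simp)).hasDerivAt.scomp t hdh.self_of_nhds.hasDerivAt)).deriv
  rw [LorentzMetric.resid, e2, e1.self_of_nhds, LorentzMetric.resid]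
  have : coord (m := m) x₀ (γ ∘ h) t = coord x₀ γ (h t) := rfl
  rw [this]
  simp only [map_smul, smul_apply]
  module

/-- The metric `gh` is `f g`, with `f` smooth and positive. -/
structure IsConformalFactor (g gh : LorentzMetric m M) (f : M → ℝ) : Prop where
  smooth : ContMDiff 𝓘(ℝ, Model m) 𝓘(ℝ, ℝ) ∞ f
  pos : ∀ x, 0 < f x
  eq : ∀ x u v, gh.val x u v = f x * g.val x u v

lemma ConformalClass.exists_isConformalFactor (C : ConformalClass m M) (hg : g ∈ C.metrics)
    (hgh : gh ∈ C.metrics) : ∃ f, IsConformalFactor g gh f := by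
  obtain ⟨k, -, hk⟩ := C.isClass
  obtain ⟨a, ha, ha0, hga⟩ := (hk g).1 hg
  obtain ⟨b, hb, hb0, hgb⟩ := (hk gh).1 hgh
  refine ⟨fun x => b x / a x, hb.div₀ ha fun x => (ha0 x).ne', fun x => div_pos (hb0 x) (ha0 x),
    fun x u v => ?_⟩
  rw [hga, hgb]
  field_simp [(ha0 x).ne']

namespace IsConformalFactor

variable {f : M → ℝ}

lemma isConformalChange (hf : IsConformalFactor g gh f) (x₀ : M) :
    IsConformalChange (g.local x₀) (gh.local x₀) (f ∘ (chartAt (Model m) x₀).symm)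
      (chartAt (Model m) x₀).target where
  left := g.isMetricOn x₀
  right := gh.isMetricOn x₀
  contDiffOn := by
    rw [← contMDiffOn_iff_contDiffOn]
    exact hf.smooth.comp_contMDiffOn
      (contMDiffOn_chart_symm (I := 𝓘(ℝ, Model m)) (n := ∞) (x := x₀))
  pos _ _ := hf.pos _
  eq _ _ _ _ := hf.eq _ _ _

lemma contDiffAt_comp (hf : IsConformalFactor g gh f)
    (hγ : ContMDiffAt 𝓘(ℝ, ℝ) 𝓘(ℝ, Model m) ∞ γ t) : ContDiffAt ℝ ∞ (f ∘ γ) t := by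
  rw [← contMDiffAt_iff_contDiffAt]
  exact hf.smooth.contMDiffAt.comp t hγ

lemma halfDLog_deriv (hf : IsConformalFactor g gh f)
    (hγ : ContMDiffAt 𝓘(ℝ, ℝ) 𝓘(ℝ, Model m) ∞ γ t)
    (hx : γ t ∈ (chartAt (Model m) x₀).source) :
    halfDLog (f ∘ (chartAt (Model m) x₀).symm) (coord x₀ γ t) (deriv (coord x₀ γ) t) =
      deriv (f ∘ γ) t / (2 * f (γ t)) := by
  have hmem : coord x₀ γ t ∈ (chartAt (Model m) x₀).target := (chartAt (Model m) x₀).map_source hx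
  have e0 : f ∘ γ =ᶠ[𝓝 t] (f ∘ (chartAt (Model m) x₀).symm) ∘ coord x₀ γ := by
    filter_upwards [eventually_mem_source hγ hx] with s hs
    simp [coord, (chartAt (Model m) x₀).left_inv hs]
  have hfd := (((hf.isConformalChange x₀).contDiffOn.contDiffAt
    ((chartAt (Model m) x₀).open_target.mem_nhds hmem)).differentiableAt (by simp)).hasFDerivAt
  have := (hfd.comp_hasDerivAt t (hasDerivAt_coord hγ hx)).deriv
  rw [e0.deriv_eq, this, deriv_coord hγ hx]
  simp only [halfDLog, smul_apply, smul_eq_mul, Function.comp_apply, coord,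
    (chartAt (Model m) x₀).left_inv hx]
  rw [div_eq_inv_mul]

/-- Along a null curve, a conformal change adds a tangential term to the geodesic equation. -/
lemma resid_eq (hf : IsConformalFactor g gh f)
    (hγ : ContMDiffAt 𝓘(ℝ, ℝ) 𝓘(ℝ, Model m) ∞ γ t)
    (hx : γ t ∈ (chartAt (Model m) x₀).source)
    (hnull : g.form (γ t) (vel γ t) (vel γ t) = 0) :
    gh.resid x₀ γ t = g.resid x₀ γ t + (deriv (f ∘ γ) t / f (γ t)) • deriv (coord x₀ γ) t := by
  have hmem : coord x₀ γ t ∈ (chartAt (Model m) x₀).target := (chartAt (Model m) x₀).map_source hx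
  rw [LorentzMetric.resid, (hf.isConformalChange x₀).christoffel_eq hmem,
    hf.halfDLog_deriv hγ hx, LorentzMetric.resid]
  have : g.local x₀ (coord x₀ γ t) (deriv (coord x₀ γ) t) (deriv (coord x₀ γ) t) = 0 := by
    rw [deriv_coord hγ hx, ← hnull]
    exact g.local_chart hx _ _
  rw [this]
  have h2 : deriv (f ∘ γ) t / f (γ t) =
      deriv (f ∘ γ) t / (2 * f (γ t)) + deriv (f ∘ γ) t / (2 * f (γ t)) := by
    have := (hf.pos (γ t)).ne'
    field_simp
    norm_num
  rw [h2]
  module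

/-- Along a null geodesic of `g`, the curvature of `f g` differs from that of `g` by a multiple of
the identity, modulo the velocity. With `u = log f / 2`, the factor is `u'' - u' ^ 2`, the
derivatives being taken along the curve. -/
lemma jac_eq (hf : IsConformalFactor g gh f)
    (hγ' : ∀ᶠ s in 𝓝 t, ContMDiffAt 𝓘(ℝ, ℝ) 𝓘(ℝ, Model m) ∞ γ s) (hgeo : g.GeodesicAt γ t)
    (hnull : g.form (γ t) (vel γ t) (vel γ t) = 0) {w : Model m}
    (hw : g.form (γ t) (vel γ t) w = 0) :
    ∃ β : ℝ, gh.jac (γ t) (vel γ t) w = g.jac (γ t) (vel γ t) w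
      + (deriv (fun s => deriv (f ∘ γ) s / (2 * f (γ s))) t
          - (deriv (f ∘ γ) t / (2 * f (γ t))) ^ 2) • w + β • vel γ t := by
  have hγ := hγ'.self_of_nhds
  set x₀ := γ t with hx₀
  have hx : γ t ∈ (chartAt (Model m) x₀).source := mem_chart_source _ _
  have hmem : coord x₀ γ t ∈ (chartAt (Model m) x₀).target := (chartAt (Model m) x₀).map_source hx
  have hcc := hf.isConformalChange x₀
  set a := halfDLog (f ∘ (chartAt (Model m) x₀).symm) with ha
  have hda : HasFDerivAt a (fderiv ℝ a (coord x₀ γ t)) (coord x₀ γ t) :=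
    ((hcc.contDiffOn_halfDLog.contDiffAt
      ((chartAt (Model m) x₀).open_target.mem_nhds hmem)).differentiableAt (by simp)).hasFDerivAt
  have hev : (fun s => deriv (f ∘ γ) s / (2 * f (γ s))) =ᶠ[𝓝 t]
      fun s => a (coord x₀ γ s) (deriv (coord x₀ γ) s) := by
    filter_upwards [hγ', eventually_mem_source hγ hx] with s h1 h2
    exact (hf.halfDLog_deriv h1 h2).symm
  have hder : deriv (fun s => deriv (f ∘ γ) s / (2 * f (γ s))) t =
      fderiv ℝ a (coord x₀ γ t) (deriv (coord x₀ γ) t) (deriv (coord x₀ γ) t)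
        + a (coord x₀ γ t) (deriv (deriv (coord x₀ γ)) t) := by
    rw [hev.deriv_eq]
    exact ((hda.comp_hasDerivAt t
      ((contDiffAt_coord hγ hx).differentiableAt (by simp)).hasDerivAt).clm_apply
        ((contDiffAt_deriv_coord hγ hx).differentiableAt (by simp)).hasDerivAt).deriv
  have hres : deriv (deriv (coord x₀ γ)) t = - christoffel (g.local x₀) (coord x₀ γ t)
      (deriv (coord x₀ γ) t) (deriv (coord x₀ γ) t) := eq_neg_of_add_eq_zero_left hgeo
  have hk : g.local x₀ (coord x₀ γ t) (deriv (coord x₀ γ) t) (deriv (coord x₀ γ) t) = 0 := by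
    rw [deriv_coord hγ hx, ← hnull]
    exact g.local_chart hx _ _
  have hw' : g.local x₀ (coord x₀ γ t) (deriv (coord x₀ γ) t)
      (tmap (chartAt (Model m) x₀) (γ t) w) = 0 := by
    rw [deriv_coord hγ hx, ← hw]
    exact g.local_chart hx _ _
  obtain ⟨β, hβ⟩ := hcc.riemann_eq hmem hk hw'
  refine ⟨β, (chartEquiv hx).injective ?_⟩
  simp only [map_add, map_smul, chartEquiv_apply]
  rw [gh.chart_jac hx, g.chart_jac hx, ← deriv_coord hγ hx, hder, hres,
    ← hf.halfDLog_deriv hγ hx, map_neg, ← sub_eq_add_neg]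
  exact hβ

end IsConformalFactor

end Curves

/-! ### The curvature of the screen space -/

section ScreenCurvature

open Module

lemma det_eq_of_conj {V : Type*} [AddCommGroup V] [Module ℝ V] (e : V ≃ₗ[ℝ] V) {A A' : V →ₗ[ℝ] V}
    (h : ∀ w, e (A w) = A' (e w)) : LinearMap.det A' = LinearMap.det A := by
  rw [← LinearMap.det_conj A e]
  congr 1
  ext w
  simp [h]

lemma trace_eq_of_conj {V : Type*} [AddCommGroup V] [Module ℝ V] (e : V ≃ₗ[ℝ] V)
    {A A' : V →ₗ[ℝ] V} (h : ∀ w, e (A w) = A' (e w)) :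
    LinearMap.trace ℝ V A' = LinearMap.trace ℝ V A := by
  rw [← LinearMap.trace_conj' A e]
  congr 1
  ext w
  simp [LinearEquiv.conj_apply, h]

/-- The endomorphism of `V` with the same determinant as the one induced by `a J - l` on
`ker β / ⟨v⟩`, for a linear map `J` with `J v = 0` and `β ∘ J = 0`. -/
def screenLift {V : Type*} [AddCommGroup V] [Module ℝ V] (J : V →ₗ[ℝ] V) (α β : V →ₗ[ℝ] ℝ)
    (v n : V) (a l : ℝ) : V →ₗ[ℝ] V :=
  a • J - l • LinearMap.id + (1 + l) • screenCorrection α β v n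

lemma screenLift_apply {V : Type*} [AddCommGroup V] [Module ℝ V] (J : V →ₗ[ℝ] V)
    (α β : V →ₗ[ℝ] ℝ) (v n w : V) (a l : ℝ) : screenLift J α β v n a l w =
      a • J w - l • w + (1 + l) • (β n)⁻¹ • (β w • n + α w • v) := by
  simp [screenLift, screenCorrection_apply]

variable {m : ℕ} {M : Type*} [TopologicalSpace M] [ChartedSpace (Model m) M]

lemma LorentzMetric.form_symm (g : LorentzMetric m M) (x : M) (u v : Model m) :
    g.form x u v = g.form x v u := g.symm x u v

lemma LorentzMetric.exists_form_ne_zero (g : LorentzMetric m M) (x : M) {v : Model m}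
    (hv : v ≠ 0) : ∃ n, g.form x v n ≠ 0 := by
  by_contra! h
  exact hv (g.nondegenerate x v h)

/-- A non-zero null vector is not orthogonal to a timelike vector. -/
lemma LorentzMetric.form_ne_zero_of_null (g : LorentzMetric m M) (x : M) {u v : Model m}
    (hv : v ≠ 0) (hnull : g.form x v v = 0) (hu : g.form x u u < 0) : g.form x v u ≠ 0 := by
  intro h
  obtain ⟨e, -, he⟩ := g.lorentzian x
  replace he : ∀ w : Model m, g.form x e w = 0 → w ≠ 0 → 0 < g.form x w w := he
  have h' : g.form x u v = 0 := by rw [g.form_symm, h]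
  -- the combination of `v` and `u` orthogonal to `e` is not spacelike, hence zero
  set w : Model m := g.form x e u • v - g.form x e v • u with hw
  have h1 : g.form x e w = 0 := by
    simp only [hw, map_sub, map_smul, smul_eq_mul]
    ring
  have h2 : g.form x w w = g.form x e v ^ 2 * g.form x u u := by
    simp only [hw, map_sub, map_smul, sub_apply, smul_apply, smul_eq_mul, hnull, h, h']
    ring
  have h3 : w = 0 := by
    by_contra h3
    have := he w h1 h3
    rw [h2] at this
    nlinarith [sq_nonneg (g.form x e v)]
  have h4 : g.form x e v = 0 := by
    rw [h3, map_zero] at h2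
    have : g.form x e v ^ 2 = 0 := by
      rcases mul_eq_zero.1 h2.symm with h | h
      · exact h
      · exact absurd h hu.ne
    exact pow_eq_zero_iff (two_ne_zero) |>.1 this
  have := he v h4 hv
  rw [hnull] at this
  exact lt_irrefl _ this

variable [IsManifold 𝓘(ℝ, Model m) ∞ M]

lemma LorentzMetric.form_jac (g : LorentzMetric m M) (x : M) (v w : Model m) :
    g.form x v (g.jac x v w) = 0 := g.jacobi_orthogonal x v w

lemma LorentzMetric.jac_self (g : LorentzMetric m M) (x : M) (v : Model m) :
    g.jac x v v = 0 := g.jacobi_self x v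

lemma LorentzMetric.jac_smul (g : LorentzMetric m M) (x : M) (c : ℝ) (v w : Model m) :
    g.jac x (c • v) w = c ^ 2 • g.jac x v w := by
  rw [g.jac_apply, g.jac_apply, ← map_smul]
  congr 1
  simp only [riemann, map_smul, smul_apply]
  module

variable (C : ConformalClass m M) {g gh : LorentzMetric m M}

/-- The orthogonal complement, as a subspace of the model space. -/
def ConformalClass.perpModel (x : M) (v : Model m) : Submodule ℝ (Model m) := C.perp x v

instance ConformalClass.finite_screen (x : M) (v : TangentSpace 𝓘(ℝ, Model m) x) :
    Module.Finite ℝ (C.Screen x v) :=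
  inferInstanceAs (Module.Finite ℝ
    (C.perpModel x v ⧸ (Submodule.span ℝ {(v : Model m)}).comap (C.perpModel x v).subtype))

lemma ConformalClass.mem_perp_iff (hg : g ∈ C.metrics) (x : M) (v w : Model m) :
    w ∈ C.perpModel x v ↔ g.form x v w = 0 := by
  constructor
  · intro h
    exact h g hg
  · intro h k hk
    obtain ⟨c, -, hc⟩ := C.proportional hg hk x
    exact (hc v w).trans ((congrArg (c * ·) h).trans (mul_zero c))

lemma ConformalClass.finrank_screen (hg : g ∈ C.metrics) (x : M) {v : Model m} (hv : v ≠ 0)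
    (hnull : g.form x v v = 0) : finrank ℝ (C.Screen x v) + 2 = m := by
  have h := LightRay.finrank_screen (V := Model m) (p := C.perpModel x v)
    (β := (g.form x v).toLinearMap) (v := v) (C.mem_perp_iff hg x v) hnull hv (by
      obtain ⟨n, hn⟩ := g.exists_form_ne_zero x hv
      intro h
      exact hn (congrArg (fun L : Model m →ₗ[ℝ] ℝ => L n) h))
  rw [finrank_euclideanSpace_fin] at h
  exact h

/-- The determinant of the screen curvature as a determinant on the tangent space. -/
lemma ConformalClass.det_screenCurvature (hg : g ∈ C.metrics) (x : M) {v n : Model m}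
    (hnull : g.form x v v = 0) (hn : g.form x v n ≠ 0) (a l : ℝ) :
    LinearMap.det (a • C.screenCurvature hg x v - l • LinearMap.id) =
      LinearMap.det (screenLift (g.jac x v) (g.form x n).toLinearMap (g.form x v).toLinearMap
        v n a l) := by
  have hA : ∀ w ∈ C.perpModel x v, (a • g.jac x v - l • LinearMap.id : Model m →ₗ[ℝ] Model m) w ∈
      C.perpModel x v := fun w hw =>
    Submodule.sub_mem _ (Submodule.smul_mem _ a (C.jacobi_mem_perp hg x v w))
      (Submodule.smul_mem _ l hw)
  have hQ : ((Submodule.span ℝ {v}).comap (C.perpModel x v).subtype) ≤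
      ((Submodule.span ℝ {v}).comap (C.perpModel x v).subtype).comap
        (LinearMap.restrict (a • g.jac x v - l • LinearMap.id : Model m →ₗ[ℝ] Model m) hA) := by
    intro w hw
    obtain ⟨c, hc⟩ := Submodule.mem_span_singleton.1 (Submodule.mem_comap.1 hw)
    have h1 : g.jac x v (w : Model m) = 0 := by
      rw [show (w : Model m) = c • v from hc.symm, map_smul, g.jac_self, smul_zero]
    have h2 : (a • g.jac x v - l • LinearMap.id : Model m →ₗ[ℝ] Model m) (w : Model m) ∈
        Submodule.span ℝ {v} := by
      simp only [LinearMap.sub_apply, LinearMap.smul_apply, h1, smul_zero, zero_sub,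
        LinearMap.id_apply]
      exact Submodule.neg_mem _ (Submodule.smul_mem _ l hw)
    exact h2
  have h := det_screen (V := Model m) (p := C.perpModel x v) (α := (g.form x n).toLinearMap)
    (β := (g.form x v).toLinearMap) (v := v) (n := n) (σ := -l)
    (C.mem_perp_iff hg x v) hnull hn (g.form_symm x n v)
    (A := a • g.jac x v - l • LinearMap.id) (fun w => by
      simp [g.form_jac]) (by simp [g.jac_self]) hA hQ
  rw [screenLift, ← sub_neg_eq_add 1 l, ← h]
  congr 1
  refine LinearMap.ext fun w => ?_
  obtain ⟨(w : C.perpModel x v), rfl⟩ := Submodule.Quotient.mk_surjective _ w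
  rfl

lemma ConformalClass.trace_screenCurvature (hg : g ∈ C.metrics) (x : M) (v : Model m) :
    LinearMap.trace ℝ _ (C.screenCurvature hg x v) = LinearMap.trace ℝ _ (g.jac x v) :=
  trace_screen (V := Model m) (p := C.perpModel x v) (β := (g.form x v).toLinearMap) (v := v)
    (C.mem_perp_iff hg x v) (A := g.jac x v) (g.form_jac x v) (g.jac_self x v) _ _

lemma ConformalClass.screenCurvature_eq_add (hg : g ∈ C.metrics) (hgh : gh ∈ C.metrics) (x : M)
    (v : Model m) (μ : ℝ) (h : ∀ w, g.form x v w = 0 →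
      ∃ β : ℝ, gh.jac x v w = g.jac x v w + μ • w + β • v) :
    C.screenCurvature hgh x v = C.screenCurvature hg x v + μ • LinearMap.id := by
  refine LinearMap.ext fun w => ?_
  obtain ⟨(w : C.perpModel x v), rfl⟩ := Submodule.Quotient.mk_surjective _ w
  obtain ⟨β, hβ⟩ := h w ((C.mem_perp_iff hg x v w).1 w.2)
  refine (Submodule.Quotient.eq _).2 ?_
  refine Submodule.mem_comap.2 (Submodule.mem_span_singleton.2 ⟨β, ?_⟩)
  have h1 : gh.jac x v w - (g.jac x v w + μ • (w : Model m)) = β • v := by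
    rw [hβ]
    abel
  exact h1.symm

/-- The value on `v` of the arc form computed with the metric `g`: the determinant of the
trace-free part of the screen curvature, to the power `1 / (2 (m - 2))`. -/
def ConformalClass.arcLength (hg : g ∈ C.metrics) (x : M) (v : Model m) : ℝ :=
  |LinearMap.det (C.screenCurvature hg x v -
    (LinearMap.trace ℝ _ (C.screenCurvature hg x v) / ((m : ℝ) - 2)) • LinearMap.id)| ^
      (1 / (2 * ((m : ℝ) - 2)))

lemma ConformalClass.arcLength_nonneg (hg : g ∈ C.metrics) (x : M) (v : Model m) :
    0 ≤ C.arcLength hg x v := by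
  unfold ConformalClass.arcLength
  positivity

lemma ConformalClass.arcLength_eq (hg : g ∈ C.metrics) (x : M) {v n : Model m}
    (hnull : g.form x v v = 0) (hn : g.form x v n ≠ 0) : C.arcLength hg x v =
      |LinearMap.det (screenLift (g.jac x v) (g.form x n).toLinearMap (g.form x v).toLinearMap
        v n 1 (LinearMap.trace ℝ _ (g.jac x v) / ((m : ℝ) - 2)))| ^ (1 / (2 * ((m : ℝ) - 2))) := by
  rw [← C.det_screenCurvature hg x hnull hn, one_smul, ← C.trace_screenCurvature hg x v]
  rfl

/-- A multiple of the identity does not contribute to the arc form. -/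
lemma ConformalClass.arcLength_eq_of_add (hm : 3 ≤ m) (hg : g ∈ C.metrics) (hgh : gh ∈ C.metrics)
    {x : M} {v : Model m} (hv : v ≠ 0) (hnull : g.form x v v = 0) {μ : ℝ}
    (h : C.screenCurvature hgh x v = C.screenCurvature hg x v + μ • LinearMap.id) :
    C.arcLength hgh x v = C.arcLength hg x v := by
  have hfr := C.finrank_screen hg x hv hnull
  have hm' : (m : ℝ) - 2 ≠ 0 := by
    have : (3 : ℝ) ≤ m := by exact_mod_cast hm
    linarith
  have hfr' : (finrank ℝ (C.Screen x v) : ℝ) = m - 2 := by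
    rw [eq_sub_iff_add_eq]
    exact_mod_cast hfr
  unfold ConformalClass.arcLength
  have ht : LinearMap.trace ℝ (C.Screen x v) (C.screenCurvature hg x v + μ • LinearMap.id) =
      LinearMap.trace ℝ (C.Screen x v) (C.screenCurvature hg x v) + μ * (m - 2) := by
    have : Module.Finite ℝ (C.Screen x v) := C.finite_screen x v
    rw [map_add, map_smul, LinearMap.trace_id]
    exact congrArg (fun r : ℝ => _ + μ * r) hfr'
  rw [h, ht, add_div, mul_div_cancel_right₀ _ hm', add_smul, add_sub_add_right_eq_sub]

lemma screenLift_smul {V : Type*} [AddCommGroup V] [Module ℝ V] {J J' : V →ₗ[ℝ] V}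
    {α β β' : V →ₗ[ℝ] ℝ} {v n : V} {c : ℝ} (hc : c ≠ 0) (hJ : ∀ w, J' w = c ^ 2 • J w)
    (hβ : ∀ w, β' w = c * β w) (l : ℝ) :
    screenLift J' α β' (c • v) n 1 l = screenLift J α β v n (c ^ 2) l := by
  ext w
  rw [screenLift_apply, screenLift_apply, hJ, hβ, hβ, one_smul]
  congr 2
  rw [smul_comm (α w) c v, mul_smul c (β w) n, ← smul_add, smul_smul, mul_inv, mul_comm c⁻¹,
    mul_assoc, inv_mul_cancel₀ hc, mul_one]

lemma ConformalClass.arcLength_smul (hm : 3 ≤ m) (hg : g ∈ C.metrics) (x : M) {v : Model m}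
    (hv : v ≠ 0) (hnull : g.form x v v = 0) {c : ℝ} (hc : c ≠ 0) :
    C.arcLength hg x (c • v) = |c| * C.arcLength hg x v := by
  obtain ⟨n, hn⟩ := g.exists_form_ne_zero x hv
  have hnull' : g.form x (c • v) (c • v) = 0 := by simp [hnull]
  have hn' : g.form x (c • v) n ≠ 0 := by simp [hc, hn]
  have hfr := C.finrank_screen hg x hv hnull
  have ht : LinearMap.trace ℝ _ (g.jac x (c • v)) = c ^ 2 * LinearMap.trace ℝ _ (g.jac x v) := by
    rw [show g.jac x (c • v) = c ^ 2 • g.jac x v from LinearMap.ext (g.jac_smul x c v), map_smul,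
      smul_eq_mul]
  rw [C.arcLength_eq hg x hnull' hn', ht, screenLift_smul hc (g.jac_smul x c v) (β :=
    (g.form x v).toLinearMap) (by simp), ← C.det_screenCurvature hg x hnull hn, mul_div_assoc,
    mul_smul, ← smul_sub, LinearMap.det_smul, C.trace_screenCurvature hg x v |>.symm]
  have hm1 : (1 : ℝ) ≤ (m : ℝ) - 2 := by
    have : (3 : ℝ) ≤ m := by exact_mod_cast hm
    linarith
  have hk : ((m - 2 : ℕ) : ℝ) = (m : ℝ) - 2 := by
    rw [Nat.cast_sub (by omega)]
    norm_num
  have hfr2 : finrank ℝ (C.Screen x v) = m - 2 := by omega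
  rw [abs_mul, Real.mul_rpow (abs_nonneg _) (abs_nonneg _)]
  congr 1
  have e1 : |(c ^ 2) ^ finrank ℝ (C.Screen x v)| = |c| ^ (2 * ((m : ℝ) - 2)) := by
    rw [hfr2, ← pow_mul, abs_pow, ← hk, ← Real.rpow_natCast]
    push_cast
    rfl
  have e2 := Real.rpow_mul (abs_nonneg c) (2 * ((m : ℝ) - 2)) (1 / (2 * ((m : ℝ) - 2)))
  rw [mul_one_div_cancel (by positivity), Real.rpow_one] at e2
  exact (congrArg (· ^ (1 / (2 * ((m : ℝ) - 2)))) e1).trans e2.symm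

section Isometry

variable {M' : Type*} [TopologicalSpace M'] [ChartedSpace (Model m) M']
  [IsManifold 𝓘(ℝ, Model m) ∞ M'] {C' : ConformalClass m M'} {g' : LorentzMetric m M'}
  {φ : Diffeomorph 𝓘(ℝ, Model m) 𝓘(ℝ, Model m) M M' ∞}

lemma IsIsometry.trace_jac (h : IsIsometry g g' φ) (x : M) (v : Model m) :
    LinearMap.trace ℝ _ (g'.jac (φ x) (tmap φ x v)) = LinearMap.trace ℝ _ (g.jac x v) :=
  trace_eq_of_conj (diffeoEquiv φ x) (h.jac_eq x v)

lemma IsIsometry.arcLength_eq (h : IsIsometry g g' φ) (hg : g ∈ C.metrics)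
    (hg' : g' ∈ C'.metrics) (x : M) {v : Model m} (hv : v ≠ 0) (hnull : g.form x v v = 0) :
    C'.arcLength hg' (φ x) (tmap φ x v) = C.arcLength hg x v := by
  obtain ⟨n, hn⟩ := g.exists_form_ne_zero x hv
  rw [C.arcLength_eq hg x hnull hn, C'.arcLength_eq hg' (φ x) (n := tmap φ x n)
    (by rw [← h, hnull]) (by rwa [← h]), h.trace_jac]
  congr 2
  refine det_eq_of_conj (diffeoEquiv φ x) fun w => ?_
  simp only [screenLift_apply, map_add, map_sub, map_smul, diffeoEquiv_apply, h.jac_eq,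
    ContinuousLinearMap.coe_coe, ← h x]

end Isometry

end ScreenCurvature

/-! ### Smooth functions of one variable and conformal factors -/

section Functions

lemma exists_local_inverse {f : ℝ → ℝ} {a : ℝ} (hf : ∀ᶠ x in 𝓝 a, ContDiffAt ℝ ∞ f x)
    (h : deriv f a ≠ 0) : ∃ k : ℝ → ℝ, (∀ᶠ y in 𝓝 (f a), ContDiffAt ℝ ∞ k y) ∧
      (∀ᶠ x in 𝓝 a, k (f x) = x) ∧ ∀ᶠ y in 𝓝 (f a), f (k y) = y := by
  have hfa := hf.self_of_nhds
  have hs := (hfa.hasStrictDerivAt (by simp)).hasStrictFDerivAt_equiv h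
  set e := hs.toOpenPartialHomeomorph f with he
  have hef : ∀ x, e x = f x := fun x => rfl
  have ha : a ∈ e.source := hs.mem_toOpenPartialHomeomorph_source
  have hfa' : f a ∈ e.target := e.map_source ha
  have hk : Tendsto e.symm (𝓝 (f a)) (𝓝 a) := by
    have := (e.continuousAt_symm hfa').tendsto
    rwa [← hef, e.left_inv ha] at this
  refine ⟨e.symm, ?_, ?_, ?_⟩
  · have hd : ∀ᶠ x in 𝓝 a, deriv f x ≠ 0 :=
      ((hfa.derivWithin (m := ∞) (by simp)).continuousAt).eventually_ne h
    filter_upwards [hk.eventually hf, hk.eventually hd, e.open_target.mem_nhds hfa']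
      with y h1 h2 h3
    exact e.contDiffAt_symm_deriv h2 h3 (h1.differentiableAt (by simp)).hasDerivAt h1
  · filter_upwards [e.open_source.mem_nhds ha] with x hx using e.left_inv hx
  · filter_upwards [e.open_target.mem_nhds hfa'] with y hy using e.right_inv hy

variable {m : ℕ}

lemma contDiffAt_trace {A : ℝ → (Model m →ₗ[ℝ] Model m)} {t : ℝ}
    (hA : ∀ w, ContDiffAt ℝ ∞ (fun s => A s w) t) :
    ContDiffAt ℝ ∞ (fun s => LinearMap.trace ℝ _ (A s)) t := by
  set b := (EuclideanSpace.basisFun (Fin m) ℝ).toBasis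
  simp only [LinearMap.trace_eq_matrix_trace ℝ b, Matrix.trace, Matrix.diag,
    LinearMap.toMatrix_apply]
  refine ContDiffAt.sum fun i _ => ?_
  exact (b.coord i).toContinuousLinearMap.contDiff.contDiffAt.comp t (hA (b i))

lemma contDiffAt_det {A : ℝ → (Model m →ₗ[ℝ] Model m)} {t : ℝ}
    (hA : ∀ w, ContDiffAt ℝ ∞ (fun s => A s w) t) :
    ContDiffAt ℝ ∞ (fun s => LinearMap.det (A s)) t := by
  set b := (EuclideanSpace.basisFun (Fin m) ℝ).toBasis
  simp only [← LinearMap.det_toMatrix b, Matrix.det_apply]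
  refine ContDiffAt.sum fun σ _ => ContDiffAt.const_smul _ (contDiffAt_prod fun i _ => ?_)
  simp only [LinearMap.toMatrix_apply]
  exact (b.coord (σ i)).toContinuousLinearMap.contDiff.contDiffAt.comp t (hA (b i))

lemma contDiffAt_screenLift {J : ℝ → (Model m →ₗ[ℝ] Model m)} {α β : ℝ → (Model m →L[ℝ] ℝ)}
    {v : ℝ → Model m} {l : ℝ → ℝ} {t : ℝ} {n : Model m}
    (hJ : ∀ w, ContDiffAt ℝ ∞ (fun s => J s w) t) (hα : ContDiffAt ℝ ∞ α t)
    (hβ : ContDiffAt ℝ ∞ β t) (hv : ContDiffAt ℝ ∞ v t) (hl : ContDiffAt ℝ ∞ l t)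
    (hn : β t n ≠ 0) (w : Model m) :
    ContDiffAt ℝ ∞ (fun s => screenLift (J s) (α s).toLinearMap (β s).toLinearMap (v s) n 1 (l s) w)
      t := by
  have hw : ContDiffAt ℝ ∞ (fun _ : ℝ => w) t := contDiffAt_const
  have hnc : ContDiffAt ℝ ∞ (fun _ : ℝ => n) t := contDiffAt_const
  have h1 : ContDiffAt ℝ ∞ (fun _ : ℝ => (1 : ℝ)) t := contDiffAt_const
  have hβn : ContDiffAt ℝ ∞ (fun s => (β s n)⁻¹) t := (hβ.clm_apply hnc).inv hn
  have hβw : ContDiffAt ℝ ∞ (fun s => β s w • n) t := (hβ.clm_apply hw).smul hnc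
  have hαw : ContDiffAt ℝ ∞ (fun s => α s w • v s) t := (hα.clm_apply hw).smul hv
  simp only [screenLift_apply, ContinuousLinearMap.coe_coe]
  exact ((h1.smul (hJ w)).sub (hl.smul hw)).add ((h1.add hl).smul (hβn.smul (hβw.add hαw)))

end Functions

section Factors

variable {m : ℕ} {M : Type*} [TopologicalSpace M] [ChartedSpace (Model m) M]
  [IsManifold 𝓘(ℝ, Model m) ∞ M]

/-- Around a regular point of a curve, a parameter of the curve is the composition of the chart
with a linear functional and a local diffeomorphism of the line. -/
lemma exists_local_parameter {γ : ℝ → M} {t : ℝ}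
    (hγ : ∀ᶠ s in 𝓝 t, ContMDiffAt 𝓘(ℝ, ℝ) 𝓘(ℝ, Model m) ∞ γ s) (hv : vel (m := m) γ t ≠ 0) :
    ∃ (L : Model m →L[ℝ] ℝ) (k : ℝ → ℝ),
      (∀ᶠ y in 𝓝 (L (coord (m := m) (γ t) γ t)), ContDiffAt ℝ ∞ k y) ∧
      (∀ᶠ s in 𝓝 t, k (L (coord (m := m) (γ t) γ s)) = s) := by
  have hx : γ t ∈ (chartAt (Model m) (γ t)).source := mem_chart_source _ _
  have hd := hasDerivAt_coord (m := m) hγ.self_of_nhds hx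
  set c' : Model m := tmap (chartAt (Model m) (γ t)) (γ t) (vel γ t) with hc'
  have hc0 : c' ≠ 0 := fun h => hv ((chartEquiv hx).injective (by
    rw [chartEquiv_apply, ← hc', h, map_zero]))
  -- the projection to the direction of the velocity is a local coordinate of the curve
  set L : Model m →L[ℝ] ℝ := innerSL ℝ c'
  have hsm : ∀ᶠ s in 𝓝 t, ContDiffAt ℝ ∞ (fun s => L (coord (m := m) (γ t) γ s)) s := by
    filter_upwards [hγ, eventually_mem_source hγ.self_of_nhds hx] with s h1 h2
    exact L.contDiff.contDiffAt.comp s (contDiffAt_coord h1 h2)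
  obtain ⟨k, h1, h2, -⟩ := exists_local_inverse hsm (by
    have : HasDerivAt (fun s => L (coord (m := m) (γ t) γ s)) (L c') t :=
      L.hasFDerivAt.comp_hasDerivAt t hd
    rw [this.deriv]
    simpa [L] using hc0)
  exact ⟨L, k, h1, h2⟩

/-- Near `t`, a positive smooth function along a regular curve is the restriction of a positive
smooth function on the whole manifold. -/
lemma exists_extension [T2Space M] {γ : ℝ → M} {t : ℝ}
    (hγ : ∀ᶠ s in 𝓝 t, ContMDiffAt 𝓘(ℝ, ℝ) 𝓘(ℝ, Model m) ∞ γ s) (hv : vel (m := m) γ t ≠ 0)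
    {ρ : ℝ → ℝ} (hρ : ∀ᶠ s in 𝓝 t, ContDiffAt ℝ ∞ ρ s) (hpos : 0 < ρ t) :
    ∃ f : M → ℝ, ContMDiff 𝓘(ℝ, Model m) 𝓘(ℝ, ℝ) ∞ f ∧ (∀ x, 0 < f x) ∧
      ∀ᶠ s in 𝓝 t, f (γ s) = ρ s := by
  obtain ⟨L, k, hk, hinv⟩ := exists_local_parameter hγ hv
  set x₀ := γ t with hx₀
  set e := chartAt (Model m) x₀ with he
  have hx : x₀ ∈ e.source := mem_chart_source _ _
  set F : M → ℝ := fun x => ρ (k (L (e x))) with hF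
  have hkt : k (L (e x₀)) = t := hinv.self_of_nhds
  have heL : ContinuousAt (fun x => L (e x)) x₀ :=
    L.continuous.continuousAt.comp (e.continuousAt hx)
  have hkc : Tendsto (fun x => k (L (e x))) (𝓝 x₀) (𝓝 t) := by
    have h1 : ContinuousAt k (L (e x₀)) := (ContDiffAt.continuousAt hk.self_of_nhds)
    have h2 : ContinuousAt (fun x => k (L (e x))) x₀ := ContinuousAt.comp (g := k) h1 heL
    have := h2.tendsto
    rwa [hkt] at this
  have hFs : ∀ᶠ x in 𝓝 x₀, ContMDiffAt 𝓘(ℝ, Model m) 𝓘(ℝ, ℝ) ∞ F x := by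
    filter_upwards [heL.tendsto.eventually hk, hkc.eventually hρ, e.open_source.mem_nhds hx]
      with x h1 h2 h3
    have h4 : ContMDiffAt 𝓘(ℝ, Model m) 𝓘(ℝ, Model m) ∞ e x :=
      (contMDiffOn_chart (I := 𝓘(ℝ, Model m)) (x := x₀)).contMDiffAt (e.open_source.mem_nhds h3)
    have h5 : ContDiffAt ℝ ∞ (fun y => ρ (k (L y))) (e x) :=
      ContDiffAt.comp (g := ρ) (e x) h2 (ContDiffAt.comp (g := k) (e x) h1 L.contDiff.contDiffAt)
    exact h5.contMDiffAt.comp x h4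
  have hFp : ∀ᶠ x in 𝓝 x₀, 0 < F x :=
    hkc.eventually (hρ.self_of_nhds.continuousAt.eventually (lt_mem_nhds hpos))
  obtain ⟨b, -, hb⟩ := (SmoothBumpFunction.nhds_basis_tsupport (I := 𝓘(ℝ, Model m)) x₀).mem_iff.1
    (hFs.and hFp)
  -- interpolate between `F` near `x₀` and the constant `1` with a bump function
  refine ⟨fun x => 1 + b x * (F x - 1), ?_, ?_, ?_⟩
  · refine contMDiff_const.add (contMDiff_of_tsupport fun x hx' => ?_)
    have hx2 : x ∈ tsupport b := closure_mono (Function.support_mul_subset_left _ _) hx'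
    exact b.contMDiffAt.mul ((hb hx2).1.sub contMDiffAt_const)
  · intro x
    change 0 < 1 + b x * (F x - 1)
    by_cases hx' : x ∈ tsupport b
    · have h1 := (hb hx').2
      have h2 := b.nonneg (x := x)
      have h3 := b.le_one (x := x)
      have : 1 + b x * (F x - 1) = (1 - b x) + b x * F x := by ring
      rw [this]
      rcases h2.eq_or_lt with h | h
      · rw [← h]
        norm_num
      · have := mul_pos h h1
        linarith
    · rw [image_eq_zero_of_notMem_tsupport hx']
      norm_num
  · have hb1 : ∀ᶠ x in 𝓝 x₀, b x = 1 := b.eventuallyEq_one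
    filter_upwards [hγ.self_of_nhds.continuousAt.eventually hb1, hinv] with s h1 h2
    have : F (γ s) = ρ s := congrArg ρ h2
    simp [h1, this]

lemma ConformalClass.exists_scale (C : ConformalClass m M) {g : LorentzMetric m M}
    (hg : g ∈ C.metrics) {f : M → ℝ} (hf : ContMDiff 𝓘(ℝ, Model m) 𝓘(ℝ, ℝ) ∞ f)
    (hpos : ∀ x, 0 < f x) : ∃ gh ∈ C.metrics, IsConformalFactor g gh f := by
  let gh : LorentzMetric m M :=
    { val := fun x => f x • g.val x
      symm := fun x u v => congrArg (f x * ·) (g.symm x u v)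
      lorentzian := fun x => by
        obtain ⟨v, h1, h2⟩ := g.lorentzian x
        refine ⟨v, mul_neg_of_pos_of_neg (hpos x) h1,
          fun w hw hw0 => mul_pos (hpos x) (h2 w ?_ hw0)⟩
        exact (mul_eq_zero.1 hw).resolve_left (hpos x).ne'
      smooth := fun e he => by
        have h1 : ContDiffOn ℝ ∞ (f ∘ e.symm) e.target := by
          rw [← contMDiffOn_iff_contDiffOn]
          exact hf.comp_contMDiffOn (contMDiffOn_symm_of_mem_maximalAtlas
            (IsManifold.subset_maximalAtlas he))
        exact h1.smul (g.smooth e he) }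
  have h : IsConformalFactor g gh f := ⟨hf, hpos, fun _ _ _ => rfl⟩
  refine ⟨gh, ?_, h⟩
  obtain ⟨k, -, hk⟩ := C.isClass
  obtain ⟨a, ha, ha0, hga⟩ := (hk g).1 hg
  exact (hk gh).2 ⟨fun x => f x * a x, hf.mul ha, fun x => mul_pos (hpos x) (ha0 x),
    fun x u v => by rw [h.eq, hga, mul_assoc]⟩

end Factors

/-! ### The arc form along a curve -/

section AlongCurve

variable {m : ℕ} {M : Type*} [TopologicalSpace M] [ChartedSpace (Model m) M]
  [IsManifold 𝓘(ℝ, Model m) ∞ M] (C : ConformalClass m M) {g : LorentzMetric m M}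
  {γ : ℝ → M} {t : ℝ}

lemma contDiffAt_jacobiMap {x₀ : M} (hγ : ContMDiffAt 𝓘(ℝ, ℝ) 𝓘(ℝ, Model m) ∞ γ t)
    (hx : γ t ∈ (chartAt (Model m) x₀).source) (g : LorentzMetric m M) (w : Model m) :
    ContDiffAt ℝ ∞ (fun s => jacobiMap (g.local x₀) (coord x₀ γ s) (deriv (coord x₀ γ) s) w) t := by
  have hmem : coord x₀ γ t ∈ (chartAt (Model m) x₀).target := (chartAt (Model m) x₀).map_source hx
  have hn := (chartAt (Model m) x₀).open_target.mem_nhds hmem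
  have hΓ := (g.isMetricOn x₀).contDiffOn_christoffel
  have h1 : ContDiffAt ℝ ∞ (fun s => christoffel (g.local x₀) (coord x₀ γ s)) t :=
    (hΓ.contDiffAt hn).comp t (contDiffAt_coord hγ hx)
  have h2 : ContDiffAt ℝ ∞ (fun s => fderiv ℝ (christoffel (g.local x₀)) (coord x₀ γ s)) t :=
    ((hΓ.fderiv_of_isOpen (m := ∞) (chartAt (Model m) x₀).open_target (by simp)).contDiffAt
      hn).comp t (contDiffAt_coord hγ hx)
  have hc := contDiffAt_deriv_coord hγ hx
  have hw : ContDiffAt ℝ ∞ (fun _ : ℝ => w) t := contDiffAt_const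
  change ContDiffAt ℝ ∞ (fun s => riemann (g.local x₀) (coord x₀ γ s) (deriv (coord x₀ γ) s) w
    (deriv (coord x₀ γ) s)) t
  unfold riemann
  exact ((((h2.clm_apply hc).clm_apply hw).clm_apply hc).sub
    (((h2.clm_apply hw).clm_apply hc).clm_apply hc)).add
    ((h1.clm_apply hc).clm_apply ((h1.clm_apply hw).clm_apply hc)) |>.sub
    ((h1.clm_apply hw).clm_apply ((h1.clm_apply hc).clm_apply hc))

lemma trace_jac_coord {x₀ : M} (hγ : ContMDiffAt 𝓘(ℝ, ℝ) 𝓘(ℝ, Model m) ∞ γ t)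
    (hx : γ t ∈ (chartAt (Model m) x₀).source) (g : LorentzMetric m M) :
    LinearMap.trace ℝ _ (g.jac (γ t) (vel γ t)) =
      LinearMap.trace ℝ _ (jacobiMap (g.local x₀) (coord x₀ γ t) (deriv (coord x₀ γ) t)) := by
  symm
  refine trace_eq_of_conj (chartEquiv hx) fun w => ?_
  rw [chartEquiv_apply, g.chart_jac hx, deriv_coord hγ hx]
  rfl

lemma contDiffAt_trace_jac (g : LorentzMetric m M)
    (hγ : ∀ᶠ s in 𝓝 t, ContMDiffAt 𝓘(ℝ, ℝ) 𝓘(ℝ, Model m) ∞ γ s) :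
    ContDiffAt ℝ ∞ (fun s => LinearMap.trace ℝ _ (g.jac (γ s) (vel γ s))) t := by
  have hx : γ t ∈ (chartAt (Model m) (γ t)).source := mem_chart_source _ _
  refine (contDiffAt_trace (contDiffAt_jacobiMap hγ.self_of_nhds hx g)).congr_of_eventuallyEq ?_
  filter_upwards [hγ, eventually_mem_source hγ.self_of_nhds hx] with s h1 h2
  exact trace_jac_coord h1 h2 g

/-- Along a null curve the arc form is a power of the absolute value of a smooth function: the
determinant on the screen space is one on the tangent space, which is smooth in a chart. -/
lemma ConformalClass.exists_contDiffAt_arcLength (hg : g ∈ C.metrics)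
    (hγ : ∀ᶠ s in 𝓝 t, ContMDiffAt 𝓘(ℝ, ℝ) 𝓘(ℝ, Model m) ∞ γ s) (hv : vel (m := m) γ t ≠ 0)
    (hnull : ∀ᶠ s in 𝓝 t, g.form (γ s) (vel γ s) (vel γ s) = 0) :
    ∃ D : ℝ → ℝ, ContDiffAt ℝ ∞ D t ∧ ∀ᶠ s in 𝓝 t,
      C.arcLength hg (γ s) (vel γ s) = |D s| ^ (1 / (2 * ((m : ℝ) - 2))) := by
  set x₀ := γ t with hx₀
  have hx : γ t ∈ (chartAt (Model m) x₀).source := mem_chart_source _ _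
  have hγt := hγ.self_of_nhds
  have hmem : coord x₀ γ t ∈ (chartAt (Model m) x₀).target := (chartAt (Model m) x₀).map_source hx
  obtain ⟨n, hn⟩ := g.exists_form_ne_zero (γ t) hv
  have hc := contDiffAt_deriv_coord hγt hx
  have hG : ContDiffAt ℝ ∞ (fun s => g.local x₀ (coord x₀ γ s)) t :=
    ((g.isMetricOn x₀).contDiffAt hmem).comp t (contDiffAt_coord hγt hx)
  set N := tmap (chartAt (Model m) x₀) (γ t) n with hN
  have hNc : ContDiffAt ℝ ∞ (fun _ : ℝ => N) t := contDiffAt_const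
  have hβ : ContDiffAt ℝ ∞ (fun s => g.local x₀ (coord x₀ γ s) (deriv (coord x₀ γ) s)) t :=
    hG.clm_apply hc
  have hβN := hβ.clm_apply hNc
  have hβt : g.local x₀ (coord x₀ γ t) (deriv (coord x₀ γ) t) N ≠ 0 := by
    rw [deriv_coord hγt hx, hN]
    rwa [show coord x₀ γ t = chartAt (Model m) x₀ (γ t) from rfl, g.local_chart hx]
  refine ⟨fun s => LinearMap.det (screenLift
    (jacobiMap (g.local x₀) (coord x₀ γ s) (deriv (coord x₀ γ) s))
    (g.local x₀ (coord x₀ γ s) N).toLinearMap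
    (g.local x₀ (coord x₀ γ s) (deriv (coord x₀ γ) s)).toLinearMap (deriv (coord x₀ γ) s) N 1
    (LinearMap.trace ℝ _ (g.jac (γ s) (vel γ s)) / ((m : ℝ) - 2))), ?_, ?_⟩
  · exact contDiffAt_det (contDiffAt_screenLift (contDiffAt_jacobiMap hγt hx g)
      (hG.clm_apply hNc) hβ hc ((contDiffAt_trace_jac g hγ).div_const _) hβt)
  · filter_upwards [hγ, hnull, eventually_mem_source hγt hx,
      hβN.continuousAt.eventually_ne hβt] with s h1 h2 h3 h4
    set ns := (chartEquiv h3).symm N with hns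
    have hNs : tmap (chartAt (Model m) x₀) (γ s) ns = N := (chartEquiv h3).apply_symm_apply N
    have hloc : ∀ u v, g.local x₀ (coord x₀ γ s) (tmap (chartAt (Model m) x₀) (γ s) u)
      (tmap (chartAt (Model m) x₀) (γ s) v) = g.form (γ s) u v := g.local_chart h3
    rw [deriv_coord h1 h3, ← hNs, hloc] at h4
    rw [C.arcLength_eq hg (γ s) h2 h4]
    congr 2
    symm
    refine det_eq_of_conj (chartEquiv h3) fun w => ?_
    simp only [screenLift_apply, map_add, map_sub, map_smul, chartEquiv_apply, g.chart_jac h3,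
      ContinuousLinearMap.coe_coe, deriv_coord h1 h3, hNs]
    rw [← hNs, hloc, hloc, hloc]
    rfl

lemma ConformalClass.continuousAt_arcLength (hm : 3 ≤ m) (hg : g ∈ C.metrics)
    (hγ : ∀ᶠ s in 𝓝 t, ContMDiffAt 𝓘(ℝ, ℝ) 𝓘(ℝ, Model m) ∞ γ s) (hv : vel (m := m) γ t ≠ 0)
    (hnull : ∀ᶠ s in 𝓝 t, g.form (γ s) (vel γ s) (vel γ s) = 0) :
    ContinuousAt (fun s => C.arcLength hg (γ s) (vel γ s)) t := by
  obtain ⟨D, hD, h⟩ := C.exists_contDiffAt_arcLength hg hγ hv hnull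
  have hm' : (0 : ℝ) < (m : ℝ) - 2 := by
    have : (3 : ℝ) ≤ m := by exact_mod_cast hm
    linarith
  exact (hD.continuousAt.abs.rpow_const (Or.inr (by positivity))).congr
    (EventuallyEq.symm h)

lemma ConformalClass.contDiffAt_arcLength (hm : 3 ≤ m) (hg : g ∈ C.metrics)
    (hγ : ∀ᶠ s in 𝓝 t, ContMDiffAt 𝓘(ℝ, ℝ) 𝓘(ℝ, Model m) ∞ γ s) (hv : vel (m := m) γ t ≠ 0)
    (hnull : ∀ᶠ s in 𝓝 t, g.form (γ s) (vel γ s) (vel γ s) = 0)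
    (h0 : C.arcLength hg (γ t) (vel γ t) ≠ 0) :
    ContDiffAt ℝ ∞ (fun s => C.arcLength hg (γ s) (vel γ s)) t := by
  obtain ⟨D, hD, h⟩ := C.exists_contDiffAt_arcLength hg hγ hv hnull
  have hm' : (0 : ℝ) < (m : ℝ) - 2 := by
    have : (3 : ℝ) ≤ m := by exact_mod_cast hm
    linarith
  have hDt : D t ≠ 0 := by
    intro hDt
    apply h0
    rw [h.self_of_nhds, hDt, abs_zero, Real.zero_rpow (by positivity)]
  refine (((contDiffAt_abs hDt).comp t hD).rpow_const_of_ne ?_).congr_of_eventuallyEq h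
  exact abs_ne_zero.2 hDt

end AlongCurve

/-! ### Light rays and strong causality -/

section LightRays

variable {m : ℕ} {M : Type*} [TopologicalSpace M] [ChartedSpace (Model m) M]
  [IsManifold 𝓘(ℝ, Model m) ∞ M]

lemma eventually_contMDiffAt {γ : ℝ → M} {I : Set ℝ} (ho : IsOpen I)
    (h : ContMDiffOn 𝓘(ℝ, ℝ) 𝓘(ℝ, Model m) ∞ γ I) {t : ℝ} (ht : t ∈ I) :
    ∀ᶠ s in 𝓝 t, ContMDiffAt 𝓘(ℝ, ℝ) 𝓘(ℝ, Model m) ∞ γ s := by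
  filter_upwards [ho.mem_nhds ht] with s hs using h.contMDiffAt (ho.mem_nhds hs)

/-- The time orientation, as a map to the model space. -/
def Spacetime.timeVec (S : Spacetime m M) (x : M) : Model m := S.T x

lemma Spacetime.form_T_neg (S : Spacetime m M) {g : LorentzMetric m M} (hg : g ∈ S.metrics)
    (x : M) : g.form x (S.timeVec x) (S.timeVec x) < 0 := S.T_timelike g hg x

lemma Spacetime.form_T_ne_zero (S : Spacetime m M) {g : LorentzMetric m M} (hg : g ∈ S.metrics)
    {x : M} {v : Model m} (hv : v ≠ 0) (hnull : g.form x v v = 0) : g.form x v (S.timeVec x) ≠ 0 :=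
  g.form_ne_zero_of_null x hv hnull (S.form_T_neg hg x)

lemma continuousAt_coord_T (S : Spacetime m M) {x₀ x : M}
    (hx : x ∈ (chartAt (Model m) x₀).source) :
    ContinuousAt (fun z => tmap (m := m) (chartAt (Model m) x₀) z (S.timeVec z)) x := by
  have hI : IsManifold 𝓘(ℝ, Model m) 1 M := IsManifold.of_le (n := ∞) (by simp)
  have hx0 : x ∈ (trivializationAt (Model m) (TangentSpace 𝓘(ℝ, Model m)) x₀).baseSet := hx
  have h1 := ((trivializationAt (Model m) (TangentSpace 𝓘(ℝ, Model m)) x₀).contMDiffAt_section_iff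
    (IB := 𝓘(ℝ, Model m)) (n := ∞) (s := S.T) hx0).1 (S.T_smooth x)
  refine h1.continuousAt.congr ?_
  filter_upwards [(chartAt (Model m) x₀).open_source.mem_nhds hx] with z hz
  have h2 : tmap (m := m) (chartAt (Model m) x₀) z = tangentCoordChange 𝓘(ℝ, Model m) z x₀ z :=
    mfderiv_chartAt_eq_tangentCoordChange hz
  rw [h2]
  rfl

lemma continuousAt_form_T (S : Spacetime m M) (g : LorentzMetric m M) {γ : ℝ → M} {t : ℝ}
    (hγ : ∀ᶠ s in 𝓝 t, ContMDiffAt 𝓘(ℝ, ℝ) 𝓘(ℝ, Model m) ∞ γ s) :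
    ContinuousAt (fun s => g.form (γ s) (vel γ s) (S.timeVec (γ s))) t := by
  have hx : γ t ∈ (chartAt (Model m) (γ t)).source := mem_chart_source _ _
  have hγt := hγ.self_of_nhds
  have hmem : coord (γ t) γ t ∈ (chartAt (Model m) (γ t)).target :=
    (chartAt (Model m) (γ t)).map_source hx
  have h1 : ContinuousAt (fun s => g.local (γ t) (coord (γ t) γ s)) t :=
    ((g.isMetricOn (γ t)).contDiffAt hmem).continuousAt.comp (contDiffAt_coord hγt hx).continuousAt
  have h2 := (contDiffAt_deriv_coord hγt hx).continuousAt
  have h3 : ContinuousAt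
      (fun s => tmap (m := m) (chartAt (Model m) (γ t)) (γ s) (S.timeVec (γ s))) t :=
    ContinuousAt.comp (g := fun z => tmap (m := m) (chartAt (Model m) (γ t)) z (S.timeVec z))
      (continuousAt_coord_T S hx) hγt.continuousAt
  refine ((h1.clm_apply h2).clm_apply h3).congr ?_
  filter_upwards [hγ, eventually_mem_source hγt hx] with s h4 h5
  rw [deriv_coord h4 h5]
  exact g.local_chart h5 _ _

lemma vel_neg {γ : ℝ → M} {t : ℝ}
    (hγ : ContMDiffAt 𝓘(ℝ, ℝ) 𝓘(ℝ, Model m) ∞ γ (-t)) :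
    vel (m := m) (γ ∘ Neg.neg) t = - vel γ (-t) := by
  rw [vel_comp hγ differentiable_neg.differentiableAt]
  simp

lemma geodesicAt_neg {g : LorentzMetric m M} {γ : ℝ → M} {t : ℝ}
    (hγ : ContMDiffAt 𝓘(ℝ, ℝ) 𝓘(ℝ, Model m) ∞ γ (-t))
    (hg : g.GeodesicAt γ (-t)) : g.GeodesicAt (γ ∘ Neg.neg) t := by
  have hneg : ContDiff ℝ ∞ (Neg.neg : ℝ → ℝ) := contDiff_neg
  have hx : γ (-t) ∈ (chartAt (Model m) (γ (-t))).source := mem_chart_source _ _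
  refine (g.geodesicAt_iff (x₀ := γ (-t)) (hγ.comp t hneg.contMDiff.contMDiffAt) hx).2 ?_
  rw [g.resid_comp hγ hneg.contDiffAt hx, (g.geodesicAt_iff hγ hx).1 hg]
  simp

/-- Reversing the parameter of a null geodesic. -/
lemma LorentzMetric.IsNullGeodesicOn.neg {g : LorentzMetric m M} {γ : ℝ → M} {I : Set ℝ}
    (h : g.IsNullGeodesicOn γ I) : g.IsNullGeodesicOn (γ ∘ Neg.neg) (Neg.neg ⁻¹' I) := by
  have hs : ∀ t ∈ Neg.neg ⁻¹' I, ContMDiffAt 𝓘(ℝ, ℝ) 𝓘(ℝ, Model m) ∞ γ (-t) := fun t ht =>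
    h.smooth.contMDiffAt (h.isOpen.mem_nhds ht)
  have hneg : ContDiff ℝ ∞ (Neg.neg : ℝ → ℝ) := contDiff_neg
  have hv : ∀ t ∈ Neg.neg ⁻¹' I, vel (m := m) (γ ∘ Neg.neg) t = - vel γ (-t) := fun t ht =>
    vel_neg (hs t ht)
  refine ⟨h.isOpen.preimage continuous_neg, ⟨fun a ha b hb c hc => ?_⟩, ?_, ?_, ?_, ?_, ?_⟩
  · exact h.ordConnected.out hb ha ⟨neg_le_neg hc.2, neg_le_neg hc.1⟩
  · obtain ⟨t, ht⟩ := h.nonempty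
    exact ⟨-t, by simpa using ht⟩
  · exact fun t ht => ((hs t ht).comp t hneg.contMDiff.contMDiffAt).contMDiffWithinAt
  · intro t ht h0
    exact h.regular _ ht (neg_eq_zero.1 ((hv t ht).symm.trans h0))
  · intro t ht
    have h1 : g.form (γ (-t)) (vel (γ ∘ Neg.neg) t) (vel (γ ∘ Neg.neg) t) = 0 := by
      rw [hv t ht]
      simpa using (show g.form (γ (-t)) (vel γ (-t)) (vel γ (-t)) = 0 from h.null _ ht)
    exact h1
  · exact fun t ht => geodesicAt_neg (hs t ht) (h.geodesic _ ht)

/-- A null geodesic of a metric of the class, parametrised towards the future. -/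
structure Spacetime.IsFutureGeodesic (S : Spacetime m M) (g : LorentzMetric m M) (γ : ℝ → M)
    (I : Set ℝ) : Prop where
  mem : g ∈ S.metrics
  geodesic : g.IsNullGeodesicOn γ I
  future : ∀ t ∈ I, g.form (γ t) (vel γ t) (S.timeVec (γ t)) < 0

/-- A null geodesic or its reversal is future-directed. -/
lemma Spacetime.future_or_neg (S : Spacetime m M) {g : LorentzMetric m M} (hg : g ∈ S.metrics)
    {γ : ℝ → M} {I : Set ℝ} (h : g.IsNullGeodesicOn γ I) :
    S.IsFutureGeodesic g γ I ∨ S.IsFutureGeodesic g (γ ∘ Neg.neg) (Neg.neg ⁻¹' I) := by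
  have hne : ∀ t ∈ I, g.form (γ t) (vel γ t) (S.timeVec (γ t)) ≠ 0 := fun t ht =>
    S.form_T_ne_zero hg (h.regular t ht) (h.null t ht)
  have hc : ContinuousOn (fun s => g.form (γ s) (vel γ s) (S.timeVec (γ s))) I := fun t ht =>
    (continuousAt_form_T S g (eventually_contMDiffAt h.isOpen h.smooth ht)).continuousWithinAt
  by_cases hneg : ∀ t ∈ I, g.form (γ t) (vel γ t) (S.timeVec (γ t)) < 0
  · exact Or.inl ⟨hg, h, hneg⟩
  · right
    push Not at hneg
    obtain ⟨a, ha, hapos⟩ := hneg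
    refine ⟨hg, h.neg, fun t ht => ?_⟩
    have h1 : 0 < g.form (γ (-t)) (vel γ (-t)) (S.timeVec (γ (-t))) := by
      by_contra hcon
      obtain ⟨s, hs, hs0⟩ := h.ordConnected.isPreconnected.intermediate_value₂ ht ha hc
        (continuousOn_const (c := (0 : ℝ))) (not_lt.1 hcon) hapos
      exact hne s hs hs0
    rw [vel_neg (h.smooth.contMDiffAt (h.isOpen.mem_nhds ht))]
    have h2 : g.form (γ (-t)) (-vel γ (-t)) (S.timeVec (γ (-t))) < 0 := by
      rw [map_neg, neg_apply]
      linarith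
    exact h2

lemma Spacetime.exists_isFutureGeodesic (S : Spacetime m M) {Γ : Set M} (hΓ : S.IsLightRay Γ) :
    ∃ g γ I, S.IsFutureGeodesic g γ I ∧ γ '' I = Γ := by
  obtain ⟨g, hg, γ, I, h, -, rfl⟩ := hΓ
  rcases S.future_or_neg hg h with h | h
  · exact ⟨g, γ, I, h, rfl⟩
  · refine ⟨g, _, _, h, ?_⟩
    rw [image_comp, image_preimage_eq _ neg_surjective]

namespace Spacetime.IsFutureGeodesic

variable {S : Spacetime m M} {g : LorentzMetric m M} {γ₀ : ℝ → M} {I₀ : Set ℝ}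

lemma contMDiffAt (h : S.IsFutureGeodesic g γ₀ I₀) {t : ℝ} (ht : t ∈ I₀) :
    ContMDiffAt 𝓘(ℝ, ℝ) 𝓘(ℝ, Model m) ∞ γ₀ t :=
  h.geodesic.smooth.contMDiffAt (h.geodesic.isOpen.mem_nhds ht)

lemma vel_ne_zero (h : S.IsFutureGeodesic g γ₀ I₀) {t : ℝ} (ht : t ∈ I₀) :
    vel (m := m) γ₀ t ≠ 0 := h.geodesic.regular t ht

lemma null (h : S.IsFutureGeodesic g γ₀ I₀) {t : ℝ} (ht : t ∈ I₀) :
    g.form (γ₀ t) (vel γ₀ t) (vel γ₀ t) = 0 := h.geodesic.null t ht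

lemma isParametrisation (h : S.IsFutureGeodesic g γ₀ I₀) :
    S.IsParametrisation (γ₀ '' I₀) γ₀ I₀ where
  isOpen := h.geodesic.isOpen
  ordConnected := h.geodesic.ordConnected
  smooth := h.geodesic.smooth
  regular := h.geodesic.regular
  future t ht k hk := by
    obtain ⟨c, hc, hck⟩ := S.proportional h.mem hk (γ₀ t)
    rw [hck]
    exact mul_neg_of_pos_of_neg hc (h.future t ht)
  image_subset := subset_rfl

/-- By strong causality, applied to the complement of `γ₀ (t₀ ± δ)`, the geodesic returns close to
`γ₀ t₀` only for parameters close to `t₀`. -/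
lemma exists_nhds [T2Space M] (h : S.IsFutureGeodesic g γ₀ I₀) {t₀ : ℝ} (ht₀ : t₀ ∈ I₀) {ε : ℝ}
    (hε : 0 < ε) : ∃ V ∈ 𝓝 (γ₀ t₀), ∀ t ∈ I₀, γ₀ t ∈ V → |t - t₀| < ε := by
  have hx : γ₀ t₀ ∈ (chartAt (Model m) (γ₀ t₀)).source := mem_chart_source _ _
  have hne : ∀ᶠ z in 𝓝[≠] t₀, γ₀ z ≠ γ₀ t₀ := by
    have := (hasDerivAt_coord (m := m) (h.contMDiffAt ht₀) hx).eventually_ne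
      (c := coord (γ₀ t₀) γ₀ t₀) (fun h0 => h.vel_ne_zero ht₀ ((chartEquiv hx).injective (by
        rw [chartEquiv_apply, h0, map_zero])))
    filter_upwards [this] with z hz hz'
    exact hz (congrArg (chartAt (Model m) (γ₀ t₀)) hz')
  rw [eventually_nhdsWithin_iff, Metric.eventually_nhds_iff] at hne
  obtain ⟨r, hr, hr'⟩ := hne
  obtain ⟨r₂, hr₂, hr₂'⟩ := Metric.isOpen_iff.1 h.geodesic.isOpen t₀ ht₀
  set δ := min ε (min r r₂) / 2 with hδ
  have hmin : 0 < min ε (min r r₂) := lt_min hε (lt_min hr hr₂)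
  have hδ0 : 0 < δ := by positivity
  have hδ1 : δ < min ε (min r r₂) := half_lt_self hmin
  have hδε : δ < ε := hδ1.trans_le (min_le_left _ _)
  have hδr : δ < r := hδ1.trans_le ((min_le_right _ _).trans (min_le_left _ _))
  have n1 : γ₀ (t₀ + δ) ≠ γ₀ t₀ := hr' (by simp [abs_of_pos hδ0, hδr])
    (by simp [hδ0.ne'])
  have n2 : γ₀ (t₀ - δ) ≠ γ₀ t₀ := hr' (by simp [abs_of_pos hδ0, hδr])
    (by simp [hδ0.ne'])
  have hU : ({γ₀ (t₀ + δ), γ₀ (t₀ - δ)} : Set M)ᶜ ∈ 𝓝 (γ₀ t₀) := by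
    refine (Set.toFinite _).isClosed.isOpen_compl.mem_nhds ?_
    simp [n1.symm, n2.symm]
  obtain ⟨V, hV, -, hVU⟩ := S.stronglyCausal _ _ hU
  have hseg : ∀ a b, a ∈ I₀ → b ∈ I₀ → a ≤ b → γ₀ a ∈ V → γ₀ b ∈ V →
      ∀ t ∈ Icc a b, γ₀ t ∈ ({γ₀ (t₀ + δ), γ₀ (t₀ - δ)} : Set M)ᶜ := by
    intro a b ha hb hab hVa hVb
    have hI : Icc a b ⊆ I₀ := h.geodesic.ordConnected.out ha hb
    refine hVU γ₀ a b hab (fun t ht => h.contMDiffAt (hI ht)) (fun t ht k hk => ⟨?_, ?_⟩) hVa hVb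
    · obtain ⟨c, hc, hck⟩ := S.proportional h.mem hk (γ₀ t)
      rw [hck]
      exact ((congrArg (c * ·) (h.null (hI ht))).trans (mul_zero c)).le
    · exact h.isParametrisation.future t (hI ht) k hk
  refine ⟨V, hV, fun t ht htV => ?_⟩
  have hV0 := mem_of_mem_nhds hV
  refine lt_trans ?_ hδε
  rw [abs_lt]
  constructor
  · by_contra hcon
    have := hseg t t₀ ht ht₀ (by linarith) htV hV0 (t₀ - δ) ⟨by linarith, by linarith⟩
    simp at this
  · by_contra hcon
    have := hseg t₀ t ht₀ ht (by linarith) hV0 htV (t₀ + δ) ⟨by linarith, by linarith⟩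
    simp at this

lemma injOn [T2Space M] (h : S.IsFutureGeodesic g γ₀ I₀) : InjOn γ₀ I₀ := by
  intro a ha b hb hab
  by_contra hne
  obtain ⟨V, hV, hV'⟩ := h.exists_nhds hb (abs_pos.2 (sub_ne_zero.2 hne))
  exact lt_irrefl _ (hV' a ha (hab ▸ mem_of_mem_nhds hV))

end Spacetime.IsFutureGeodesic

/-- `γ = γ₀ ∘ h` on `I`, with `h : I → I₀` smooth and increasing. -/
structure IsReparam (m : ℕ) {M : Type*} [TopologicalSpace M] [ChartedSpace (Model m) M]
    (γ₀ : ℝ → M) (I₀ : Set ℝ) (γ : ℝ → M) (I : Set ℝ) (h : ℝ → ℝ) : Prop where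
  isOpen : IsOpen I
  ordConnected : I.OrdConnected
  contDiffOn : ContDiffOn ℝ ∞ h I
  mapsTo : MapsTo h I I₀
  eq : ∀ t ∈ I, γ t = γ₀ (h t)
  deriv_pos : ∀ t ∈ I, 0 < deriv h t
  vel_eq : ∀ t ∈ I, vel (m := m) γ t = deriv h t • vel γ₀ (h t)

namespace IsReparam

variable {γ₀ γ : ℝ → M} {I₀ I : Set ℝ} {h : ℝ → ℝ}

lemma contDiffAt (hr : IsReparam m γ₀ I₀ γ I h) {t : ℝ} (ht : t ∈ I) : ContDiffAt ℝ ∞ h t :=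
  hr.contDiffOn.contDiffAt (hr.isOpen.mem_nhds ht)

lemma hasDerivAt (hr : IsReparam m γ₀ I₀ γ I h) {t : ℝ} (ht : t ∈ I) :
    HasDerivAt h (deriv h t) t := ((hr.contDiffAt ht).differentiableAt (by simp)).hasDerivAt

lemma eventuallyEq (hr : IsReparam m γ₀ I₀ γ I h) {t : ℝ} (ht : t ∈ I) : γ =ᶠ[𝓝 t] γ₀ ∘ h := by
  filter_upwards [hr.isOpen.mem_nhds ht] with s hs using hr.eq s hs

lemma strictMonoOn (hr : IsReparam m γ₀ I₀ γ I h) : StrictMonoOn h I := by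
  refine strictMonoOn_of_deriv_pos (hr.ordConnected.convex) hr.contDiffOn.continuousOn ?_
  rw [hr.isOpen.interior_eq]
  exact hr.deriv_pos

lemma image_Icc (hr : IsReparam m γ₀ I₀ γ I h) {a b : ℝ} (hab : a ≤ b) (hI : Icc a b ⊆ I) :
    γ '' Icc a b = γ₀ '' Icc (h a) (h b) := by
  have hc : ContinuousOn h (Icc a b) := hr.contDiffOn.continuousOn.mono hI
  have himg : h '' Icc a b = Icc (h a) (h b) := by
    apply Subset.antisymm
    · rintro _ ⟨t, ht, rfl⟩
      exact ⟨hr.strictMonoOn.monotoneOn (hI (left_mem_Icc.2 hab)) (hI ht) ht.1,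
        hr.strictMonoOn.monotoneOn (hI ht) (hI (right_mem_Icc.2 hab)) ht.2⟩
    · exact intermediate_value_Icc hab hc
  rw [← himg, ← image_comp]
  exact image_congr fun t ht => hr.eq t (hI ht)

end IsReparam

/-- Every parametrisation of an arc is a reparametrisation of the geodesic. -/
lemma Spacetime.IsFutureGeodesic.exists_isReparam [T2Space M] {S : Spacetime m M}
    {g : LorentzMetric m M} {γ₀ : ℝ → M} {I₀ : Set ℝ} (hb : S.IsFutureGeodesic g γ₀ I₀)
    {γ : ℝ → M} {I : Set ℝ} (hp : S.IsParametrisation (γ₀ '' I₀) γ I) :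
    ∃ h, IsReparam m γ₀ I₀ γ I h := by
  have hex : ∀ t, ∃ s, t ∈ I → s ∈ I₀ ∧ γ₀ s = γ t := by
    intro t
    by_cases ht : t ∈ I
    · obtain ⟨s, hs, hst⟩ := hp.image_subset (mem_image_of_mem γ ht)
      exact ⟨s, fun _ => ⟨hs, hst⟩⟩
    · exact ⟨0, fun h => absurd h ht⟩
  choose h hh using hex
  have hγ : ∀ t ∈ I, ContMDiffAt 𝓘(ℝ, ℝ) 𝓘(ℝ, Model m) ∞ γ t := fun t ht =>
    hp.smooth.contMDiffAt (hp.isOpen.mem_nhds ht)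
  have hcont : ∀ t ∈ I, ContinuousAt h t := by
    intro t ht
    rw [Metric.continuousAt_iff']
    intro ε hε
    obtain ⟨V, hV, hV'⟩ := hb.exists_nhds (hh t ht).1 hε
    rw [(hh t ht).2] at hV
    filter_upwards [(hγ t ht).continuousAt.eventually hV, hp.isOpen.mem_nhds ht] with s h1 h2
    exact hV' _ (hh s h2).1 (by rwa [(hh s h2).2])
  -- near `t`, the continuous function `h` is `k ∘ L` in the chart, applied to `γ`
  have hsm : ∀ t ∈ I, ContDiffAt ℝ ∞ h t := by
    intro t ht
    have hs := (hh t ht).1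
    obtain ⟨L, k, hk, hinv⟩ := exists_local_parameter (m := m)
      (eventually_contMDiffAt hb.geodesic.isOpen hb.geodesic.smooth hs) (hb.vel_ne_zero hs)
    have hx : γ t ∈ (chartAt (Model m) (γ₀ (h t))).source := by
      rw [(hh t ht).2]
      exact mem_chart_source _ _
    have h1 : ContDiffAt ℝ ∞ (fun s => L (coord (m := m) (γ₀ (h t)) γ s)) t :=
      L.contDiff.contDiffAt.comp t (contDiffAt_coord (hγ t ht) hx)
    have h2 : L (coord (m := m) (γ₀ (h t)) γ t) = L (coord (m := m) (γ₀ (h t)) γ₀ (h t)) := by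
      simp only [coord, (hh t ht).2]
    have h3 := ContDiffAt.comp (g := k) t (h2 ▸ hk.self_of_nhds) h1
    refine h3.congr_of_eventuallyEq ?_
    filter_upwards [(hcont t ht).eventually hinv, hp.isOpen.mem_nhds ht] with s h4 h5
    have h6 : coord (m := m) (γ₀ (h t)) γ s = coord (γ₀ (h t)) γ₀ (h s) := by
      simp only [coord, (hh s h5).2]
    rw [Function.comp_apply, h6, h4]
  have hvel : ∀ t ∈ I, vel (m := m) γ t = deriv h t • vel γ₀ (h t) := by
    intro t ht
    have he : γ =ᶠ[𝓝 t] γ₀ ∘ h := by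
      filter_upwards [hp.isOpen.mem_nhds ht] with s hs using (hh s hs).2.symm
    rw [vel_congr he, vel_comp (hb.contMDiffAt (hh t ht).1)
      ((hsm t ht).differentiableAt (by simp))]
  refine ⟨h, hp.isOpen, hp.ordConnected, fun t ht => (hsm t ht).contDiffWithinAt,
    fun t ht => (hh t ht).1, fun t ht => (hh t ht).2.symm, fun t ht => ?_, hvel⟩
  have h1 : g.form (γ t) (vel γ t) (S.timeVec (γ t)) < 0 := hp.future t ht g hb.mem
  have h2 := hb.future (h t) (hh t ht).1
  rw [(hh t ht).2] at h2
  rw [hvel t ht, map_smul, smul_apply, smul_eq_mul] at h1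
  by_contra hcon
  have := mul_nonneg_of_nonpos_of_nonpos (not_lt.1 hcon) h2.le
  linarith

end LightRays

/-! ### Adapted metrics and reparametrisations -/

section Adapted

variable {m : ℕ} {M : Type*} [TopologicalSpace M] [ChartedSpace (Model m) M]
  [IsManifold 𝓘(ℝ, Model m) ∞ M]

lemma LorentzMetric.resid_congr (g : LorentzMetric m M) {γ γ' : ℝ → M} {t : ℝ} {x₀ : M}
    (h : γ =ᶠ[𝓝 t] γ') : g.resid x₀ γ t = g.resid x₀ γ' t := by
  have h1 : coord (m := m) x₀ γ =ᶠ[𝓝 t] coord x₀ γ' := by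
    filter_upwards [h] with s hs
    simp only [coord, hs]
  simp only [LorentzMetric.resid, h1.deriv.deriv_eq, h1.deriv_eq, h1.self_of_nhds]

/-- Two metrics of the class adapted to the same null curve have the same screen curvature: their
ratio is constant along the curve. -/
lemma ConformalClass.screenCurvature_eq_of_isAdapted (C : ConformalClass m M)
    {g gh : LorentzMetric m M} (hg : g ∈ C.metrics) (hgh : gh ∈ C.metrics) {γ : ℝ → M} {t : ℝ}
    (hγ : ∀ᶠ s in 𝓝 t, ContMDiffAt 𝓘(ℝ, ℝ) 𝓘(ℝ, Model m) ∞ γ s)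
    (hv : ∀ᶠ s in 𝓝 t, vel (m := m) γ s ≠ 0)
    (hnull : ∀ᶠ s in 𝓝 t, g.form (γ s) (vel γ s) (vel γ s) = 0)
    (ha : g.IsAdapted γ t) (hah : gh.IsAdapted γ t) :
    C.screenCurvature hgh (γ t) (vel γ t) = C.screenCurvature hg (γ t) (vel γ t) := by
  obtain ⟨f, hf⟩ := C.exists_isConformalFactor hg hgh
  have hF : ∀ᶠ s in 𝓝 t, deriv (f ∘ γ) s = 0 := by
    filter_upwards [hγ, hv, hnull, ha, hah] with s h1 h2 h3 h4 h5
    have hx : γ s ∈ (chartAt (Model m) (γ s)).source := mem_chart_source _ _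
    have h6 := hf.resid_eq (x₀ := γ s) h1 hx h3
    rw [show gh.resid (γ s) γ s = 0 from h5, show g.resid (γ s) γ s = 0 from h4, zero_add,
      deriv_coord h1 hx] at h6
    rcases smul_eq_zero.1 h6.symm with h | h
    · exact (div_eq_zero_iff.1 h).resolve_right (hf.pos _).ne'
    · exact absurd ((chartEquiv hx).injective (by rw [chartEquiv_apply, h, map_zero])) h2
  have hμ : deriv (fun s => deriv (f ∘ γ) s / (2 * f (γ s))) t
          - (deriv (f ∘ γ) t / (2 * f (γ t))) ^ 2 = 0 := by
    have : (fun s => deriv (f ∘ γ) s / (2 * f (γ s))) =ᶠ[𝓝 t] fun _ => 0 := by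
      filter_upwards [hF] with s hs
      rw [hs, zero_div]
    rw [this.deriv_eq, hF.self_of_nhds]
    simp
  have := C.screenCurvature_eq_add hg hgh (γ t) (vel γ t) 0 (fun w hw => by
    rw [← hμ]
    exact hf.jac_eq hγ ha.self_of_nhds hnull.self_of_nhds hw)
  rw [this, zero_smul, add_zero]

/-- The curvature of a null curve may be computed with any adapted metric. -/
lemma ConformalClass.curvature_eq (C : ConformalClass m M)
    {g : LorentzMetric m M} (hg : g ∈ C.metrics) {γ : ℝ → M} {t : ℝ}
    (hγ : ∀ᶠ s in 𝓝 t, ContMDiffAt 𝓘(ℝ, ℝ) 𝓘(ℝ, Model m) ∞ γ s)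
    (hv : ∀ᶠ s in 𝓝 t, vel (m := m) γ s ≠ 0)
    (hnull : ∀ᶠ s in 𝓝 t, g.form (γ s) (vel γ s) (vel γ s) = 0)
    (ha : g.IsAdapted γ t) :
    C.curvature γ t = C.screenCurvature hg (γ t) (velocity γ t) := by
  have h : ∃ g, g ∈ C.metrics ∧ g.IsAdapted γ t := ⟨g, hg, ha⟩
  unfold ConformalClass.curvature
  rw [dif_pos h]
  exact C.screenCurvature_eq_of_isAdapted hg h.choose_spec.1 hγ hv hnull ha h.choose_spec.2

/-- The value of the arc form on the velocity of `γ`: the determinant of the trace-free part of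
the curvature of `γ`, to the power `1 / (2 (m - 2))`. -/
def ConformalClass.arcDensity (C : ConformalClass m M) (γ : ℝ → M) (t : ℝ) : ℝ :=
  |LinearMap.det (C.curvature γ t - (C.ric γ t / ((m : ℝ) - 2)) • LinearMap.id)| ^
    (1 / (2 * ((m : ℝ) - 2)))

lemma ConformalClass.zeta_eq_arcDensity (C : ConformalClass m M) {γ : ℝ → M} {t : ℝ}
    (h : C.ric γ t = 0) : C.zeta γ t = C.arcDensity γ t := by
  rw [ConformalClass.arcDensity, h, zero_div, zero_smul, sub_zero, ConformalClass.zeta]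

namespace IsReparam

variable {S : Spacetime m M} {g gh : LorentzMetric m M} {γ₀ γ : ℝ → M} {I₀ I : Set ℝ} {h : ℝ → ℝ}
  {t : ℝ}

lemma of_comp (hb : S.IsFutureGeodesic g γ₀ I₀) (ho : IsOpen I) (hc : I.OrdConnected)
    (hs : ContDiffOn ℝ ∞ h I) (hm : MapsTo h I I₀) (hd : ∀ t ∈ I, 0 < deriv h t) :
    IsReparam m γ₀ I₀ (γ₀ ∘ h) I h where
  isOpen := ho
  ordConnected := hc
  contDiffOn := hs
  mapsTo := hm
  eq _ _ := rfl
  deriv_pos := hd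
  vel_eq t ht := vel_comp (hb.contMDiffAt (hm ht))
    ((hs.contDiffAt (ho.mem_nhds ht)).differentiableAt (by simp))

lemma contMDiffAt (hr : IsReparam m γ₀ I₀ γ I h) (hb : S.IsFutureGeodesic g γ₀ I₀) (ht : t ∈ I) :
    ContMDiffAt 𝓘(ℝ, ℝ) 𝓘(ℝ, Model m) ∞ γ t :=
  ((hb.contMDiffAt (hr.mapsTo ht)).comp t (hr.contDiffAt ht).contMDiffAt).congr_of_eventuallyEq
    (hr.eventuallyEq ht)

lemma vel_ne_zero (hr : IsReparam m γ₀ I₀ γ I h) (hb : S.IsFutureGeodesic g γ₀ I₀) (ht : t ∈ I) :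
    vel (m := m) γ t ≠ 0 := by
  rw [hr.vel_eq t ht]
  exact smul_ne_zero (hr.deriv_pos t ht).ne' (hb.vel_ne_zero (hr.mapsTo ht))

lemma null (hr : IsReparam m γ₀ I₀ γ I h) (hb : S.IsFutureGeodesic g γ₀ I₀) (ht : t ∈ I) :
    g.form (γ t) (vel γ t) (vel γ t) = 0 := by
  have h1 := hb.null (hr.mapsTo ht)
  rw [← hr.eq t ht] at h1
  rw [hr.vel_eq t ht]
  simp [h1]

lemma isParametrisation (hr : IsReparam m γ₀ I₀ γ I h) (hb : S.IsFutureGeodesic g γ₀ I₀) :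
    S.IsParametrisation (γ₀ '' I₀) γ I where
  isOpen := hr.isOpen
  ordConnected := hr.ordConnected
  smooth _ ht := (hr.contMDiffAt hb ht).contMDiffWithinAt
  regular _ ht := hr.vel_ne_zero hb ht
  future t ht k hk := by
    obtain ⟨c, hc, hck⟩ := S.proportional hb.mem hk (γ t)
    have h1 := hb.future _ (hr.mapsTo ht)
    rw [← hr.eq t ht] at h1
    have h2 : g.form (γ t) (vel γ t) (S.timeVec (γ t)) < 0 := by
      rw [hr.vel_eq t ht, map_smul, smul_apply, smul_eq_mul]
      exact mul_neg_of_pos_of_neg (hr.deriv_pos t ht) h1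
    rw [hck]
    exact mul_neg_of_pos_of_neg hc h2
  image_subset := by
    rintro _ ⟨t, ht, rfl⟩
    exact ⟨h t, hr.mapsTo ht, (hr.eq t ht).symm⟩

/-- The geodesic equation of `f g` along a reparametrisation `γ₀ ∘ h` of a null geodesic of `g`. -/
lemma geodesicAt_iff (hr : IsReparam m γ₀ I₀ γ I h) (hb : S.IsFutureGeodesic g γ₀ I₀) (ht : t ∈ I)
    {f : M → ℝ} (hf : IsConformalFactor g gh f) : gh.GeodesicAt γ t ↔
      deriv (deriv h) t + deriv (f ∘ γ) t / f (γ t) * deriv h t = 0 := by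
  have hx : γ₀ (h t) ∈ (chartAt (Model m) (γ₀ (h t))).source := mem_chart_source _ _
  have hx' : γ t ∈ (chartAt (Model m) (γ₀ (h t))).source := by
    rw [hr.eq t ht]
    exact hx
  have hc₀ := hb.contMDiffAt (hr.mapsTo ht)
  have hc := hr.contMDiffAt hb ht
  have h1 : g.resid (γ₀ (h t)) γ₀ (h t) = 0 := hb.geodesic.geodesic _ (hr.mapsTo ht)
  have h2 : deriv (coord (m := m) (γ₀ (h t)) γ) t =
      deriv h t • deriv (coord (γ₀ (h t)) γ₀) (h t) := by
    rw [deriv_coord hc hx', deriv_coord hc₀ hx, hr.vel_eq t ht, map_smul, hr.eq t ht]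
  have h3 : deriv (coord (m := m) (γ₀ (h t)) γ₀) (h t) ≠ 0 := by
    rw [deriv_coord hc₀ hx]
    exact fun h0 => hb.vel_ne_zero (hr.mapsTo ht) ((chartEquiv hx).injective (by
      rw [chartEquiv_apply, h0, map_zero]))
  rw [gh.geodesicAt_iff hc hx', hf.resid_eq hc hx' (hr.null hb ht),
    g.resid_congr (hr.eventuallyEq ht), g.resid_comp hc₀ (hr.contDiffAt ht) hx, h1, h2, smul_zero,
    zero_add, smul_smul, ← add_smul, smul_eq_zero, or_iff_left h3]

/-- An adapted metric `f g` for `γ₀ ∘ h` is obtained from `f = 1 / h'` along the curve. -/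
lemma exists_isAdapted [T2Space M] (hr : IsReparam m γ₀ I₀ γ I h)
    (hb : S.IsFutureGeodesic g γ₀ I₀) (ht : t ∈ I) :
    ∃ gh ∈ S.metrics, ∃ f, IsConformalFactor g gh f ∧ gh.IsAdapted γ t ∧
      ∀ᶠ s in 𝓝 t, f (γ s) = (deriv h s)⁻¹ := by
  have hmem := hr.isOpen.mem_nhds ht
  have hρ : ∀ᶠ s in 𝓝 t, ContDiffAt ℝ ∞ (fun s => (deriv h s)⁻¹) s := by
    filter_upwards [hmem] with s hs
    exact ((hr.contDiffAt hs).derivWithin (m := ∞) (by simp)).inv (hr.deriv_pos s hs).ne'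
  obtain ⟨f, hf, hf0, hfγ⟩ := exists_extension (m := m)
    (by filter_upwards [hmem] with s hs using hr.contMDiffAt hb hs) (hr.vel_ne_zero hb ht) hρ
    (inv_pos.2 (hr.deriv_pos t ht))
  obtain ⟨gh, hgh, hcf⟩ := S.exists_scale hb.mem hf hf0
  refine ⟨gh, hgh, f, hcf, ?_, hfγ⟩
  filter_upwards [hmem, hfγ.eventually_nhds] with s hs h1
  rw [hr.geodesicAt_iff hb hs hcf]
  have h2 : f ∘ γ =ᶠ[𝓝 s] (deriv h)⁻¹ := h1
  have hd : HasDerivAt (deriv h) (deriv (deriv h) s) s :=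
    (((hr.contDiffAt hs).derivWithin (m := ∞) (by simp)).differentiableAt (by simp)).hasDerivAt
  have h0 := (hr.deriv_pos s hs).ne'
  rw [h2.deriv_eq, (hd.inv h0).deriv, h1.self_of_nhds]
  field_simp
  ring

/-- The conformal change `f g` adds a multiple of the identity to the screen curvature along a null
geodesic of `g`. -/
lemma screenCurvature_eq (hb : S.IsFutureGeodesic g γ₀ I₀) {s : ℝ} (hs : s ∈ I₀)
    (hgh : gh ∈ S.metrics) {f : M → ℝ} (hf : IsConformalFactor g gh f) :
    S.screenCurvature hgh (γ₀ s) (vel γ₀ s) = S.screenCurvature hb.mem (γ₀ s) (vel γ₀ s)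
      + (deriv (fun r => deriv (f ∘ γ₀) r / (2 * f (γ₀ r))) s
          - (deriv (f ∘ γ₀) s / (2 * f (γ₀ s))) ^ 2) • LinearMap.id :=
  S.screenCurvature_eq_add hb.mem hgh _ _ _ fun _ hw =>
    hf.jac_eq (eventually_contMDiffAt hb.geodesic.isOpen hb.geodesic.smooth hs)
      (hb.geodesic.geodesic s hs) (hb.null hs) hw

lemma curvature_eq (hr : IsReparam m γ₀ I₀ γ I h) (hb : S.IsFutureGeodesic g γ₀ I₀) (ht : t ∈ I)
    (hgh : gh ∈ S.metrics) (ha : gh.IsAdapted γ t) :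
    S.curvature γ t = S.screenCurvature hgh (γ t) (velocity γ t) := by
  have hmem := hr.isOpen.mem_nhds ht
  refine S.curvature_eq hgh ?_ ?_ ?_ ha
  · filter_upwards [hmem] with s hs using hr.contMDiffAt hb hs
  · filter_upwards [hmem] with s hs using hr.vel_ne_zero hb hs
  · filter_upwards [hmem] with s hs
    obtain ⟨c, -, hck⟩ := S.proportional hb.mem hgh (γ s)
    exact (hck _ _).trans ((congrArg (c * ·) (hr.null hb hs)).trans (mul_zero c))

/-- The arc form scales like a 1-form under reparametrisations. -/
lemma arcDensity_eq [T2Space M] (hm : 3 ≤ m) (hr : IsReparam m γ₀ I₀ γ I h)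
    (hb : S.IsFutureGeodesic g γ₀ I₀) (ht : t ∈ I) :
    S.arcDensity γ t = deriv h t * S.arcLength hb.mem (γ₀ (h t)) (vel γ₀ (h t)) := by
  obtain ⟨gh, hgh, f, hf, ha, -⟩ := hr.exists_isAdapted hb ht
  have hs := hr.mapsTo ht
  have hnull : gh.form (γ₀ (h t)) (vel γ₀ (h t)) (vel γ₀ (h t)) = 0 :=
    (hf.eq _ _ _).trans ((congrArg (f (γ₀ (h t)) * ·) (hb.null hs)).trans (mul_zero _))
  have h1 : S.arcDensity γ t = S.arcLength hgh (γ t) (vel γ t) := by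
    unfold ConformalClass.arcDensity ConformalClass.ric
    rw [hr.curvature_eq hb ht hgh ha]
    rfl
  rw [h1, hr.vel_eq t ht, hr.eq t ht,
    S.arcLength_smul hm hgh _ (hb.vel_ne_zero hs) hnull (hr.deriv_pos t ht).ne',
    abs_of_pos (hr.deriv_pos t ht),
    S.arcLength_eq_of_add hm hb.mem hgh (hb.vel_ne_zero hs) (hb.null hs)
      (screenCurvature_eq hb hs hgh hf)]

/-- The transformation of the Ricci term under reparametrisations: for `b = -h'' / (2 h' ^ 2)`, the
expression `b' / h' - b ^ 2` is `-1 / (2 h' ^ 2)` times the Schwarzian derivative of `h`. -/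
lemma ric_eq [T2Space M] (hr : IsReparam m γ₀ I₀ γ I h)
    (hb : S.IsFutureGeodesic g γ₀ I₀) (ht : t ∈ I) {b : ℝ → ℝ} {b' : ℝ}
    (hbeq : ∀ᶠ s in 𝓝 t, b s = -(deriv (deriv h) s) / (2 * deriv h s ^ 2))
    (hb' : HasDerivAt b b' t) :
    S.ric γ t = deriv h t ^ 2 * (LinearMap.trace ℝ _ (g.jac (γ₀ (h t)) (vel γ₀ (h t)))
      + ((m : ℝ) - 2) * (b' / deriv h t - b t ^ 2)) := by
  obtain ⟨gh, hgh, f, hf, ha, hfh⟩ := hr.exists_isAdapted hb ht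
  have hs := hr.mapsTo ht
  have hv := hb.vel_ne_zero hs
  have h0 := (hr.deriv_pos t ht).ne'
  have hmem := hr.isOpen.mem_nhds ht
  -- half the logarithmic derivative of `f` in the geodesic parameter; as `f = 1 / h'`, it is `b`
  set B : ℝ → ℝ := fun r => deriv (f ∘ γ₀) r / (2 * f (γ₀ r)) with hB
  have hBs : DifferentiableAt ℝ B (h t) := by
    have h1 := hf.contDiffAt_comp (hb.contMDiffAt hs)
    have h2 : DifferentiableAt ℝ (fun r => 2 * f (γ₀ r)) (h t) :=
      (h1.differentiableAt (by simp)).const_mul 2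
    exact ((h1.derivWithin (m := ∞) (by simp)).differentiableAt (by simp)).div h2
      (mul_ne_zero two_ne_zero (hf.pos _).ne')
  have hBh : ∀ᶠ s in 𝓝 t, B (h s) = b s := by
    filter_upwards [hbeq, hmem, hfh.eventually_nhds] with s h1 h2 h3
    have h4 : f ∘ γ₀ ∘ h =ᶠ[𝓝 s] fun s => (deriv h s)⁻¹ := by
      filter_upwards [h3, hr.isOpen.mem_nhds h2] with r h5 h6
      rw [← h5, hr.eq r h6]
      rfl
    have h5 : HasDerivAt (f ∘ γ₀) (deriv (f ∘ γ₀) (h s)) (h s) :=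
      ((hf.contDiffAt_comp (hb.contMDiffAt (hr.mapsTo h2))).differentiableAt (by simp)).hasDerivAt
    have h6 := h5.comp s (hr.hasDerivAt h2)
    have hd : HasDerivAt (deriv h) (deriv (deriv h) s) s :=
      (((hr.contDiffAt h2).derivWithin (m := ∞) (by simp)).differentiableAt (by simp)).hasDerivAt
    have h7 := (hr.deriv_pos s h2).ne'
    have h8 : deriv (f ∘ γ₀) (h s) * deriv h s = -deriv (deriv h) s / deriv h s ^ 2 := by
      rw [← h6.deriv, ← (hd.inv h7).deriv]
      exact h4.deriv_eq
    have h9 : f (γ₀ (h s)) = (deriv h s)⁻¹ := h4.self_of_nhds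
    rw [h1, hB]
    simp only [h9]
    rw [eq_div_iff h7 |>.2 h8]
    field_simp
  have hBt : B (h t) = b t := hBh.self_of_nhds
  have hB' : deriv B (h t) = b' / deriv h t := by
    rw [eq_div_iff h0, ← (hBs.hasDerivAt.comp t (hr.hasDerivAt ht)).deriv, ← hb'.deriv]
    exact EventuallyEq.deriv_eq hBh
  have h1 : S.ric γ t = LinearMap.trace ℝ _ (gh.jac (γ t) (vel γ t)) := by
    rw [← S.trace_screenCurvature hgh]
    unfold ConformalClass.ric
    rw [hr.curvature_eq hb ht hgh ha]
    rfl
  have h2 : gh.jac (γ₀ (h t)) (deriv h t • vel γ₀ (h t)) =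
      deriv h t ^ 2 • gh.jac (γ₀ (h t)) (vel γ₀ (h t)) := LinearMap.ext (gh.jac_smul _ _ _)
  have h3 := screenCurvature_eq hb hs hgh hf
  have hfin : Module.Finite ℝ (S.Screen (γ₀ (h t)) (vel γ₀ (h t))) := S.finite_screen _ _
  have h4 : (Module.finrank ℝ (S.Screen (γ₀ (h t)) (vel γ₀ (h t))) : ℝ) = (m : ℝ) - 2 := by
    rw [eq_sub_iff_add_eq]
    exact_mod_cast S.finrank_screen hb.mem (γ₀ (h t)) hv (hb.null hs)
  have h5 := congrArg (LinearMap.trace ℝ (S.Screen (γ₀ (h t)) (vel γ₀ (h t)))) h3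
  rw [map_add, map_smul, LinearMap.trace_id] at h5
  have h6 : LinearMap.trace ℝ _ (gh.jac (γ₀ (h t)) (vel γ₀ (h t))) =
      LinearMap.trace ℝ _ (g.jac (γ₀ (h t)) (vel γ₀ (h t)))
        + (deriv B (h t) - B (h t) ^ 2) * ((m : ℝ) - 2) := by
    rw [← h4, ← S.trace_screenCurvature hgh, ← S.trace_screenCurvature hb.mem]
    exact h5
  rw [h1, hr.vel_eq t ht, hr.eq t ht, h2, map_smul, h6, hB', hBt, smul_eq_mul]
  ring

end IsReparam

end Adapted

/-! ### Existence of projective parametrisations -/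

section Projective

/-- Solutions of a smooth autonomous equation are smooth. -/
lemma contDiffOn_of_hasDerivAt {E : Type*} [NormedAddCommGroup E] [NormedSpace ℝ E] {X : E → E}
    {W : Set E} (hX : ContDiffOn ℝ ∞ X W) {α : ℝ → E} {J : Set ℝ} (ho : IsOpen J)
    (hm : MapsTo α J W) (hα : ∀ t ∈ J, HasDerivAt α (X (α t)) t) : ContDiffOn ℝ ∞ α J := by
  rw [contDiffOn_infty]
  intro n
  induction n with
  | zero =>
    exact contDiffOn_zero.2 fun t ht => (hα t ht).continuousAt.continuousWithinAt
  | succ n ih =>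
    push_cast
    rw [contDiffOn_succ_iff_deriv_of_isOpen ho]
    refine ⟨fun t ht => (hα t ht).differentiableAt.differentiableWithinAt, by simp, ?_⟩
    exact ((hX.of_le (mod_cast le_top)).comp ih hm).congr fun t ht => (hα t ht).deriv

variable {m : ℕ} {M : Type*} [TopologicalSpace M] [ChartedSpace (Model m) M]
  [IsManifold 𝓘(ℝ, Model m) ∞ M] {S : Spacetime m M} {g : LorentzMetric m M} {γ₀ : ℝ → M}
  {I₀ : Set ℝ}

/-- A null geodesic has a reparametrisation with vanishing Ricci term around every parameter. -/
lemma Spacetime.IsFutureGeodesic.exists_projective [T2Space M] (hm : 3 ≤ m)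
    (hb : S.IsFutureGeodesic g γ₀ I₀) {s₀ : ℝ} (hs₀ : s₀ ∈ I₀) :
    ∃ (γ : ℝ → M) (I : Set ℝ) (h : ℝ → ℝ), IsReparam m γ₀ I₀ γ I h ∧ 0 ∈ I ∧ h 0 = s₀ ∧
      ∀ t ∈ I, S.ric γ t = 0 := by
  have hm' : (m : ℝ) - 2 ≠ 0 := by
    have : (3 : ℝ) ≤ m := by exact_mod_cast hm
    linarith
  set q : ℝ → ℝ := fun s => LinearMap.trace ℝ _ (g.jac (γ₀ s) (vel γ₀ s)) / ((m : ℝ) - 2) with hq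
  have hqs : ContDiffOn ℝ ∞ q I₀ := fun s hs =>
    ((contDiffAt_trace_jac g (eventually_contMDiffAt hb.geodesic.isOpen hb.geodesic.smooth
      hs)).div_const _).contDiffWithinAt
  -- With `y'' = q y` as a function of the geodesic parameter, `h` solves `h' = y(h) ^ 2`; the
  -- unknowns of the autonomous system are `h`, `y(h)` and `y'(h)`.
  set X : ℝ × ℝ × ℝ → ℝ × ℝ × ℝ := fun p => (p.2.1 ^ 2, p.2.2 * p.2.1 ^ 2, q p.1 * p.2.1 ^ 3)
    with hXdef
  set W : Set (ℝ × ℝ × ℝ) := {p | p.1 ∈ I₀ ∧ 0 < p.2.1} with hW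
  have hWo : IsOpen W := (hb.geodesic.isOpen.preimage continuous_fst).inter
    (isOpen_lt continuous_const (continuous_fst.comp continuous_snd))
  have hX : ContDiffOn ℝ ∞ X W := by
    have h1 : ContDiffOn ℝ ∞ (fun p : ℝ × ℝ × ℝ => q p.1) W :=
      hqs.comp contDiff_fst.contDiffOn fun p hp => hp.1
    have h2 : ContDiffOn ℝ ∞ (fun p : ℝ × ℝ × ℝ => p.2.1) W :=
      (contDiff_fst.comp contDiff_snd).contDiffOn
    have h3 : ContDiffOn ℝ ∞ (fun p : ℝ × ℝ × ℝ => p.2.2) W :=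
      (contDiff_snd.comp contDiff_snd).contDiffOn
    exact (h2.pow 2).prodMk ((h3.mul (h2.pow 2)).prodMk (h1.mul (h2.pow 3)))
  have hp₀ : ((s₀, 1, 0) : ℝ × ℝ × ℝ) ∈ W := ⟨hs₀, one_pos⟩
  obtain ⟨α, hα0, ε, hε, hα⟩ :=
    ContDiffAt.exists_forall_mem_closedBall_exists_eq_forall_mem_Ioo_hasDerivAt₀
      ((hX.contDiffAt (hWo.mem_nhds hp₀)).of_le (mod_cast le_top)) 0
  have hc0 : ContinuousAt α 0 := (hα 0 ⟨by linarith, by linarith⟩).continuousAt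
  have hn : α ⁻¹' W ∩ Ioo (0 - ε) (0 + ε) ∈ 𝓝 (0 : ℝ) :=
    inter_mem (hc0.preimage_mem_nhds (hWo.mem_nhds (hα0 ▸ hp₀)))
      (Ioo_mem_nhds (by linarith) (by linarith))
  obtain ⟨δ, hδ, hJ⟩ := Metric.mem_nhds_iff.1 hn
  set J := Metric.ball (0 : ℝ) δ with hJdef
  have hJo : IsOpen J := Metric.isOpen_ball
  have hαW : ∀ t ∈ J, α t ∈ W := fun t ht => (hJ ht).1
  have hαd : ∀ t ∈ J, HasDerivAt α (X (α t)) t := fun t ht => hα t (hJ ht).2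
  have hαs : ContDiffOn ℝ ∞ α J := contDiffOn_of_hasDerivAt hX hJo hαW hαd
  set h : ℝ → ℝ := fun t => (α t).1 with hh
  set Y : ℝ → ℝ := fun t => (α t).2.1 with hY
  set Z : ℝ → ℝ := fun t => (α t).2.2 with hZ
  have hh' : ∀ t ∈ J, HasDerivAt h (Y t ^ 2) t := fun t ht => (hαd t ht).fst
  have hY' : ∀ t ∈ J, HasDerivAt Y (Z t * Y t ^ 2) t := fun t ht => (hαd t ht).snd.fst
  have hZ' : ∀ t ∈ J, HasDerivAt Z (q (h t) * Y t ^ 3) t := fun t ht => (hαd t ht).snd.snd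
  have hYpos : ∀ t ∈ J, 0 < Y t := fun t ht => (hαW t ht).2
  have hJc : J.OrdConnected := by
    rw [hJdef, Real.ball_eq_Ioo]
    exact ordConnected_Ioo
  have hr : IsReparam m γ₀ I₀ (γ₀ ∘ h) J h :=
    IsReparam.of_comp hb hJo hJc (contDiff_fst.comp_contDiffOn hαs) (fun t ht => (hαW t ht).1)
      fun t ht => by
        rw [(hh' t ht).deriv]
        exact pow_pos (hYpos t ht) 2
  refine ⟨γ₀ ∘ h, J, h, hr, Metric.mem_ball_self hδ, congrArg Prod.fst hα0, fun t ht => ?_⟩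
  have hYt := (hYpos t ht).ne'
  have hb' : HasDerivAt (fun s => -Z s / Y s) (-(q (h t) * Y t ^ 2) + Z t ^ 2) t := by
    refine ((hZ' t ht).neg.div (hY' t ht) hYt).congr_deriv ?_
    simp only [Pi.neg_apply]
    field_simp
    ring
  rw [hr.ric_eq hb ht (b := fun s => -Z s / Y s) ?_ hb', (hh' t ht).deriv]
  · have hqt : LinearMap.trace ℝ _ (g.jac (γ₀ (h t)) (vel γ₀ (h t))) =
        ((m : ℝ) - 2) * q (h t) := by
      rw [hq]
      field_simp
    rw [hqt]
    field_simp
    ring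
  · filter_upwards [hJo.mem_nhds ht] with s hs
    have h1 : deriv h =ᶠ[𝓝 s] fun r => Y r ^ 2 := by
      filter_upwards [hJo.mem_nhds hs] with r hr using (hh' r hr).deriv
    have hYs := (hYpos s hs).ne'
    rw [h1.deriv_eq, ((hY' s hs).fun_pow 2).deriv, (hh' s hs).deriv]
    field_simp
    simp
    ring

end Projective

/-! ### The arc form along a light ray -/

section ArcForm

/-- A smooth function with positive derivative on an interval has a smooth inverse. -/
lemma exists_smooth_inverse {u : ℝ → ℝ} {I : Set ℝ} (ho : IsOpen I) (hc : I.OrdConnected)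
    (hu : ContDiffOn ℝ ∞ u I) (hpos : ∀ t ∈ I, 0 < deriv u t) :
    ∃ k : ℝ → ℝ, IsOpen (u '' I) ∧ (u '' I).OrdConnected ∧ ContDiffOn ℝ ∞ k (u '' I) ∧
      (∀ t ∈ I, k (u t) = t) ∧ ∀ t ∈ I, deriv k (u t) = (deriv u t)⁻¹ := by
  have hinj : InjOn u I := by
    refine (strictMonoOn_of_deriv_pos hc.convex hu.continuousOn ?_).injOn
    rwa [ho.interior_eq]
  have hk : ∀ t ∈ I, Function.invFunOn u I (u t) = t := fun t ht => hinj.leftInvOn_invFunOn ht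
  have hloc : ∀ t ∈ I, u '' I ∈ 𝓝 (u t) ∧ ContDiffAt ℝ ∞ (Function.invFunOn u I) (u t) := by
    intro t ht
    obtain ⟨κ, h1, h2, h3⟩ := exists_local_inverse
      (by filter_upwards [ho.mem_nhds ht] with s hs using hu.contDiffAt (ho.mem_nhds hs))
      (hpos t ht).ne'
    have h4 : κ (u t) = t := h2.self_of_nhds
    have h5 : ∀ᶠ y in 𝓝 (u t), κ y ∈ I := by
      refine h1.self_of_nhds.continuousAt.eventually ?_
      rw [h4]
      exact ho.mem_nhds ht
    constructor
    · filter_upwards [h3, h5] with y h6 h7 using ⟨κ y, h7, h6⟩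
    · refine h1.self_of_nhds.congr_of_eventuallyEq ?_
      filter_upwards [h3, h5] with y h6 h7
      conv_lhs => rw [← h6]
      exact hk _ h7
  refine ⟨Function.invFunOn u I, ?_, ?_, ?_, hk, fun t ht => ?_⟩
  · rw [isOpen_iff_mem_nhds]
    rintro _ ⟨t, ht, rfl⟩
    exact (hloc t ht).1
  · exact (hc.isPreconnected.image u hu.continuousOn).ordConnected
  · rintro _ ⟨t, ht, rfl⟩
    exact (hloc t ht).2.contDiffWithinAt
  · have h1 := ((hloc t ht).2.differentiableAt (by simp)).hasDerivAt.comp t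
      ((hu.contDiffAt (ho.mem_nhds ht)).differentiableAt (by simp)).hasDerivAt
    have h2 : Function.invFunOn u I ∘ u =ᶠ[𝓝 t] id := by
      filter_upwards [ho.mem_nhds ht] with s hs using hk s hs
    have h3 := h2.deriv_eq
    rw [h1.deriv, deriv_id] at h3
    exact eq_inv_of_mul_eq_one_left h3

variable {m : ℕ} {M : Type*} [TopologicalSpace M] [ChartedSpace (Model m) M]
  [IsManifold 𝓘(ℝ, Model m) ∞ M] {S : Spacetime m M} {g : LorentzMetric m M} {γ₀ : ℝ → M}
  {I₀ : Set ℝ}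

namespace Spacetime.IsFutureGeodesic

/-- The density of the arc form in the geodesic parameter. -/
def density (hb : S.IsFutureGeodesic g γ₀ I₀) (s : ℝ) : ℝ :=
  S.arcLength hb.mem (γ₀ s) (vel γ₀ s)

lemma continuousOn_density (hm : 3 ≤ m) (hb : S.IsFutureGeodesic g γ₀ I₀) :
    ContinuousOn hb.density I₀ := fun s hs =>
  (S.continuousAt_arcLength hm hb.mem
    (eventually_contMDiffAt hb.geodesic.isOpen hb.geodesic.smooth hs) (hb.vel_ne_zero hs)
    (by filter_upwards [hb.geodesic.isOpen.mem_nhds hs] with r hr using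
      hb.null hr)).continuousWithinAt

lemma contDiffAt_density (hm : 3 ≤ m) (hb : S.IsFutureGeodesic g γ₀ I₀) {s : ℝ} (hs : s ∈ I₀)
    (h0 : hb.density s ≠ 0) : ContDiffAt ℝ ∞ hb.density s :=
  S.contDiffAt_arcLength hm hb.mem
    (eventually_contMDiffAt hb.geodesic.isOpen hb.geodesic.smooth hs) (hb.vel_ne_zero hs)
    (by filter_upwards [hb.geodesic.isOpen.mem_nhds hs] with r hr using hb.null hr) h0

end Spacetime.IsFutureGeodesic

namespace IsReparam

variable {γ : ℝ → M} {I : Set ℝ} {h : ℝ → ℝ} [T2Space M]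

lemma arcDensity_eq_density (hm : 3 ≤ m) (hr : IsReparam m γ₀ I₀ γ I h)
    (hb : S.IsFutureGeodesic g γ₀ I₀) {t : ℝ} (ht : t ∈ I) :
    S.arcDensity γ t = hb.density (h t) * deriv h t := by
  rw [hr.arcDensity_eq hm hb ht, mul_comm]
  rfl

lemma continuousOn_deriv (hr : IsReparam m γ₀ I₀ γ I h) : ContinuousOn (deriv h) I :=
  hr.contDiffOn.continuousOn_deriv_of_isOpen hr.isOpen (by simp)

lemma continuousOn_arcDensity (hm : 3 ≤ m) (hr : IsReparam m γ₀ I₀ γ I h)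
    (hb : S.IsFutureGeodesic g γ₀ I₀) : ContinuousOn (S.arcDensity γ) I :=
  (((hb.continuousOn_density hm).comp hr.contDiffOn.continuousOn hr.mapsTo).mul
    hr.continuousOn_deriv).congr fun _ ht => hr.arcDensity_eq_density hm hb ht

lemma integral_arcDensity (hm : 3 ≤ m) (hr : IsReparam m γ₀ I₀ γ I h)
    (hb : S.IsFutureGeodesic g γ₀ I₀) {a b : ℝ} (ha : a ∈ I) (hb' : b ∈ I) :
    ∫ t in a..b, S.arcDensity γ t = ∫ s in h a..h b, hb.density s := by
  have hI : uIcc a b ⊆ I := hr.ordConnected.uIcc_subset ha hb'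
  rw [← intervalIntegral.integral_comp_mul_deriv' (fun t ht => hr.hasDerivAt (hI ht))
    (hr.continuousOn_deriv.mono hI)
    ((hb.continuousOn_density hm).mono (by
      rintro _ ⟨t, ht, rfl⟩
      exact hr.mapsTo (hI ht)))]
  exact intervalIntegral.integral_congr fun t ht => hr.arcDensity_eq_density hm hb (hI ht)

end IsReparam

lemma Spacetime.IsProjective.zeta_eq {Γ : Set M} {γ : ℝ → M} {I : Set ℝ}
    (hp : S.IsProjective Γ γ I) {t : ℝ} (ht : t ∈ I) : S.zeta γ t = S.arcDensity γ t :=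
  S.zeta_eq_arcDensity (hp.ric_eq_zero t ht)

namespace Spacetime.IsFutureGeodesic

variable [T2Space M]

/-- The length of a segment in terms of the geodesic parameter. The injectivity of the geodesic
recovers the end points from the segment. -/
lemma conformalLength_eq (hm : 3 ≤ m) (hb : S.IsFutureGeodesic g γ₀ I₀) {s₁ s₂ : ℝ}
    (hI : Icc s₁ s₂ ⊆ I₀)
    (hex : ∃ γ I a b, S.IsProjectiveSegment (γ₀ '' I₀) (γ₀ '' Icc s₁ s₂) γ I a b) :
    S.conformalLength (γ₀ '' I₀) (γ₀ '' Icc s₁ s₂) = ∫ s in s₁..s₂, hb.density s := by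
  have hex' : ∃ p : (ℝ → M) × Set ℝ × ℝ × ℝ,
      S.IsProjectiveSegment (γ₀ '' I₀) (γ₀ '' Icc s₁ s₂) p.1 p.2.1 p.2.2.1 p.2.2.2 := by
    obtain ⟨γ, I, a, b, h⟩ := hex
    exact ⟨(γ, I, a, b), h⟩
  unfold Spacetime.conformalLength
  rw [dif_pos hex']
  have hp := hex'.choose_spec
  set p := hex'.choose
  obtain ⟨h, hr⟩ := hb.exists_isReparam hp.projective.toIsParametrisation
  have ha := hp.subset (left_mem_Icc.2 hp.le)
  have hb' := hp.subset (right_mem_Icc.2 hp.le)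
  have hII : uIcc p.2.2.1 p.2.2.2 ⊆ p.2.1 := by rw [uIcc_of_le hp.le]; exact hp.subset
  rw [intervalIntegral.integral_congr fun t ht => hp.projective.zeta_eq (hII ht),
    hr.integral_arcDensity hm hb ha hb']
  have himg := hp.image_eq
  have hmono := hr.strictMonoOn.monotoneOn ha hb' hp.le
  rw [hr.image_Icc hp.le hp.subset,
    hb.injOn.image_eq_image_iff
      (hb.geodesic.ordConnected.out (hr.mapsTo ha) (hr.mapsTo hb')) hI] at himg
  obtain ⟨e1, e2⟩ := (Icc_eq_Icc_iff hmono).1 himg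
  rw [e1, e2]

/-- The arc form of the light ray is characterised by its value on the velocity of the
geodesic. -/
lemma isArcForm_iff (hm : 3 ≤ m) (hb : S.IsFutureGeodesic g γ₀ I₀)
    (θ : ∀ x : M, TangentSpace 𝓘(ℝ, Model m) x →L[ℝ] ℝ) : S.IsArcForm (γ₀ '' I₀) θ ↔
      ∀ s ∈ I₀, θ (γ₀ s) (vel γ₀ s) = hb.density s := by
  let θ' : M → Model m →L[ℝ] ℝ := θ
  have key : ∀ {γ : ℝ → M} {I : Set ℝ} {h : ℝ → ℝ}, IsReparam m γ₀ I₀ γ I h → ∀ t ∈ I,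
      θ (γ t) (velocity γ t) = θ (γ₀ (h t)) (vel γ₀ (h t)) * deriv h t := by
    intro γ I h hr t ht
    change θ' (γ t) (vel γ t) = θ' (γ₀ (h t)) (vel γ₀ (h t)) * deriv h t
    rw [hr.vel_eq t ht, hr.eq t ht, map_smul, smul_eq_mul, mul_comm]
  constructor
  · intro hθ s hs
    obtain ⟨γ, I, h, hr, h0, rfl, hric⟩ := hb.exists_projective hm hs
    have h1 := hθ γ I ⟨hr.isParametrisation hb, hric⟩ 0 h0
    rw [S.zeta_eq_arcDensity (hric 0 h0), hr.arcDensity_eq_density hm hb h0, key hr 0 h0] at h1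
    exact mul_right_cancel₀ (hr.deriv_pos 0 h0).ne' h1
  · intro hθ γ I hp t ht
    obtain ⟨h, hr⟩ := hb.exists_isReparam hp.toIsParametrisation
    rw [key hr t ht, hp.zeta_eq ht, hr.arcDensity_eq_density hm hb ht, hθ _ (hr.mapsTo ht)]

lemma exists_isArcForm (hm : 3 ≤ m) (hb : S.IsFutureGeodesic g γ₀ I₀) :
    ∃ θ : ∀ x : M, TangentSpace 𝓘(ℝ, Model m) x →L[ℝ] ℝ, S.IsArcForm (γ₀ '' I₀) θ := by
  have hex : ∀ x : M, ∃ L : Model m →L[ℝ] ℝ, ∀ s ∈ I₀, γ₀ s = x → L (vel γ₀ s) = hb.density s := by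
    intro x
    by_cases hx : x ∈ γ₀ '' I₀
    · obtain ⟨s, hs, rfl⟩ := hx
      obtain ⟨L, hL⟩ := SeparatingDual.exists_eq_one (R := ℝ) (hb.vel_ne_zero hs)
      refine ⟨hb.density s • L, fun r hr hrs => ?_⟩
      rw [hb.injOn hr hs hrs, smul_apply, hL, smul_eq_mul, mul_one]
    · exact ⟨0, fun s hs hsx => absurd ⟨s, hs, hsx⟩ hx⟩
  choose θ hθ using hex
  exact ⟨θ, (hb.isArcForm_iff hm θ).2 fun s hs => hθ _ s hs rfl⟩

/-- The arc form in an arbitrary parametrisation. -/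
lemma arcForm_eq (hm : 3 ≤ m) (hb : S.IsFutureGeodesic g γ₀ I₀)
    {θ : ∀ x : M, TangentSpace 𝓘(ℝ, Model m) x →L[ℝ] ℝ} (hθ : S.IsArcForm (γ₀ '' I₀) θ)
    {γ : ℝ → M} {I : Set ℝ} {h : ℝ → ℝ} (hr : IsReparam m γ₀ I₀ γ I h) {t : ℝ} (ht : t ∈ I) :
    θ (γ t) (velocity γ t) = S.arcDensity γ t := by
  let θ' : M → Model m →L[ℝ] ℝ := θ
  have h1 : θ' (γ₀ (h t)) (vel γ₀ (h t)) = hb.density (h t) :=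
    (hb.isArcForm_iff hm θ).1 hθ _ (hr.mapsTo ht)
  change θ' (γ t) (vel γ t) = _
  rw [hr.vel_eq t ht, hr.eq t ht, map_smul, smul_eq_mul, h1, hr.arcDensity_eq_density hm hb ht,
    mul_comm]

end Spacetime.IsFutureGeodesic

/-! ### The conformal arc parameter -/

namespace IsReparam

variable {γ : ℝ → M} {I : Set ℝ} {h : ℝ → ℝ} [T2Space M]

/-- Where the arc form does not vanish, its integral is a parameter with density one. -/
lemma exists_unit_density (hm : 3 ≤ m) (hr : IsReparam m γ₀ I₀ γ I h)
    (hb : S.IsFutureGeodesic g γ₀ I₀) (h0 : ∀ t ∈ I, S.arcDensity γ t ≠ 0) {t₀ : ℝ}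
    (ht₀ : t₀ ∈ I) : ∃ (σ : ℝ → M) (J : Set ℝ) (k : ℝ → ℝ), IsReparam m γ₀ I₀ σ J k ∧
      (∀ s ∈ J, S.arcDensity σ s = 1) ∧ σ '' J = γ '' I ∧
      ∀ t ∈ I, (∫ τ in t₀..t, S.arcDensity γ τ) ∈ J ∧
        σ (∫ τ in t₀..t, S.arcDensity γ τ) = γ t := by
  set u : ℝ → ℝ := fun t => ∫ τ in t₀..t, S.arcDensity γ τ with hu
  have hd := fun {t} (ht : t ∈ I) => hr.arcDensity_eq_density hm hb ht
  have hc := hr.continuousOn_arcDensity hm hb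
  have hu' : ∀ t ∈ I, HasDerivAt u (S.arcDensity γ t) t := fun t ht =>
    intervalIntegral.integral_hasDerivAt_right
      (hc.mono (hr.ordConnected.uIcc_subset ht₀ ht)).intervalIntegrable
      (hc.stronglyMeasurableAtFilter hr.isOpen t ht) (hc.continuousAt (hr.isOpen.mem_nhds ht))
  have hpos : ∀ t ∈ I, 0 < deriv u t := fun t ht => by
    rw [(hu' t ht).deriv]
    refine lt_of_le_of_ne ?_ (h0 t ht).symm
    rw [hd ht]
    exact mul_nonneg (S.arcLength_nonneg _ _ _) (hr.deriv_pos t ht).le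
  have hus : ContDiffOn ℝ ∞ u I := by
    rw [contDiffOn_infty_iff_deriv_of_isOpen hr.isOpen]
    refine ⟨fun t ht => (hu' t ht).differentiableAt.differentiableWithinAt, fun t ht => ?_⟩
    have h1 : hb.density (h t) ≠ 0 := fun h1 => h0 t ht (by rw [hd ht, h1, zero_mul])
    have h2 : ContDiffAt ℝ ∞ (fun t => hb.density (h t) * deriv h t) t :=
      ((hb.contDiffAt_density hm (hr.mapsTo ht) h1).comp t (hr.contDiffAt ht)).mul
        ((hr.contDiffAt ht).derivWithin (by simp))
    refine (h2.congr_of_eventuallyEq ?_).contDiffWithinAt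
    filter_upwards [hr.isOpen.mem_nhds ht] with s hs
    rw [(hu' s hs).deriv, hd hs]
  obtain ⟨k, hJo, hJc, hk, hku, hk'⟩ := exists_smooth_inverse hr.isOpen hr.ordConnected hus hpos
  have hder : ∀ t ∈ I, deriv (h ∘ k) (u t) = deriv h t * (deriv u t)⁻¹ := by
    intro t ht
    have h1 := ((hk.contDiffAt (hJo.mem_nhds (mem_image_of_mem u ht))).differentiableAt
      (by simp)).hasDerivAt
    have h2 := hr.hasDerivAt ht
    rw [← hku t ht] at h2
    rw [(h2.comp (u t) h1).deriv, hk' t ht, hku t ht]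
  have hkI : MapsTo k (u '' I) I := by
    rintro _ ⟨t, ht, rfl⟩
    rwa [hku t ht]
  have hs : IsReparam m γ₀ I₀ (γ₀ ∘ (h ∘ k)) (u '' I) (h ∘ k) :=
    of_comp hb hJo hJc (hr.contDiffOn.comp hk hkI) (hr.mapsTo.comp hkI) (by
      rintro _ ⟨t, ht, rfl⟩
      rw [hder t ht]
      exact mul_pos (hr.deriv_pos t ht) (inv_pos.2 (hpos t ht)))
  have hσ : ∀ t ∈ I, (γ₀ ∘ (h ∘ k)) (u t) = γ t := fun t ht => by
    rw [Function.comp_apply, Function.comp_apply, hku t ht, hr.eq t ht]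
  refine ⟨_, _, _, hs, ?_, ?_, fun t ht => ⟨mem_image_of_mem u ht, hσ t ht⟩⟩
  · rintro _ ⟨t, ht, rfl⟩
    rw [hs.arcDensity_eq_density hm hb (mem_image_of_mem u ht), hder t ht, Function.comp_apply,
      hku t ht, ← mul_assoc, ← hd ht, (hu' t ht).deriv, mul_inv_cancel₀ (h0 t ht)]
  · rw [← image_comp]
    exact image_congr hσ

/-- Two parameters with density one on the same arc differ by a translation: both are primitives of
the density in the geodesic parameter. -/
lemma exists_translation (hm : 3 ≤ m) (hb : S.IsFutureGeodesic g γ₀ I₀) {σ₁ σ₂ : ℝ → M}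
    {J₁ J₂ : Set ℝ} {h₁ h₂ : ℝ → ℝ} (hr₁ : IsReparam m γ₀ I₀ σ₁ J₁ h₁)
    (hr₂ : IsReparam m γ₀ I₀ σ₂ J₂ h₂) (hu₁ : ∀ s ∈ J₁, S.arcDensity σ₁ s = 1)
    (hu₂ : ∀ s ∈ J₂, S.arcDensity σ₂ s = 1) (himg : σ₁ '' J₁ = σ₂ '' J₂) :
    ∃ c : ℝ, (∀ s, s ∈ J₁ ↔ s + c ∈ J₂) ∧ ∀ s ∈ J₁, σ₂ (s + c) = σ₁ s := by
  rcases J₁.eq_empty_or_nonempty with rfl | ⟨s₁, hs₁⟩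
  · rw [image_empty, eq_comm, image_eq_empty] at himg
    subst himg
    exact ⟨0, by simp, by simp⟩
  have h12 : ∀ s ∈ J₁, ∃ r ∈ J₂, σ₂ r = σ₁ s := fun s hs => by
    have := mem_image_of_mem σ₁ hs
    rwa [himg] at this
  have h21 : ∀ r ∈ J₂, ∃ s ∈ J₁, σ₁ s = σ₂ r := fun r hr => by
    have := mem_image_of_mem σ₂ hr
    rwa [← himg] at this
  have hh : ∀ s ∈ J₁, ∀ r ∈ J₂, σ₂ r = σ₁ s → h₂ r = h₁ s := fun s hs r hr h =>
    hb.injOn (hr₂.mapsTo hr) (hr₁.mapsTo hs) (by rw [← hr₂.eq r hr, ← hr₁.eq s hs, h])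
  have hint : ∀ {σ : ℝ → M} {J : Set ℝ} {h : ℝ → ℝ}, IsReparam m γ₀ I₀ σ J h →
      (∀ s ∈ J, S.arcDensity σ s = 1) → ∀ a ∈ J, ∀ b ∈ J,
      ∫ s in h a..h b, hb.density s = b - a := by
    intro σ J h hr hu a ha b hb'
    rw [← hr.integral_arcDensity hm hb ha hb', intervalIntegral.integral_congr
      (g := fun _ => (1 : ℝ)) fun t ht => hu t (hr.ordConnected.uIcc_subset ha hb' ht)]
    simp
  obtain ⟨s₂, hs₂, h0⟩ := h12 s₁ hs₁
  have key : ∀ s ∈ J₁, ∀ r ∈ J₂, σ₂ r = σ₁ s → r = s + (s₂ - s₁) := by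
    intro s hs r hr h
    have e1 := hint hr₁ hu₁ s₁ hs₁ s hs
    have e2 := hint hr₂ hu₂ s₂ hs₂ r hr
    rw [hh s₁ hs₁ s₂ hs₂ h0, hh s hs r hr h, e1] at e2
    linarith
  refine ⟨s₂ - s₁, fun s => ⟨fun hs => ?_, fun hs => ?_⟩, fun s hs => ?_⟩
  · obtain ⟨r, hr, hrs⟩ := h12 s hs
    rwa [← key s hs r hr hrs]
  · obtain ⟨r, hr, hrs⟩ := h21 _ hs
    have := key r hr _ hs hrs.symm
    rwa [← add_right_cancel this] at hr
  · obtain ⟨r, hr, hrs⟩ := h12 s hs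
    rw [← key s hs r hr hrs, hrs]

end IsReparam

end ArcForm

/-! ### Conformal diffeomorphisms -/

section Conformal

variable {m : ℕ} {M : Type*} [TopologicalSpace M] [ChartedSpace (Model m) M]
  [IsManifold 𝓘(ℝ, Model m) ∞ M] {M' : Type*} [TopologicalSpace M'] [ChartedSpace (Model m) M']
  [IsManifold 𝓘(ℝ, Model m) ∞ M'] {φ : Diffeomorph 𝓘(ℝ, Model m) 𝓘(ℝ, Model m) M M' ∞}

/-- Every metric of the class of `M` is the pull-back of a metric of the class of `M'`. -/
lemma exists_isIsometry {C : ConformalClass m M} {C' : ConformalClass m M'}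
    (hφ : IsConformal C C' φ) {g : LorentzMetric m M} (hg : g ∈ C.metrics) :
    ∃ g' ∈ C'.metrics, IsIsometry g g' φ := by
  obtain ⟨k', hk', -⟩ := C'.isClass
  obtain ⟨k, hk, hkk⟩ := hφ k' hk'
  obtain ⟨f, hf⟩ := C.exists_isConformalFactor hk hg
  obtain ⟨g', hg', hf'⟩ := C'.exists_scale hk' (f := f ∘ φ.symm)
    (hf.smooth.comp φ.symm.contMDiff) (fun x => hf.pos _)
  refine ⟨g', hg', fun x u v => (hf.eq x u v).trans ?_⟩
  have h1 := hf'.eq (φ x) (tmap φ x u) (tmap φ x v)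
  rw [Function.comp_apply, φ.symm_apply_apply] at h1
  exact (congrArg (f x * ·) (hkk x u v)).trans h1.symm

lemma contMDiffAt_diffeo_comp (φ : Diffeomorph 𝓘(ℝ, Model m) 𝓘(ℝ, Model m) M M' ∞) {γ : ℝ → M}
    {t : ℝ} (hγ : ContMDiffAt 𝓘(ℝ, ℝ) 𝓘(ℝ, Model m) ∞ γ t) :
    ContMDiffAt 𝓘(ℝ, ℝ) 𝓘(ℝ, Model m) ∞ (φ ∘ γ) t :=
  φ.contMDiff.contMDiffAt.comp t hγ

lemma vel_diffeo_comp_ne_zero (φ : Diffeomorph 𝓘(ℝ, Model m) 𝓘(ℝ, Model m) M M' ∞) {γ : ℝ → M}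
    {t : ℝ} (hγ : ContMDiffAt 𝓘(ℝ, ℝ) 𝓘(ℝ, Model m) ∞ γ t) (hv : vel (m := m) γ t ≠ 0) :
    vel (m := m) (φ ∘ γ) t ≠ 0 := by
  rw [vel_diffeo_comp φ hγ, ← diffeoEquiv_apply]
  exact fun h => hv ((diffeoEquiv φ (γ t)).injective (h.trans (map_zero _).symm))

lemma IsIsometry.null {g : LorentzMetric m M} {g' : LorentzMetric m M'} (h : IsIsometry g g' φ)
    {γ : ℝ → M} {t : ℝ} (hγ : ContMDiffAt 𝓘(ℝ, ℝ) 𝓘(ℝ, Model m) ∞ γ t)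
    (hnull : g.form (γ t) (vel γ t) (vel γ t) = 0) :
    g'.form ((φ ∘ γ) t) (vel (φ ∘ γ) t) (vel (φ ∘ γ) t) = 0 := by
  rw [vel_diffeo_comp φ hγ, Function.comp_apply, ← h, hnull]

lemma IsIsometry.isNullGeodesicOn {g : LorentzMetric m M} {g' : LorentzMetric m M'}
    (h : IsIsometry g g' φ) {γ : ℝ → M} {I : Set ℝ} (hγ : g.IsNullGeodesicOn γ I) :
    g'.IsNullGeodesicOn (φ ∘ γ) I := by
  have hs : ∀ t ∈ I, ContMDiffAt 𝓘(ℝ, ℝ) 𝓘(ℝ, Model m) ∞ γ t := fun t ht =>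
    hγ.smooth.contMDiffAt (hγ.isOpen.mem_nhds ht)
  exact
    { isOpen := hγ.isOpen
      ordConnected := hγ.ordConnected
      nonempty := hγ.nonempty
      smooth := fun t ht => (contMDiffAt_diffeo_comp φ (hs t ht)).contMDiffWithinAt
      regular := fun t ht => vel_diffeo_comp_ne_zero φ (hs t ht) (hγ.regular t ht)
      null := fun t ht => h.null (hs t ht) (hγ.null t ht)
      geodesic := fun t ht => h.geodesicAt (hs t ht) (hγ.geodesic t ht) }

lemma IsConformal.isLightRay {C : ConformalClass m M} {C' : ConformalClass m M'}
    (hφ : IsConformal C C' φ) {Γ : Set M} (hΓ : C.IsLightRay Γ) : C'.IsLightRay (φ '' Γ) := by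
  obtain ⟨g, hg, γ, I, hγ, hmax, rfl⟩ := hΓ
  obtain ⟨g', hg', h⟩ := exists_isIsometry hφ hg
  refine ⟨g', hg', φ ∘ γ, I, h.isNullGeodesicOn hγ, fun γ' I' hγ' hII' heq => ?_, image_comp _ _ _⟩
  -- the inverse of `φ` maps an extension of `φ ∘ γ` to an extension of `γ`
  refine hmax _ I' (h.symm.isNullGeodesicOn hγ') hII' fun t ht => ?_
  rw [Function.comp_apply, heq ht, Function.comp_apply, φ.symm_apply_apply]

variable {S : Spacetime m M} {S' : Spacetime m M'} {g : LorentzMetric m M}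
  {g' : LorentzMetric m M'} {γ₀ γ : ℝ → M} {I₀ I : Set ℝ} {h : ℝ → ℝ}

namespace IsReparam

lemma diffeo_comp (hr : IsReparam m γ₀ I₀ γ I h) (hb : S.IsFutureGeodesic g γ₀ I₀)
    (φ : Diffeomorph 𝓘(ℝ, Model m) 𝓘(ℝ, Model m) M M' ∞) :
    IsReparam m (φ ∘ γ₀) I₀ (φ ∘ γ) I h where
  isOpen := hr.isOpen
  ordConnected := hr.ordConnected
  contDiffOn := hr.contDiffOn
  mapsTo := hr.mapsTo
  eq t ht := congrArg φ (hr.eq t ht)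
  deriv_pos := hr.deriv_pos
  vel_eq t ht := by
    rw [vel_diffeo_comp φ (hr.contMDiffAt hb ht), vel_diffeo_comp φ (hb.contMDiffAt (hr.mapsTo ht)),
      hr.vel_eq t ht, map_smul, hr.eq t ht]

lemma neg (hr : IsReparam m γ₀ I₀ γ I h)
    (hs₀ : ∀ s ∈ I₀, ContMDiffAt 𝓘(ℝ, ℝ) 𝓘(ℝ, Model m) ∞ γ₀ s) :
    IsReparam m (γ₀ ∘ Neg.neg) (Neg.neg ⁻¹' I₀) (γ ∘ Neg.neg) (Neg.neg ⁻¹' I)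
      (fun t => -h (-t)) := by
  have hs : ∀ t ∈ I, ContMDiffAt 𝓘(ℝ, ℝ) 𝓘(ℝ, Model m) ∞ γ t := fun t ht =>
    ((hs₀ _ (hr.mapsTo ht)).comp t (hr.contDiffAt ht).contMDiffAt).congr_of_eventuallyEq
      (hr.eventuallyEq ht)
  have hd : ∀ t, deriv (fun t => -h (-t)) t = deriv h (-t) := fun t => by
    rw [deriv.fun_neg, deriv_comp_neg, neg_neg]
  exact
    { isOpen := hr.isOpen.preimage continuous_neg
      ordConnected := ⟨fun a ha b hb c hc =>
        hr.ordConnected.out hb ha ⟨neg_le_neg hc.2, neg_le_neg hc.1⟩⟩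
      contDiffOn := (hr.contDiffOn.comp contDiff_neg.contDiffOn fun _ ht => ht).neg
      mapsTo := fun t ht => by
        rw [mem_preimage, neg_neg]
        exact hr.mapsTo ht
      eq := fun t ht => by
        rw [Function.comp_apply, Function.comp_apply, neg_neg, hr.eq _ ht]
      deriv_pos := fun t ht => by
        rw [hd]
        exact hr.deriv_pos _ ht
      vel_eq := fun t ht => by
        rw [hd, vel_neg (hs _ ht), vel_neg (by rw [neg_neg]; exact hs₀ _ (hr.mapsTo ht)), neg_neg,
          hr.vel_eq _ ht, smul_neg] }

end IsReparam

/-- The Ricci term of a curve with an adapted metric. -/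
lemma ConformalClass.ric_eq_trace (C : ConformalClass m M) (hg : g ∈ C.metrics) {t : ℝ}
    (hγ : ∀ᶠ s in 𝓝 t, ContMDiffAt 𝓘(ℝ, ℝ) 𝓘(ℝ, Model m) ∞ γ s)
    (hv : ∀ᶠ s in 𝓝 t, vel (m := m) γ s ≠ 0)
    (hnull : ∀ᶠ s in 𝓝 t, g.form (γ s) (vel γ s) (vel γ s) = 0) (ha : g.IsAdapted γ t) :
    C.ric γ t = LinearMap.trace ℝ _ (g.jac (γ t) (vel γ t)) := by
  rw [← C.trace_screenCurvature hg]
  unfold ConformalClass.ric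
  rw [C.curvature_eq hg hγ hv hnull ha]
  rfl

namespace IsReparam

variable [T2Space M]

/-- The Ricci term is invariant under conformal diffeomorphisms and reversals of the parameter. -/
lemma ric_diffeo (hr : IsReparam m γ₀ I₀ γ I h) (hb : S.IsFutureGeodesic g γ₀ I₀)
    (hφ : IsConformal S.toConformalClass S'.toConformalClass φ) {t : ℝ} (ht : t ∈ I) :
    S'.ric (φ ∘ γ) t = S.ric γ t ∧ S'.ric ((φ ∘ γ) ∘ Neg.neg) (-t) = S.ric γ t := by
  obtain ⟨k, hk, f, hf, ha, -⟩ := hr.exists_isAdapted hb ht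
  obtain ⟨k', hk', hiso⟩ := exists_isIsometry hφ hk
  have hmem : ∀ᶠ s in 𝓝 t, s ∈ I := hr.isOpen.mem_nhds ht
  have hnull : ∀ s ∈ I, k.form (γ s) (vel γ s) (vel γ s) = 0 := fun s hs =>
    (hf.eq _ _ _).trans ((congrArg (f (γ s) * ·) (hr.null hb hs)).trans (mul_zero _))
  have hs := fun {s} (hs : s ∈ I) => hr.contMDiffAt hb hs
  have h0 : S.ric γ t = LinearMap.trace ℝ _ (k.jac (γ t) (vel γ t)) :=
    S.ric_eq_trace hk (hmem.mono fun _ h => hs h) (hmem.mono fun _ h => hr.vel_ne_zero hb h)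
      (hmem.mono hnull) ha
  have hs' := fun {s} (h : s ∈ I) => contMDiffAt_diffeo_comp φ (hs h)
  have hv' := fun {s} (h : s ∈ I) => vel_diffeo_comp_ne_zero φ (hs h) (hr.vel_ne_zero hb h)
  have hn' := fun {s} (h : s ∈ I) => hiso.null (hs h) (hnull s h)
  have ha' : k'.IsAdapted (φ ∘ γ) t := by
    filter_upwards [ha, hmem] with s h1 h2 using hiso.geodesicAt (hs h2) h1
  have h1 : LinearMap.trace ℝ _ (k'.jac ((φ ∘ γ) t) (vel (φ ∘ γ) t)) = S.ric γ t := by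
    rw [h0, vel_diffeo_comp φ (hs ht)]
    exact hiso.trace_jac _ _
  have htend : Tendsto (Neg.neg : ℝ → ℝ) (𝓝 (-t)) (𝓝 t) := by
    simpa using (continuous_neg (G := ℝ)).tendsto (-t)
  have hmem' := htend.eventually hmem
  have hneg : ContDiff ℝ ∞ (Neg.neg : ℝ → ℝ) := contDiff_neg
  constructor
  · rw [← h1]
    exact S'.ric_eq_trace hk' (hmem.mono fun _ h => hs' h) (hmem.mono fun _ h => hv' h)
      (hmem.mono fun _ h => hn' h) ha'
  · rw [S'.ric_eq_trace hk' (γ := (φ ∘ γ) ∘ Neg.neg)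
      (hmem'.mono fun s h => (hs' h).comp s hneg.contMDiff.contMDiffAt)
      (hmem'.mono fun s h => by
        rw [vel_neg (hs' h)]
        exact neg_ne_zero.2 (hv' h))
      (hmem'.mono fun s h => by
        rw [vel_neg (hs' h)]
        simpa using hn' h)
      ((htend.eventually (ha'.and hmem)).mono fun s h => geodesicAt_neg (hs' h.2) h.1), ← h1,
      vel_neg (hs' (by rwa [neg_neg])), Function.comp_apply, neg_neg]
    congr 1
    refine LinearMap.ext fun w => ?_
    rw [← neg_one_smul ℝ, k'.jac_smul]
    simp

end IsReparam

/-- Segments and their lengths are invariant under conformal diffeomorphisms. If the time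
orientation is not preserved, the image of a parametrisation has to be reversed. -/
lemma IsConformal.exists_isProjectiveSegment [T2Space M] [T2Space M'] (hm : 3 ≤ m)
    (hφ : IsConformal S.toConformalClass S'.toConformalClass φ) {Γ Γ₀ : Set M}
    (hΓ : S.IsLightRay Γ) (hΓ₀ : ∃ γ I a b, S.IsProjectiveSegment Γ Γ₀ γ I a b) :
    (∃ γ I a b, S'.IsProjectiveSegment (φ '' Γ) (φ '' Γ₀) γ I a b) ∧
      S'.conformalLength (φ '' Γ) (φ '' Γ₀) = S.conformalLength Γ Γ₀ := by
  obtain ⟨g, γ₀, I₀, hb, rfl⟩ := S.exists_isFutureGeodesic hΓ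
  obtain ⟨γ, I, a, b, hp⟩ := id hΓ₀
  obtain ⟨h, hr⟩ := hb.exists_isReparam hp.projective.toIsParametrisation
  obtain ⟨g', hg', hiso⟩ := exists_isIsometry hφ hb.mem
  have himg := hp.image_eq
  have ha := hp.subset (left_mem_Icc.2 hp.le)
  have hb' := hp.subset (right_mem_Icc.2 hp.le)
  have hI := hb.geodesic.ordConnected.out (hr.mapsTo ha) (hr.mapsTo hb')
  rw [hr.image_Icc hp.le hp.subset] at himg
  subst himg
  rw [hb.conformalLength_eq hm hI hΓ₀]
  have hdens : ∀ s ∈ I₀, S'.arcLength hg' ((φ ∘ γ₀) s) (vel (φ ∘ γ₀) s) = hb.density s :=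
    fun s hs => by
      rw [vel_diffeo_comp φ (hb.contMDiffAt hs)]
      exact hiso.arcLength_eq S.toConformalClass hb.mem hg' _ (hb.vel_ne_zero hs) (hb.null hs)
  have hII : uIcc (h a) (h b) ⊆ I₀ :=
    hb.geodesic.ordConnected.uIcc_subset (hr.mapsTo ha) (hr.mapsTo hb')
  have hr' := hr.diffeo_comp hb φ
  have hseg : (φ ∘ γ) '' Icc a b = (φ ∘ γ₀) '' Icc (h a) (h b) := hr'.image_Icc hp.le hp.subset
  rw [← image_comp, ← image_comp]
  have hgeo := hiso.isNullGeodesicOn hb.geodesic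
  have hs₀ := fun s (hs : s ∈ I₀) => contMDiffAt_diffeo_comp φ (hb.contMDiffAt hs)
  rcases S'.future_or_neg hg' hgeo with hf | hf
  · have hex : ∃ γ' I' a' b', S'.IsProjectiveSegment ((φ ∘ γ₀) '' I₀)
        ((φ ∘ γ₀) '' Icc (h a) (h b)) γ' I' a' b' := by
      refine ⟨φ ∘ γ, I, a, b, ⟨hr'.isParametrisation hf, fun t ht => ?_⟩, hp.le, hp.subset, hseg⟩
      rw [(hr.ric_diffeo hb hφ ht).1, hp.projective.ric_eq_zero t ht]
    refine ⟨hex, ?_⟩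
    rw [hf.conformalLength_eq hm hI hex]
    exact intervalIntegral.integral_congr fun s hs => hdens s (hII hs)
  · have hrn := hr'.neg hs₀
    have e1 : ∀ A : Set ℝ, ((φ ∘ γ₀) ∘ Neg.neg) '' (Neg.neg ⁻¹' A) = (φ ∘ γ₀) '' A := fun A => by
      rw [image_comp, image_preimage_eq _ neg_surjective]
    have e2 : ∀ x y : ℝ, (Neg.neg ⁻¹' Icc x y : Set ℝ) = Icc (-y) (-x) := by simp
    rw [← e1 I₀, ← e1 (Icc (h a) (h b)), e2]
    have hex : ∃ γ' I' a' b', S'.IsProjectiveSegment (((φ ∘ γ₀) ∘ Neg.neg) '' (Neg.neg ⁻¹' I₀))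
        (((φ ∘ γ₀) ∘ Neg.neg) '' Icc (-h b) (-h a)) γ' I' a' b' := by
      refine ⟨(φ ∘ γ) ∘ Neg.neg, Neg.neg ⁻¹' I, -b, -a, ⟨hrn.isParametrisation hf, fun t ht => ?_⟩,
        neg_le_neg hp.le, ?_, ?_⟩
      · have h1 := (hr.ric_diffeo hb hφ ht).2
        rw [neg_neg] at h1
        rw [h1, hp.projective.ric_eq_zero _ ht]
      · rw [← e2]
        exact preimage_mono hp.subset
      · rw [← e2, ← e2, e1, image_comp, image_preimage_eq _ neg_surjective, hseg]
    refine ⟨hex, ?_⟩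
    rw [hf.conformalLength_eq hm (by rw [← e2]; exact preimage_mono hI) hex,
      ← intervalIntegral.integral_comp_neg]
    refine intervalIntegral.integral_congr fun s hs => ?_
    have hs' := hII hs
    have hv := vel_diffeo_comp_ne_zero φ (hb.contMDiffAt hs') (hb.vel_ne_zero hs')
    have h1 : vel (m := m) ((φ ∘ γ₀) ∘ Neg.neg) (-s) = (-1 : ℝ) • vel (φ ∘ γ₀) s := by
      rw [vel_neg (by rw [neg_neg]; exact hs₀ s hs'), neg_neg, neg_one_smul]
    change S'.arcLength hg' (((φ ∘ γ₀) ∘ Neg.neg) (-s)) (vel ((φ ∘ γ₀) ∘ Neg.neg) (-s)) = _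
    rw [h1, Function.comp_apply, neg_neg, S'.arcLength_smul hm hg' _ hv
      (hiso.null (hb.contMDiffAt hs') (hb.null hs')) (by norm_num), hdens s hs']
    simp

end Conformal

end LightRay

end

theorem mainTheorem3 {m : ℕ} (hm : 3 ≤ m) {M : Type*} [TopologicalSpace M] [T2Space M]
    [SecondCountableTopology M] [ChartedSpace (Model m) M] [IsManifold 𝓘(ℝ, Model m) ∞ M]
    (S : Spacetime m M) (Γ : Set M) (hΓ : S.IsLightRay Γ) :
    -- `R_γ(t)` is defined by an adapted metric, which exists, and does not depend on its choice
    (∀ (γ : ℝ → M) (I : Set ℝ), S.IsParametrisation Γ γ I → ∀ t ∈ I,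
      (∃ g ∈ S.metrics, g.IsAdapted γ t) ∧
      ∀ (g : LorentzMetric m M) (hg : g ∈ S.metrics), g.IsAdapted γ t →
        S.curvature γ t = S.screenCurvature hg (γ t) (velocity γ t)) ∧
    -- projective parametrisations exist around every point of the light ray
    (∀ x ∈ Γ, ∃ (γ : ℝ → M) (I : Set ℝ), S.IsProjective Γ γ I ∧ x ∈ γ '' I) ∧
    -- the length is computed by every projective parametrisation
    (∀ (Γ₀ : Set M) (γ : ℝ → M) (I : Set ℝ) (a b : ℝ), S.IsProjectiveSegment Γ Γ₀ γ I a b →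
      IntervalIntegrable (S.zeta γ) volume a b ∧
      S.conformalLength Γ Γ₀ = ∫ t in a..b, S.zeta γ t) ∧
    -- conformal invariance of light rays and of the length
    (∀ (M' : Type*) [TopologicalSpace M'] [T2Space M'] [SecondCountableTopology M']
      [ChartedSpace (Model m) M'] [IsManifold 𝓘(ℝ, Model m) ∞ M'] (S' : Spacetime m M')
      (φ : Diffeomorph 𝓘(ℝ, Model m) 𝓘(ℝ, Model m) M M' ∞),
      IsConformal S.toConformalClass S'.toConformalClass φ →
      S'.IsLightRay (φ '' Γ) ∧
      ∀ Γ₀ : Set M, (∃ γ I a b, S.IsProjectiveSegment Γ Γ₀ γ I a b) →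
        (∃ γ I a b, S'.IsProjectiveSegment (φ '' Γ) (φ '' Γ₀) γ I a b) ∧
        S'.conformalLength (φ '' Γ) (φ '' Γ₀) = S.conformalLength Γ Γ₀) ∧
    -- the 1-form `ds_Γ` exists
    (∃ θ : ∀ x : M, TangentSpace 𝓘(ℝ, Model m) x →L[ℝ] ℝ, S.IsArcForm Γ θ) ∧
    (∀ θ : ∀ x : M, TangentSpace 𝓘(ℝ, Model m) x →L[ℝ] ℝ, S.IsArcForm Γ θ →
      -- its expression in an arbitrary parametrisation (so it is unique on `Γ`)
      (∀ (γ : ℝ → M) (I : Set ℝ), S.IsParametrisation Γ γ I → ∀ t ∈ I,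
        θ (γ t) (velocity γ t) =
          |LinearMap.det (S.curvature γ t - (S.ric γ t / ((m : ℝ) - 2)) • LinearMap.id)| ^
            (1 / (2 * ((m : ℝ) - 2)))) ∧
      -- `L(Γ₀)` is the integral of `ds_Γ` over `Γ₀`, in any parametrisation
      (∀ (γ : ℝ → M) (I : Set ℝ) (a b : ℝ), S.IsParametrisation Γ γ I → a ≤ b → Icc a b ⊆ I →
        IntervalIntegrable (fun t => θ (γ t) (velocity γ t)) volume a b ∧
        ((∃ γ' I' a' b', S.IsProjectiveSegment Γ (γ '' Icc a b) γ' I' a' b') →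
          S.conformalLength Γ (γ '' Icc a b) = ∫ t in a..b, θ (γ t) (velocity γ t))) ∧
      -- where `ds_Γ ≠ 0`, it integrates to a conformal arc parameter
      (∀ (γ : ℝ → M) (I : Set ℝ), S.IsParametrisation Γ γ I →
        (∀ t ∈ I, θ (γ t) (velocity γ t) ≠ 0) → ∀ t₀ ∈ I,
        ∃ (σ : ℝ → M) (J : Set ℝ), S.IsArcParametrisation Γ θ σ J ∧ σ '' J = γ '' I ∧
          ∀ t ∈ I, (∫ τ in t₀..t, θ (γ τ) (velocity γ τ)) ∈ J ∧
            σ (∫ τ in t₀..t, θ (γ τ) (velocity γ τ)) = γ t) ∧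
      -- the conformal arc parameter is unique up to translation
      (∀ (σ₁ σ₂ : ℝ → M) (J₁ J₂ : Set ℝ), S.IsArcParametrisation Γ θ σ₁ J₁ →
        S.IsArcParametrisation Γ θ σ₂ J₂ → σ₁ '' J₁ = σ₂ '' J₂ →
        ∃ c : ℝ, (∀ s, s ∈ J₁ ↔ s + c ∈ J₂) ∧ ∀ s ∈ J₁, σ₂ (s + c) = σ₁ s)) := by
  obtain ⟨g, γ₀, I₀, hb, rfl⟩ := S.exists_isFutureGeodesic hΓ
  refine ⟨fun γ I hp t ht => ?_, ?_, fun Γ₀ γ I a b hp => ?_, fun M' _ _ _ _ _ S' φ hφ =>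
    ⟨hφ.isLightRay hΓ, fun Γ₀ hΓ₀ => hφ.exists_isProjectiveSegment hm hΓ hΓ₀⟩,
    hb.exists_isArcForm hm, fun θ hθ => ⟨fun γ I hp t ht => ?_, fun γ I a b hp hab hI => ?_,
    fun γ I hp h0 t₀ ht₀ => ?_, fun σ₁ σ₂ J₁ J₂ hp₁ hp₂ himg => ?_⟩⟩
  · obtain ⟨h, hr⟩ := hb.exists_isReparam hp
    obtain ⟨k, hk, -, -, ha, -⟩ := hr.exists_isAdapted hb ht
    exact ⟨⟨k, hk, ha⟩, fun k' hk' ha' => hr.curvature_eq hb ht hk' ha'⟩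
  · rintro _ ⟨s, hs, rfl⟩
    obtain ⟨γ, I, h, hr, h0, rfl, hric⟩ := hb.exists_projective hm hs
    exact ⟨γ, I, ⟨hr.isParametrisation hb, hric⟩, 0, h0, hr.eq 0 h0⟩
  · obtain ⟨h, hr⟩ := hb.exists_isReparam hp.projective.toIsParametrisation
    have ha := hp.subset (left_mem_Icc.2 hp.le)
    have hb' := hp.subset (right_mem_Icc.2 hp.le)
    have hI : uIcc a b ⊆ I := by
      rw [uIcc_of_le hp.le]
      exact hp.subset
    have hz : EqOn (S.zeta γ) (S.arcDensity γ) (uIcc a b) := fun t ht =>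
      hp.projective.zeta_eq (hI ht)
    refine ⟨(((hr.continuousOn_arcDensity hm hb).mono hI).congr hz).intervalIntegrable, ?_⟩
    have himg := hp.image_eq
    rw [hr.image_Icc hp.le hp.subset] at himg
    subst himg
    rw [intervalIntegral.integral_congr hz, hr.integral_arcDensity hm hb ha hb',
      hb.conformalLength_eq hm (hb.geodesic.ordConnected.out (hr.mapsTo ha) (hr.mapsTo hb'))
        ⟨γ, I, a, b, hp⟩]
  · obtain ⟨h, hr⟩ := hb.exists_isReparam hp
    exact hb.arcForm_eq hm hθ hr ht
  · obtain ⟨h, hr⟩ := hb.exists_isReparam hp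
    have ha := hI (left_mem_Icc.2 hab)
    have hb' := hI (right_mem_Icc.2 hab)
    have hII : uIcc a b ⊆ I := by rwa [uIcc_of_le hab]
    have hz : EqOn (fun t => θ (γ t) (velocity γ t)) (S.arcDensity γ) (uIcc a b) := fun t ht =>
      hb.arcForm_eq hm hθ hr (hII ht)
    refine ⟨(((hr.continuousOn_arcDensity hm hb).mono hII).congr hz).intervalIntegrable, ?_⟩
    rw [hr.image_Icc hab hI]
    intro hex
    rw [intervalIntegral.integral_congr hz, hr.integral_arcDensity hm hb ha hb',
      hb.conformalLength_eq hm (hb.geodesic.ordConnected.out (hr.mapsTo ha) (hr.mapsTo hb')) hex]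
  · obtain ⟨h, hr⟩ := hb.exists_isReparam hp
    have hz : EqOn (fun t => θ (γ t) (velocity γ t)) (S.arcDensity γ) I := fun t ht =>
      hb.arcForm_eq hm hθ hr ht
    obtain ⟨σ, J, k, hσ, hu, himg, hσγ⟩ :=
      hr.exists_unit_density hm hb (fun t ht => (hz ht).symm.trans_ne (h0 t ht)) ht₀
    refine ⟨σ, J, ⟨hσ.isParametrisation hb, fun s hs => ?_⟩, himg, fun t ht => ?_⟩
    · exact (hb.arcForm_eq hm hθ hσ hs).trans (hu s hs)
    · rw [intervalIntegral.integral_congr (hz.mono (hr.ordConnected.uIcc_subset ht₀ ht))]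
      exact hσγ t ht
  · obtain ⟨h₁, hr₁⟩ := hb.exists_isReparam hp₁.toIsParametrisation
    obtain ⟨h₂, hr₂⟩ := hb.exists_isReparam hp₂.toIsParametrisation
    exact IsReparam.exists_translation hm hb hr₁ hr₂
      (fun s hs => (hb.arcForm_eq hm hθ hr₁ hs).symm.trans (hp₁.unit_speed s hs))
      (fun s hs => (hb.arcForm_eq hm hθ hr₂ hs).symm.trans (hp₂.unit_speed s hs)) himg
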